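/- **Setting.** Let $\Lambda\subset\mathbb R^8$ be the $E_8$ root lattice, i.e. all vectors $(n_1,\dots,n_8)$ and $(n_1+\tfrac12,\dots,n_8+\tfrac12)$ with $n_i\in\mathbb Z$ and $\sum n_i$ even. An embedding is a triple $(V,a_1,a_3)$ of vectors of $\mathbb R^8$. The six Casas–Mondragón–Muñoz (CMM) observable embeddings $(V_A,a_{1A},a_{3A})$ of the $Z_3$ orbifold are given by $(3V_A;\,3a_{1A};\,3a_{3A})=$ - CMM 1: $(-1,-1,0,0,0,2,0,0)$; $(1,1,-1,-1,2,0,0,0)$; $(0,0,0,0,0,0,2,0)$ - CMM 2: $(-1,-1,0,0,0,2,0,0)$; $(1,1,-1,-1,-1,-1,0,0)$; $(0,0,0,0,0,0,2,0)$ - CMM 4: $(-1,-1,0,0,0,2,0,0)$; $(1,1,-1,-1,-1,0,1,0)$; $(0,0,0,0,0,0,2,0)$ - CMM 6: $(-1,-1,0,0,0,2,0,0)$; $(1,1,-1,-1,-1,2,1,0)$; $(0,0,0,0,0,1,1,2)$ - CMM 8: $(-1,-1,0,0,0,1,1,0)$; $(1,1,-1,-1,-1,1,1,1)$; $(0,0,0,0,0,1,2,1)$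 - CMM 9: $(-1,-1,0,0,0,1,1,0)$; $(1,1,-1,-1,-1,-2,0,1)$; $(0,0,0,0,0,0,0,2)$ A hidden embedding $(V_B,a_{1B},a_{3B})$ is consistent with one of them if three times each of the six vectors lies in $\Lambda$ and, for the sixteen-dimensional vectors $V=(V_A;V_B)$, $a_i=(a_{iA};a_{iB})$, the numbers $3V\cdot V$, $3V\cdot a_i$, $3a_i\cdot a_j$ ($i,j\in\{1,3\}$) are integers. A model is a CMM embedding with a consistent hidden embedding. Hidden embeddings are equivalent if they are related by a sequence of the operations (I) adding a vector of $\Lambda$ to one of the three vectors, and (II) applying one Weyl reflection $P\mapsto P-(P\cdot e)e$ ($e\in\Lambda$, $e\cdot e=2$) to all three vectors simultaneously. The hidden gauge group $G_H$ is the subgroup of the compact group $E_8$ left unbroken by the embedding, taken (as usual) up to finite coverings, i.e. through its Lie algebra: the subalgebra of the compact Lie algebra $\mathfrak e_8$ fixed by the three inner automorphisms which fix the Cartan generators and multiply the root vector $e_\alpha$ by $e^{2\pi i\,\alpha\cdot v}$, $v=V_B,a_{1B},a_{3B}$. The five cases are $$\begin{array}{ll}1.& SO(10)\times U(1)^3\\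 2.& SU(5)\times SU(2)\times U(1)^3\\ 3.& SU(4)\times SU(2)^2\times U(1)^3\\ 4.& SU(3)\times SU(2)^2\times U(1)^4\\ 5.& SU(2)^2\times U(1)^6\end{array}$$ A model is called viable (for dynamical supersymmetry breaking) if its $G_H$ is not that of Case 5. Let $\mathcal T$ be the explicit list of 175 hidden embeddings, each assigned to a CMM embedding and labelled by a case, which is tabulated as `displayedTable` in the formal definitions. **Theorem.** 1. For every hidden embedding consistent with one of the six CMM embeddings, $G_H$ is exactly one of the five groups above. 2. The 175 entries of $\mathcal T$ are distinct, each is consistent with its CMM embedding, and its $G_H$ is that of the case with which it is labelled. 3. There is a set of 192 models, complete in the sense that every hidden embedding consistent with one of the six CMM embeddings is equivalent to a hidden embedding which occurs in the set with the same CMM embedding, such that exactly the five groups above occur as $G_H$ in the set, the viable members of the set are exactly the 175 entries of $\mathcal T$, and exactly the four groups of Cases 1–4 occur among these. -/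

import Mathlib

open scoped Matrix ComplexConjugate

namespace HiddenSector

/-- The simple roots of `E₈`, in Bourbaki's numbering (the one of `CartanMatrix.E₈`). -/
noncomputable def simpleRoot : Fin 8 → Fin 8 → ℝ :=
  ![![1/2, -1/2, -1/2, -1/2, -1/2, -1/2, -1/2, 1/2],
    ![1, 1, 0, 0, 0, 0, 0, 0],
    ![-1, 1, 0, 0, 0, 0, 0, 0],
    ![0, -1, 1, 0, 0, 0, 0, 0],
    ![0, 0, -1, 1, 0, 0, 0, 0],
    ![0, 0, 0, -1, 1, 0, 0, 0],
    ![0, 0, 0, 0, -1, 1, 0, 0],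
    ![0, 0, 0, 0, 0, -1, 1, 0]]

/-- The vector `∑ mᵢ αᵢ` of `ℝ⁸` with integer coordinates `m` in the basis of simple roots. -/
noncomputable def latticeVec (m : Fin 8 → ℤ) : Fin 8 → ℝ :=
  ∑ i, (m i : ℝ) • simpleRoot i

/-- The scalar product of two root lattice vectors, in simple root coordinates. -/
def pairing (m n : Fin 8 → ℤ) : ℤ := m ⬝ᵥ CartanMatrix.E₈ *ᵥ n

/-- A bilinear form `q` with `q m n + q n m = pairing m n`, so that `q α α = 1` on the roots: half
of the diagonal plus the strictly upper triangular part of the Cartan matrix. -/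
def asymForm (m n : Fin 8 → ℤ) : ℤ :=
  ∑ i, m i * n i + ∑ i, ∑ j, if i < j then m i * CartanMatrix.E₈ i j * n j else 0

theorem asymForm_add_left (a b c : Fin 8 → ℤ) :
    asymForm (a + b) c = asymForm a c + asymForm b c := by
  simp [asymForm, Fin.sum_univ_eight, CartanMatrix.E₈]; ring

theorem asymForm_add_right (a b c : Fin 8 → ℤ) :
    asymForm a (b + c) = asymForm a b + asymForm a c := by
  simp [asymForm, Fin.sum_univ_eight, CartanMatrix.E₈]; ring

theorem asymForm_neg_left (a c : Fin 8 → ℤ) : asymForm (-a) c = -asymForm a c := by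
  simp [asymForm, Fin.sum_univ_eight, CartanMatrix.E₈]; ring

theorem asymForm_neg_right (a c : Fin 8 → ℤ) : asymForm a (-c) = -asymForm a c := by
  simp [asymForm, Fin.sum_univ_eight, CartanMatrix.E₈]; ring

theorem pairing_eq (a b : Fin 8 → ℤ) : pairing a b = asymForm a b + asymForm b a := by
  simp [pairing, asymForm, Fin.sum_univ_eight, CartanMatrix.E₈, dotProduct, Matrix.mulVec]; ring

theorem latticeVec_apply (m : Fin 8 → ℤ) : latticeVec m =
    ![(m 0 : ℝ) / 2 + m 1 - m 2, -((m 0 : ℝ) / 2) + m 1 + m 2 - m 3,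
      -((m 0 : ℝ) / 2) + m 3 - m 4, -((m 0 : ℝ) / 2) + m 4 - m 5,
      -((m 0 : ℝ) / 2) + m 5 - m 6, -((m 0 : ℝ) / 2) + m 6 - m 7,
      -((m 0 : ℝ) / 2) + m 7, (m 0 : ℝ) / 2] := by
  ext i
  fin_cases i <;> simp [latticeVec, Fin.sum_univ_eight, simpleRoot] <;> ring

theorem latticeVec_dot (a b : Fin 8 → ℤ) :
    latticeVec a ⬝ᵥ latticeVec b = (pairing a b : ℝ) := by
  rw [latticeVec_apply, latticeVec_apply]
  simp [pairing, Fin.sum_univ_eight, CartanMatrix.E₈, dotProduct, Matrix.mulVec]; ring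

theorem latticeVec_injective : Function.Injective latticeVec := by
  intro a b h
  rw [latticeVec_apply, latticeVec_apply] at h
  have h' := fun i => congrFun h i
  have h0 := h' 0; have h1 := h' 1; have h2 := h' 2; have h3 := h' 3
  have h4 := h' 4; have h5 := h' 5; have h6 := h' 6; have h7 := h' 7
  simp at h0 h1 h2 h3 h4 h5 h6 h7
  have e0 : (a 0 : ℝ) = b 0 := by rw [h7]
  have e7 : (a 7 : ℝ) = b 7 := by linarith
  have e6 : (a 6 : ℝ) = b 6 := by linarith
  have e5 : (a 5 : ℝ) = b 5 := by linarith
  have e4 : (a 4 : ℝ) = b 4 := by linarith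
  have e3 : (a 3 : ℝ) = b 3 := by linarith
  have e2 : (a 2 : ℝ) = b 2 := by linarith
  have e1 : (a 1 : ℝ) = b 1 := by linarith
  funext i
  fin_cases i <;> simp only [Fin.mk_zero, Fin.mk_one, Fin.reduceFinMk]
  exacts [h7, by exact_mod_cast e1, by exact_mod_cast e2, by exact_mod_cast e3,
    by exact_mod_cast e4, by exact_mod_cast e5, by exact_mod_cast e6, by exact_mod_cast e7]

/-- The `E₈` root lattice: the vectors with all entries `nᵢ`, or all entries `nᵢ + 1/2`, where the
`nᵢ` are integers with even sum. -/
def e8Lattice : Set (Fin 8 → ℝ) :=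
  {x | ∃ n : Fin 8 → ℤ, Even (∑ i, n i) ∧
    ((∀ i, x i = n i) ∨ (∀ i, x i = n i + 1 / 2))}
/-- The simple roots are a basis of the root lattice. -/
theorem range_latticeVec : Set.range latticeVec = e8Lattice := by
  ext x
  constructor
  · rintro ⟨m, rfl⟩
    rw [latticeVec_apply]
    rcases Int.even_or_odd' (m 0) with ⟨k, hk | hk⟩
    · refine ⟨![k + m 1 - m 2, -k + m 1 + m 2 - m 3, -k + m 3 - m 4,
      -k + m 4 - m 5, -k + m 5 - m 6, -k + m 6 - m 7, -k + m 7, k], ?_, Or.inl ?_⟩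
      · simp [Fin.sum_univ_eight]
        exact ⟨m 1 - 2 * k, by ring⟩
      · intro i
        fin_cases i <;> simp [hk]
    · refine ⟨![k + m 1 - m 2, -k-1 + m 1 + m 2 - m 3, -k-1 + m 3 - m 4,
      -k-1 + m 4 - m 5, -k-1 + m 5 - m 6, -k-1 + m 6 - m 7, -k-1 + m 7, k], ?_, Or.inr ?_⟩
      · simp [Fin.sum_univ_eight]
        exact ⟨m 1 - 2 * k - 3, by ring⟩
      · intro i
        fin_cases i <;> simp [hk] <;> ring
  · rintro ⟨n, ⟨s, hs⟩, h⟩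
    simp only [Fin.sum_univ_eight] at hs
    have hs' : (n 0 + n 1 + n 2 + n 3 + n 4 + n 5 + n 6 + n 7 : ℝ) = s + s := by
      exact_mod_cast hs
    rcases h with h | h
    · refine ⟨![2 * n 7, s + 2 * n 7, s + 3 * n 7 - n 0, n 2 + n 3 + n 4 + n 5 + n 6 + 5 * n 7,
        n 3 + n 4 + n 5 + n 6 + 4 * n 7, n 4 + n 5 + n 6 + 3 * n 7, n 5 + n 6 + 2 * n 7,
        n 6 + n 7], ?_⟩
      rw [latticeVec_apply]
      funext i
      rw [h i]
      fin_cases i <;> simp <;> linarith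
    · refine ⟨![2 * n 7 + 1, s + 2 * n 7 + 3, s + 3 * n 7 + 3 - n 0,
        n 2 + n 3 + n 4 + n 5 + n 6 + 5 * n 7 + 5,
        n 3 + n 4 + n 5 + n 6 + 4 * n 7 + 4, n 4 + n 5 + n 6 + 3 * n 7 + 3,
        n 5 + n 6 + 2 * n 7 + 2, n 6 + n 7 + 1], ?_⟩
      rw [latticeVec_apply]
      funext i
      rw [h i]
      fin_cases i <;> simp <;> linarith

/-- Twice the standard coordinates of a lattice vector. -/
def doubledVec (m : Fin 8 → ℤ) : Fin 8 → ℤ :=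
  ![m 0 + 2 * m 1 - 2 * m 2, -m 0 + 2 * m 1 + 2 * m 2 - 2 * m 3, -m 0 + 2 * m 3 - 2 * m 4,
    -m 0 + 2 * m 4 - 2 * m 5, -m 0 + 2 * m 5 - 2 * m 6, -m 0 + 2 * m 6 - 2 * m 7,
    -m 0 + 2 * m 7, m 0]

theorem four_mul_pairing_self (m : Fin 8 → ℤ) :
    4 * pairing m m = ∑ i, doubledVec m i ^ 2 := by
  simp [doubledVec, pairing, Fin.sum_univ_eight, CartanMatrix.E₈, dotProduct, Matrix.mulVec]
  ring

theorem latticeVec_eq_doubledVec (m : Fin 8 → ℤ) (i : Fin 8) :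
    latticeVec m i = (doubledVec m i : ℝ) / 2 := by
  rw [latticeVec_apply]
  fin_cases i <;> simp [doubledVec] <;> ring

theorem doubledVec_injective : Function.Injective doubledVec := by
  intro a b h
  apply latticeVec_injective
  funext i
  rw [latticeVec_eq_doubledVec, latticeVec_eq_doubledVec, h]

theorem pairing_self_nonneg (m : Fin 8 → ℤ) : 0 ≤ pairing m m := by
  have := four_mul_pairing_self m
  have h : 0 ≤ 4 * pairing m m := by rw [this]; exact Finset.sum_nonneg fun i _ => sq_nonneg _
  omega

theorem eq_zero_of_pairing_self (m : Fin 8 → ℤ) (h : pairing m m = 0) : m = 0 := by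
  have h1 : latticeVec m ⬝ᵥ latticeVec m = 0 := by rw [latticeVec_dot, h]; simp
  rw [dotProduct_self_eq_zero] at h1
  apply latticeVec_injective
  rw [h1]
  simp [latticeVec]

theorem pairing_comm (a b : Fin 8 → ℤ) : pairing a b = pairing b a := by
  rw [pairing_eq, pairing_eq, add_comm]

theorem pairing_add_left (a b c : Fin 8 → ℤ) :
    pairing (a + b) c = pairing a c + pairing b c := by
  simp only [pairing_eq, asymForm_add_left, asymForm_add_right]; ring

theorem pairing_add_right (a b c : Fin 8 → ℤ) :
    pairing a (b + c) = pairing a b + pairing a c := by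
  simp only [pairing_eq, asymForm_add_left, asymForm_add_right]; ring

theorem pairing_neg_left (a c : Fin 8 → ℤ) : pairing (-a) c = -pairing a c := by
  simp only [pairing_eq, asymForm_neg_left, asymForm_neg_right]; ring

theorem pairing_neg_right (a c : Fin 8 → ℤ) : pairing a (-c) = -pairing a c := by
  simp only [pairing_eq, asymForm_neg_left, asymForm_neg_right]; ring

/-- The 240 roots of `E₈`, i.e. the vectors of norm two of the root lattice, in simple root
coordinates. -/
abbrev Root : Type := {m : Fin 8 → ℤ // pairing m m = 2}

namespace Root

instance : Neg Root := ⟨fun α => ⟨-α.1, by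
  rw [pairing_neg_left, pairing_neg_right, neg_neg]; exact α.2⟩⟩

@[simp] theorem neg_val (α : Root) : (-α).1 = -α.1 := rfl

instance : InvolutiveNeg Root := ⟨fun α => Subtype.ext (neg_neg α.1)⟩

instance : Finite Root := by
  have hs : Set.Finite {m : Fin 8 → ℤ | pairing m m = 2} := by
    refine ((Set.finite_Icc (fun _ => -2 : Fin 8 → ℤ) (fun _ => 2)).preimage
      doubledVec_injective.injOn).subset ?_
    intro m hm
    have h := four_mul_pairing_self m
    rw [show pairing m m = 2 from hm] at h
    have key : ∀ i, doubledVec m i ^ 2 ≤ 8 := fun i => by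
      have := Finset.single_le_sum (f := fun i => doubledVec m i ^ 2)
        (fun i _ => sq_nonneg _) (Finset.mem_univ i)
      rw [← h] at this
      exact this
    exact ⟨fun i => show -2 ≤ doubledVec m i by nlinarith [key i],
      fun i => show doubledVec m i ≤ 2 by nlinarith [key i]⟩
  exact hs.to_subtype

noncomputable instance : Fintype Root := Fintype.ofFinite Root

end Root

theorem pairing_self_add (α β : Root) :
    pairing (α.1 + β.1) (α.1 + β.1) = 4 + 2 * pairing α.1 β.1 := by
  rw [pairing_add_left, pairing_add_right, pairing_add_right, α.2, β.2, pairing_comm β.1 α.1]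
  ring

theorem pairing_ge (α β : Root) : -2 ≤ pairing α.1 β.1 := by
  have := pairing_self_nonneg (α.1 + β.1)
  rw [pairing_self_add] at this
  omega

theorem eq_neg_of_pairing (α β : Root) (h : pairing α.1 β.1 = -2) : β = -α := by
  have := eq_zero_of_pairing_self (α.1 + β.1) (by rw [pairing_self_add, h]; rfl)
  exact Subtype.ext (by rw [Root.neg_val]; exact eq_neg_of_add_eq_zero_right this)

/-- The sign `ε(a, b) = (-1) ^ q(a, b)`. -/
noncomputable def cocycle (a b : Fin 8 → ℤ) : ℂ := (-1) ^ asymForm a b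

theorem cocycle_mul (a b : Fin 8 → ℤ) (c d : Fin 8 → ℤ) :
    cocycle a b * cocycle c d = (-1) ^ (asymForm a b + asymForm c d) := by
  rw [cocycle, cocycle, ← zpow_add₀ (by norm_num)]

theorem asymForm_self (α : Root) : asymForm α.1 α.1 = 1 := by
  have := α.2
  rw [pairing_eq] at this
  omega

/-- The value of the root `m` on the Cartan element `h`. -/
noncomputable def rootValue (m : Fin 8 → ℤ) : (Fin 8 → ℂ) →ₗ[ℂ] ℂ where
  toFun h := ∑ I, h I * (latticeVec m I : ℂ)
  map_add' := by intros; simp [add_mul, Finset.sum_add_distrib]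
  map_smul' := by intros; simp [mul_assoc, Finset.mul_sum]

theorem rootValue_apply (m : Fin 8 → ℤ) (h : Fin 8 → ℂ) :
    rootValue m h = ∑ I, h I * (latticeVec m I : ℂ) := rfl

theorem latticeVec_add (a b : Fin 8 → ℤ) : latticeVec (a + b) = latticeVec a + latticeVec b := by
  simp [latticeVec, add_smul, Finset.sum_add_distrib]

theorem latticeVec_neg (a : Fin 8 → ℤ) : latticeVec (-a) = -latticeVec a := by
  simp [latticeVec]

theorem rootValue_add (a b : Fin 8 → ℤ) (h : Fin 8 → ℂ) :
    rootValue (a + b) h = rootValue a h + rootValue b h := by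
  simp [rootValue_apply, latticeVec_add, mul_add, Finset.sum_add_distrib]

theorem rootValue_neg (a : Fin 8 → ℤ) (h : Fin 8 → ℂ) :
    rootValue (-a) h = -rootValue a h := by
  simp [rootValue_apply, latticeVec_neg]

theorem rootValue_latticeVec (a b : Fin 8 → ℤ) :
    rootValue a (fun I => (latticeVec b I : ℂ)) = (pairing a b : ℂ) := by
  have := latticeVec_dot b a
  rw [pairing_comm a b, rootValue_apply, ← Complex.ofReal_intCast, ← this, dotProduct]
  push_cast
  rfl

/-- The complex simple Lie algebra `E₈`: the elements are `∑ h_I H_I + ∑ x_α e_α` with the Cartan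
generators `H_1, …, H_8` and one root vector `e_α` for each root. The bracket is determined by
`[H_I, H_J] = 0`, `[H_I, e_α] = α_I e_α`, `[e_α, e_{-α}] = -∑ α_I H_I`, and, for `α + β ≠ 0`,
`[e_α, e_β] = ε(α, β) e_{α+β}` if `α + β` is a root, and `0` otherwise. -/
@[ext] structure E8Algebra where
  cartan : Fin 8 → ℂ
  root : Root → ℂ

namespace E8Algebra

/-- The two components, which carry the vector space structure. -/
def equivProd : E8Algebra ≃ (Fin 8 → ℂ) × (Root → ℂ) where
  toFun x := (x.cartan, x.root)
  invFun p := ⟨p.1, p.2⟩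

instance : AddCommGroup E8Algebra := equivProd.addCommGroup
noncomputable instance : Module ℂ E8Algebra := equivProd.module ℂ
noncomputable instance : Module ℝ E8Algebra := equivProd.module ℝ

theorem ext' {x y : E8Algebra} (h₁ : ∀ I, x.cartan I = y.cartan I)
    (h₂ : ∀ γ, x.root γ = y.root γ) : x = y := E8Algebra.ext (funext h₁) (funext h₂)

@[simp] theorem cartan_add (x y : E8Algebra) : (x + y).cartan = x.cartan + y.cartan := rfl
@[simp] theorem root_add (x y : E8Algebra) : (x + y).root = x.root + y.root := rfl
@[simp] theorem cartan_neg (x : E8Algebra) : (-x).cartan = -x.cartan := rfl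
@[simp] theorem root_neg (x : E8Algebra) : (-x).root = -x.root := rfl
@[simp] theorem cartan_zero : (0 : E8Algebra).cartan = 0 := rfl
@[simp] theorem root_zero : (0 : E8Algebra).root = 0 := rfl
@[simp] theorem cartan_smul (c : ℂ) (x : E8Algebra) : (c • x).cartan = c • x.cartan := rfl
@[simp] theorem root_smul (c : ℂ) (x : E8Algebra) : (c • x).root = c • x.root := rfl
@[simp] theorem cartan_real_smul (c : ℝ) (x : E8Algebra) :
    (c • x).cartan = c • x.cartan := rfl
@[simp] theorem root_real_smul (c : ℝ) (x : E8Algebra) : (c • x).root = c • x.root := rfl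

noncomputable instance : Bracket E8Algebra E8Algebra where
  bracket x y :=
    { cartan := fun I => -∑ α : Root, (latticeVec α.1 I : ℂ) * (x.root α * y.root (-α))
      root := fun γ => rootValue γ.1 x.cartan * y.root γ - rootValue γ.1 y.cartan * x.root γ +
        ∑ α : Root, ∑ β : Root,
          if α.1 + β.1 = γ.1 then cocycle α.1 β.1 * (x.root α * y.root β) else 0 }

theorem bracket_fst (x y : E8Algebra) (I) :
    ⁅x, y⁆.cartan I = -∑ α : Root, (latticeVec α.1 I : ℂ) * (x.root α * y.root (-α)) := rfl

theorem bracket_snd (x y : E8Algebra) (γ) :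
    ⁅x, y⁆.root γ = rootValue γ.1 x.cartan * y.root γ - rootValue γ.1 y.cartan * x.root γ +
      ∑ α : Root, ∑ β : Root,
        if α.1 + β.1 = γ.1 then cocycle α.1 β.1 * (x.root α * y.root β) else 0 := rfl

theorem add_bracket (x y z : E8Algebra) : ⁅x + y, z⁆ = ⁅x, z⁆ + ⁅y, z⁆ := by
  apply ext' <;> intro I
  · simp only [bracket_fst, cartan_add, root_add, Pi.add_apply, add_mul, mul_add, Finset.sum_add_distrib]; ring
  · simp only [bracket_snd, cartan_add, root_add, Pi.add_apply, map_add, add_mul, mul_add, ite_add_zero,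
      Finset.sum_add_distrib]; ring

theorem bracket_add (x y z : E8Algebra) : ⁅x, y + z⁆ = ⁅x, y⁆ + ⁅x, z⁆ := by
  apply ext' <;> intro I
  · simp only [bracket_fst, cartan_add, root_add, Pi.add_apply, mul_add, Finset.sum_add_distrib]; ring
  · simp only [bracket_snd, cartan_add, root_add, Pi.add_apply, map_add, add_mul, mul_add, ite_add_zero,
      Finset.sum_add_distrib]; ring

theorem smul_bracket (c : ℂ) (x y : E8Algebra) : ⁅c • x, y⁆ = c • ⁅x, y⁆ := by
  apply ext' <;> intro I
  · simp only [bracket_fst, cartan_smul, root_smul, Pi.smul_apply, smul_eq_mul, mul_neg, Finset.mul_sum]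
    congr 1; refine Finset.sum_congr rfl fun _ _ => by ring
  · simp only [bracket_snd, cartan_smul, root_smul, Pi.smul_apply, map_smul, smul_eq_mul, mul_add,
      Finset.mul_sum, mul_ite, mul_zero]
    congr 1
    · ring
    · refine Finset.sum_congr rfl fun _ _ => Finset.sum_congr rfl fun _ _ => ?_
      split_ifs <;> ring

theorem bracket_smul (c : ℂ) (x y : E8Algebra) : ⁅x, c • y⁆ = c • ⁅x, y⁆ := by
  apply ext' <;> intro I
  · simp only [bracket_fst, cartan_smul, root_smul, Pi.smul_apply, smul_eq_mul, mul_neg, Finset.mul_sum]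
    congr 1; refine Finset.sum_congr rfl fun _ _ => by ring
  · simp only [bracket_snd, cartan_smul, root_smul, Pi.smul_apply, map_smul, smul_eq_mul, mul_add,
      Finset.mul_sum, mul_ite, mul_zero]
    congr 1
    · ring
    · refine Finset.sum_congr rfl fun _ _ => Finset.sum_congr rfl fun _ _ => ?_
      split_ifs <;> ring

theorem bracket_self (x : E8Algebra) : ⁅x, x⁆ = 0 := by
  apply ext' <;> intro I
  · rw [bracket_fst, cartan_zero, Pi.zero_apply, neg_eq_zero]
    have h := Equiv.sum_comp (Equiv.neg Root)
      fun α : Root => (latticeVec α.1 I : ℂ) * (x.root α * x.root (-α))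
    simp only [Equiv.neg_apply, neg_neg] at h
    have h2 : ∀ α : Root, (latticeVec (-α).1 I : ℂ) * (x.root (-α) * x.root α)
        = -((latticeVec α.1 I : ℂ) * (x.root α * x.root (-α))) := by
      intro α
      rw [Root.neg_val]
      have : latticeVec (-α.1) I = -latticeVec α.1 I := by simp [latticeVec]
      rw [this]; push_cast; ring
    rw [Finset.sum_congr rfl (fun α _ => h2 α), Finset.sum_neg_distrib] at h
    exact self_eq_neg.mp h.symm
  · rename' I => γ
    rw [bracket_snd, root_zero, Pi.zero_apply, sub_self, zero_add]
    have h : ∀ α β : Root, (if α.1 + β.1 = γ.1 then cocycle α.1 β.1 * (x.root α * x.root β) else 0)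
        = -(if β.1 + α.1 = γ.1 then cocycle β.1 α.1 * (x.root β * x.root α) else 0) := by
      intro α β
      rw [add_comm β.1 α.1]
      split_ifs with hγ
      · have h1 := pairing_self_add α β
        rw [hγ, γ.2, pairing_eq] at h1
        have h2 : asymForm α.1 β.1 = asymForm β.1 α.1 + (-2 * asymForm β.1 α.1 - 1) := by omega
        have h3 : ((-1 : ℂ)) ^ (-2 * asymForm β.1 α.1 - 1) = -1 :=
          Odd.neg_one_zpow ⟨-asymForm β.1 α.1 - 1, by ring⟩
        have h4 : cocycle α.1 β.1 = -cocycle β.1 α.1 := by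
          rw [cocycle, cocycle, h2, zpow_add₀ (by norm_num), h3]; ring
        rw [h4]; ring
      · simp
    have h5 : ∀ S : ℂ, S = -S → S = 0 := fun S hS => self_eq_neg.mp hS
    apply h5
    conv_lhs => rw [Finset.sum_comm]
    simp only [← Finset.sum_neg_distrib]
    exact Finset.sum_congr rfl fun α _ => Finset.sum_congr rfl fun β _ => h β α

theorem bracket_skew (x y : E8Algebra) : ⁅x, y⁆ = -⁅y, x⁆ := by
  have := bracket_self (x + y)
  rw [add_bracket, bracket_add, bracket_add, bracket_self, bracket_self, zero_add, add_zero]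
    at this
  exact eq_neg_of_add_eq_zero_left this

/-- The Cartan elements `∑ h_I H_I`. -/
def hEl (h : Fin 8 → ℂ) : E8Algebra := ⟨h, 0⟩

/-- The root vector `e_m`, and `0` if `m` is not a root. -/
def eEl (m : Fin 8 → ℤ) : E8Algebra := ⟨0, fun γ => if γ.1 = m then 1 else 0⟩

@[simp] theorem hEl_cartan (h) : (hEl h).cartan = h := rfl
@[simp] theorem hEl_root (h) : (hEl h).root = 0 := rfl
@[simp] theorem eEl_cartan (m) : (eEl m).cartan = 0 := rfl
@[simp] theorem eEl_root (m γ) : (eEl m).root γ = if γ.1 = m then 1 else 0 := rfl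

@[simp] theorem cartan_sum {ι : Type*} (s : Finset ι) (f : ι → E8Algebra) :
    (∑ i ∈ s, f i).cartan = ∑ i ∈ s, (f i).cartan := by
  classical
  induction s using Finset.induction_on with
  | empty => simp
  | insert a s ha ih => simp [Finset.sum_insert ha, ih]

@[simp] theorem root_sum {ι : Type*} (s : Finset ι) (f : ι → E8Algebra) :
    (∑ i ∈ s, f i).root = ∑ i ∈ s, (f i).root := by
  classical
  induction s using Finset.induction_on with
  | empty => simp
  | insert a s ha ih => simp [Finset.sum_insert ha, ih]

theorem eEl_eq_zero (m) (h : pairing m m ≠ 2) : eEl m = 0 := by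
  apply ext' <;> intro γ
  · rfl
  · rw [eEl_root, root_zero, Pi.zero_apply, if_neg]
    rintro rfl
    exact h γ.2

theorem eq_sum (x : E8Algebra) : x = hEl x.cartan + ∑ α : Root, x.root α • eEl α.1 := by
  apply ext' <;> intro γ
  · simp
  · have : ∀ α : Root, (if γ.1 = α.1 then (1 : ℂ) else 0) = if γ = α then 1 else 0 := by
      intro α
      exact if_congr ⟨fun h => Subtype.ext h, fun h => h ▸ rfl⟩ rfl rfl
    simp [this]

theorem induction {P : E8Algebra → Prop} (hh : ∀ h, P (hEl h)) (he : ∀ α : Root, P (eEl α.1))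
    (ha : ∀ x y, P x → P y → P (x + y)) (hs : ∀ (c : ℂ) x, P x → P (c • x)) (x) : P x := by
  rw [eq_sum x]
  refine ha _ _ (hh _) ?_
  refine Finset.sum_induction _ P ha ?_ (fun α _ => hs _ _ (he α))
  simpa using hs 0 _ (hh 0)

theorem bracket_h_h (h k) : ⁅hEl h, hEl k⁆ = 0 := by
  apply ext' <;> intro γ
  · simp [bracket_fst]
  · simp [bracket_snd]

theorem bracket_h_e (h) (α : Root) : ⁅hEl h, eEl α.1⁆ = rootValue α.1 h • eEl α.1 := by
  apply ext' <;> intro γ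
  · simp [bracket_fst]
  · simp only [bracket_snd, hEl_cartan, eEl_root, eEl_cartan, map_zero, zero_mul, hEl_root,
      Pi.zero_apply, mul_zero, ite_self, Finset.sum_const_zero, sub_zero, add_zero,
      root_smul, Pi.smul_apply, smul_eq_mul]
    split_ifs with hγ
    · rw [Subtype.ext hγ]
    · simp

theorem bracket_e_e (α β : Root) : ⁅eEl α.1, eEl β.1⁆ =
    (if α.1 + β.1 = 0 then hEl (fun I => -(latticeVec α.1 I : ℂ)) else 0) +
      cocycle α.1 β.1 • eEl (α.1 + β.1) := by
  have hi : ∀ γ δ : Root, (γ.1 = δ.1) = (γ = δ) := fun γ δ =>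
    propext ⟨fun h => Subtype.ext h, fun h => h ▸ rfl⟩
  apply ext' <;> intro γ
  · rw [bracket_fst, Finset.sum_eq_single α]
    rotate_left
    · intro b _ hb; simp [hi, hb]
    · simp
    have h2 : (-α = β) ↔ α.1 + β.1 = 0 := by
      rw [← hi, Root.neg_val, neg_eq_iff_add_eq_zero]
    simp only [eEl_root, hi, h2]
    split_ifs <;> simp
  · have hr : (if α.1 + β.1 = 0 then hEl (fun I => -(latticeVec α.1 I : ℂ)) else 0).root γ = 0 := by
      split_ifs <;> simp
    simp only [bracket_snd, eEl_root, eEl_cartan, map_zero, zero_add, hi,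
      root_add, Pi.add_apply, hr, root_smul, Pi.smul_apply, smul_eq_mul, mul_ite, mul_one,
      mul_zero]
    rw [Finset.sum_eq_single α, Finset.sum_eq_single β]
    · simp [eq_comm]
    · intro b _ hb; simp [hb]
    · simp
    · intro b _ hb; simp [hb]
    · simp

theorem bracket_zero (x : E8Algebra) : ⁅x, (0 : E8Algebra)⁆ = 0 := by
  simpa using bracket_smul 0 x 0

theorem zero_bracket (x : E8Algebra) : ⁅(0 : E8Algebra), x⁆ = 0 := by
  simpa using smul_bracket 0 0 x

theorem bracket_neg (x y : E8Algebra) : ⁅x, -y⁆ = -⁅x, y⁆ := by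
  simpa using bracket_smul (-1) x y

theorem neg_bracket (x y : E8Algebra) : ⁅-x, y⁆ = -⁅x, y⁆ := by
  simpa using smul_bracket (-1) x y

theorem bracket_hEl_eEl (h) (m : Fin 8 → ℤ) : ⁅hEl h, eEl m⁆ = rootValue m h • eEl m := by
  by_cases hm : pairing m m = 2
  · exact bracket_h_e h ⟨m, hm⟩
  · rw [eEl_eq_zero m hm, bracket_zero, smul_zero]

theorem bracket_eEl_hEl (h) (m : Fin 8 → ℤ) : ⁅eEl m, hEl h⁆ = -(rootValue m h • eEl m) := by
  rw [bracket_skew, bracket_hEl_eEl]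

theorem hEl_neg (h : Fin 8 → ℂ) : hEl (fun I => -h I) = -hEl h := by
  apply ext' <;> intro I <;> simp

theorem eEl_zero : eEl 0 = 0 := eEl_eq_zero 0 (by simp [pairing])

/-- The Jacobi identity -/
def Jacobi (x y z : E8Algebra) : Prop := ⁅x, ⁅y, z⁆⁆ = ⁅⁅x, y⁆, z⁆ + ⁅y, ⁅x, z⁆⁆

theorem Jacobi.swap_left {x y z : E8Algebra} (h : Jacobi x y z) : Jacobi y x z := by
  unfold Jacobi at *
  rw [h, bracket_skew y x, neg_bracket]; abel

theorem Jacobi.swap_right {x y z : E8Algebra} (h : Jacobi x y z) : Jacobi x z y := by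
  unfold Jacobi at *
  rw [bracket_skew z y, bracket_neg, h, bracket_skew ⁅x, z⁆ y, bracket_skew z ⁅x, y⁆]; abel

theorem jacobi_h_h_e (h k) (m : Fin 8 → ℤ) : Jacobi (hEl h) (hEl k) (eEl m) := by
  unfold Jacobi
  rw [bracket_h_h, zero_bracket, bracket_hEl_eEl, bracket_hEl_eEl, bracket_smul, bracket_smul,
    bracket_hEl_eEl, bracket_hEl_eEl, smul_smul, smul_smul, mul_comm, zero_add]

theorem jacobi_h_h_h (h k l) : Jacobi (hEl h) (hEl k) (hEl l) := by
  unfold Jacobi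
  simp [bracket_h_h, zero_bracket, bracket_zero]

theorem jacobi_h_e_e (h) (α β : Root) : Jacobi (hEl h) (eEl α.1) (eEl β.1) := by
  unfold Jacobi
  rw [bracket_hEl_eEl, bracket_hEl_eEl, smul_bracket, bracket_smul, ← add_smul, bracket_e_e,
    bracket_add, bracket_smul, bracket_hEl_eEl, ← rootValue_add]
  split_ifs with h0
  · rw [bracket_h_h, h0, eEl_zero]
    have : rootValue 0 h = 0 := by simp [rootValue_apply, latticeVec]
    simp [this]
  · rw [bracket_zero, zero_add, zero_add, smul_comm]

theorem bracket_e_e_of_eq (α β : Root) (h : pairing α.1 β.1 = -2) :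
    ⁅eEl α.1, eEl β.1⁆ = -hEl (fun I => (latticeVec α.1 I : ℂ)) := by
  have hβ := eq_neg_of_pairing α β h
  have h0 : α.1 + β.1 = 0 := by rw [hβ, Root.neg_val, add_neg_cancel]
  rw [bracket_e_e, if_pos h0, h0, eEl_zero, smul_zero, add_zero, hEl_neg]

theorem bracket_e_e_of_ne (α β : Root) (h : pairing α.1 β.1 ≠ -2) :
    ⁅eEl α.1, eEl β.1⁆ = cocycle α.1 β.1 • eEl (α.1 + β.1) := by
  rw [bracket_e_e, if_neg, zero_add]
  intro h0
  apply h
  rw [eq_neg_of_add_eq_zero_right h0, pairing_neg_right, α.2]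

theorem bracket_e_e_of_nonneg (α β : Root) (h : 0 ≤ pairing α.1 β.1) :
    ⁅eEl α.1, eEl β.1⁆ = 0 := by
  rw [bracket_e_e_of_ne _ _ (by omega), eEl_eq_zero, smul_zero]
  rw [pairing_self_add]
  omega

/-- The sum of two roots at an angle of 120 degrees. -/
def addRoot (β δ : Root) (h : pairing β.1 δ.1 = -1) : Root :=
  ⟨β.1 + δ.1, by rw [pairing_self_add, h]; rfl⟩

theorem bracket_triple_neg_two (α β δ : Root) (h : pairing β.1 δ.1 = -2) :
    ⁅eEl α.1, ⁅eEl β.1, eEl δ.1⁆⁆ = (pairing α.1 β.1 : ℂ) • eEl α.1 := by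
  rw [bracket_e_e_of_eq _ _ h, bracket_neg, bracket_eEl_hEl, neg_neg, rootValue_latticeVec]

theorem bracket_triple_neg_one (α β δ : Root) (h : pairing β.1 δ.1 = -1)
    (h' : pairing α.1 β.1 + pairing δ.1 α.1 ≠ -2) :
    ⁅eEl α.1, ⁅eEl β.1, eEl δ.1⁆⁆ =
      ((-1 : ℂ) ^ (asymForm β.1 δ.1 + asymForm α.1 β.1 + asymForm α.1 δ.1)) •
        eEl (α.1 + β.1 + δ.1) := by
  rw [bracket_e_e_of_ne _ _ (by omega), bracket_smul,
    show β.1 + δ.1 = (addRoot β δ h).1 from rfl, bracket_e_e_of_ne, smul_smul, cocycle_mul]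
  · change ((-1 : ℂ) ^ (asymForm β.1 δ.1 + asymForm α.1 (β.1 + δ.1))) •
      eEl (α.1 + (β.1 + δ.1)) = _
    rw [asymForm_add_right, ← add_assoc, ← add_assoc]
  · change pairing α.1 (β.1 + δ.1) ≠ -2
    rw [pairing_add_right, pairing_comm α.1 δ.1]
    exact h'

theorem bracket_triple_zero (α β δ : Root) (h : pairing β.1 δ.1 = -1)
    (h' : pairing α.1 β.1 + pairing δ.1 α.1 = -2) :
    ⁅eEl α.1, ⁅eEl β.1, eEl δ.1⁆⁆ =
      -(cocycle β.1 δ.1 • hEl (fun I => (latticeVec α.1 I : ℂ))) := by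
  rw [bracket_e_e_of_ne _ _ (by omega), bracket_smul,
    show β.1 + δ.1 = (addRoot β δ h).1 from rfl, bracket_e_e_of_eq, smul_neg]
  change pairing α.1 (β.1 + δ.1) = -2
  rw [pairing_add_right, pairing_comm α.1 δ.1]
  exact h'

theorem bracket_triple_nonneg (α β δ : Root) (h : 0 ≤ pairing β.1 δ.1) :
    ⁅eEl α.1, ⁅eEl β.1, eEl δ.1⁆⁆ = 0 := by
  rw [bracket_e_e_of_nonneg _ _ h, bracket_zero]

/-- The cyclic form of the Jacobi identity for root vectors -/
def Cyclic (α β δ : Root) : Prop :=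
  ⁅eEl α.1, ⁅eEl β.1, eEl δ.1⁆⁆ + ⁅eEl β.1, ⁅eEl δ.1, eEl α.1⁆⁆ +
    ⁅eEl δ.1, ⁅eEl α.1, eEl β.1⁆⁆ = 0

theorem Cyclic.rotate {α β δ : Root} (h : Cyclic α β δ) : Cyclic β δ α := by
  unfold Cyclic at *
  rw [← h]; abel

theorem pairing_self_add_add (α β δ : Root) :
    pairing (α.1 + β.1 + δ.1) (α.1 + β.1 + δ.1) =
      6 + 2 * (pairing α.1 β.1 + pairing β.1 δ.1 + pairing δ.1 α.1) := by
  simp only [pairing_add_left, pairing_add_right, α.2, β.2, δ.2, pairing_comm β.1 α.1,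
    pairing_comm δ.1 β.1, pairing_comm α.1 δ.1]
  ring

theorem cyclic_of_neg_two (α β δ : Root) (h : pairing β.1 δ.1 = -2) : Cyclic α β δ := by
  unfold Cyclic
  have hδ := eq_neg_of_pairing β δ h
  subst hδ
  have hz : pairing (-β).1 α.1 = -pairing α.1 β.1 := by
    rw [Root.neg_val, pairing_neg_left, pairing_comm]
  have hs : α.1 + β.1 + (-β).1 = α.1 := by simp
  have hs2 : β.1 + (-β).1 + α.1 = α.1 := by simp
  have hs3 : (-β).1 + α.1 + β.1 = α.1 := by simp
  have hss := asymForm_self β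
  have hp := pairing_eq α.1 β.1
  have h1 := pairing_ge α β
  have h2 := pairing_ge (-β) α
  rw [hz] at h2
  rw [bracket_triple_neg_two _ _ _ h]
  have hcases : pairing α.1 β.1 = -2 ∨ pairing α.1 β.1 = -1 ∨ pairing α.1 β.1 = 0 ∨
    pairing α.1 β.1 = 1 ∨ pairing α.1 β.1 = 2 := by omega
  rcases hcases with hx | hx | hx | hx | hx
  · rw [bracket_triple_nonneg β (-β) α (by omega), bracket_triple_neg_two (-β) α β hx, hz, hx]
    have : -β = α := by rw [eq_neg_of_pairing α β hx, neg_neg]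
    rw [this]
    module
  · rw [bracket_triple_nonneg β (-β) α (by omega),
      bracket_triple_neg_one (-β) α β hx (by rw [hz, hx, h]; decide), hs3, hx]
    have he : Even (asymForm α.1 β.1 + asymForm (-β).1 α.1 + asymForm (-β).1 β.1) := by
      rw [Root.neg_val, asymForm_neg_left, asymForm_neg_left, hss]
      exact ⟨asymForm α.1 β.1, by omega⟩
    rw [he.neg_one_zpow]
    push_cast
    module
  · rw [bracket_triple_nonneg β (-β) α (by omega), bracket_triple_nonneg (-β) α β (by omega), hx]
    simp
  · rw [bracket_triple_nonneg (-β) α β (by omega),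
      bracket_triple_neg_one β (-β) α (by omega) (by rw [h, hx]; decide), hs2, hx]
    have he : Odd (asymForm (-β).1 α.1 + asymForm β.1 (-β).1 + asymForm β.1 α.1) := by
      rw [Root.neg_val, asymForm_neg_left, asymForm_neg_right, hss]
      exact ⟨-1, by omega⟩
    rw [he.neg_one_zpow]
    push_cast
    module
  · rw [bracket_triple_nonneg (-β) α β (by omega), bracket_triple_neg_two β (-β) α (by omega), h,
      hx]
    have : β = α := by
      have := eq_neg_of_pairing (-β) α (by omega)
      rw [this, neg_neg]
    rw [this]
    push_cast
    module

/-- Two angles of 120 degrees. -/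
theorem cyclic_of_neg_one (α β δ : Root) (hx : pairing α.1 β.1 = -1)
    (hy : pairing β.1 δ.1 = -1) (hz : 0 ≤ pairing δ.1 α.1) : Cyclic α β δ := by
  unfold Cyclic
  rw [bracket_triple_nonneg β δ α hz, bracket_triple_neg_one α β δ hy (by omega),
    bracket_triple_neg_one δ α β hx (by omega), show δ.1 + α.1 + β.1 = α.1 + β.1 + δ.1 by abel]
  by_cases h0 : pairing δ.1 α.1 = 0
  · have h1 := pairing_eq δ.1 α.1
    have h2 := pairing_eq δ.1 β.1
    rw [pairing_comm] at h2
    have e : asymForm β.1 δ.1 + asymForm α.1 β.1 + asymForm α.1 δ.1 =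
      asymForm α.1 β.1 + asymForm δ.1 α.1 + asymForm δ.1 β.1 +
        (-1 - 2 * asymForm δ.1 α.1 - 2 * asymForm δ.1 β.1) := by omega
    have ho : Odd (-1 - 2 * asymForm δ.1 α.1 - 2 * asymForm δ.1 β.1) :=
      ⟨-1 - asymForm δ.1 α.1 - asymForm δ.1 β.1, by ring⟩
    rw [e, zpow_add₀ (by norm_num), ho.neg_one_zpow]
    module
  · rw [eEl_eq_zero (α.1 + β.1 + δ.1)]
    · simp
    · rw [pairing_self_add_add]; omega

theorem cyclic_of_single (α β δ : Root) (hx : 0 ≤ pairing α.1 β.1)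
    (hy : pairing β.1 δ.1 = -1) (hz : 0 ≤ pairing δ.1 α.1) : Cyclic α β δ := by
  unfold Cyclic
  rw [bracket_triple_nonneg β δ α hz, bracket_triple_neg_one α β δ hy (by omega),
    bracket_triple_nonneg δ α β hx, eEl_eq_zero (α.1 + β.1 + δ.1)]
  · simp
  · rw [pairing_self_add_add]; omega

theorem cyclic_of_triangle (α β δ : Root) (hx : pairing α.1 β.1 = -1)
    (hy : pairing β.1 δ.1 = -1) (hz : pairing δ.1 α.1 = -1) : Cyclic α β δ := by
  unfold Cyclic
  have hs : α.1 + β.1 + δ.1 = 0 :=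
    eq_zero_of_pairing_self _ (by rw [pairing_self_add_add]; omega)
  have hδ : δ.1 = -(α.1 + β.1) := (neg_eq_of_add_eq_zero_right hs).symm
  rw [bracket_triple_zero α β δ hy (by omega), bracket_triple_zero β δ α hz (by omega),
    bracket_triple_zero δ α β hx (by omega)]
  have hα := asymForm_self α
  have hβ := asymForm_self β
  have hp := pairing_eq α.1 β.1
  have c1 : cocycle β.1 δ.1 = cocycle α.1 β.1 := by
    rw [cocycle, cocycle, hδ, asymForm_neg_right, asymForm_add_right]
    congr 1; omega
  have c2 : cocycle δ.1 α.1 = cocycle α.1 β.1 := by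
    rw [cocycle, cocycle, hδ, asymForm_neg_left, asymForm_add_left]
    congr 1; omega
  rw [c1, c2, hδ]
  apply ext' <;> intro I
  · simp [latticeVec_neg, latticeVec_add]; ring
  · simp

theorem cyclic (α β δ : Root) : Cyclic α β δ := by
  have x1 := pairing_ge α β
  have y1 := pairing_ge β δ
  have z1 := pairing_ge δ α
  by_cases hx2 : pairing α.1 β.1 = -2
  · exact (cyclic_of_neg_two δ α β hx2).rotate
  by_cases hy2 : pairing β.1 δ.1 = -2
  · exact cyclic_of_neg_two α β δ hy2
  by_cases hz2 : pairing δ.1 α.1 = -2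
  · exact (cyclic_of_neg_two β δ α hz2).rotate.rotate
  by_cases hx : pairing α.1 β.1 = -1 <;> by_cases hy : pairing β.1 δ.1 = -1 <;>
    by_cases hz : pairing δ.1 α.1 = -1
  · exact cyclic_of_triangle α β δ hx hy hz
  · exact cyclic_of_neg_one α β δ hx hy (by omega)
  · exact (cyclic_of_neg_one δ α β hz hx (by omega)).rotate
  · exact (cyclic_of_single δ α β (by omega) hx (by omega)).rotate
  · exact (cyclic_of_neg_one β δ α hy hz (by omega)).rotate.rotate
  · exact cyclic_of_single α β δ (by omega) hy (by omega)
  · exact (cyclic_of_single β δ α (by omega) hz (by omega)).rotate.rotate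
  · unfold Cyclic
    rw [bracket_triple_nonneg α β δ (by omega), bracket_triple_nonneg β δ α (by omega),
      bracket_triple_nonneg δ α β (by omega)]
    simp

theorem jacobi_e_e_e (α β δ : Root) : Jacobi (eEl α.1) (eEl β.1) (eEl δ.1) := by
  have h := cyclic α β δ
  unfold Cyclic at h
  unfold Jacobi
  rw [bracket_skew (eEl δ.1) (eEl α.1), bracket_neg, bracket_skew (eEl δ.1) ⁅_, _⁆] at h
  rw [← sub_eq_zero, ← h]
  abel

theorem jacobi (x y z : E8Algebra) : Jacobi x y z := by
  have hadd : ∀ x x' y z, Jacobi x y z → Jacobi x' y z → Jacobi (x + x') y z := by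
    intro x x' y z h h'
    unfold Jacobi at *
    rw [add_bracket, h, h', add_bracket, add_bracket, add_bracket, bracket_add]; abel
  have hsmul : ∀ (c : ℂ) x y z, Jacobi x y z → Jacobi (c • x) y z := by
    intro c x y z h
    unfold Jacobi at *
    rw [smul_bracket, h, smul_bracket, smul_bracket, smul_bracket, bracket_smul, smul_add]
  have ind : ∀ y z, (∀ h, Jacobi (hEl h) y z) → (∀ α : Root, Jacobi (eEl α.1) y z) →
      ∀ x, Jacobi x y z := fun y z hh he x =>
    induction (P := fun x => Jacobi x y z) hh he (fun a b => hadd a b y z)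
      (fun c a => hsmul c a y z) x
  -- two Cartan elements, then one, then none
  have hhx : ∀ h k x, Jacobi (hEl h) (hEl k) x := fun h k x =>
    (ind (hEl h) (hEl k) (fun l => jacobi_h_h_h _ _ _)
      (fun α => (jacobi_h_h_e h k α.1).swap_right.swap_left) x).swap_left.swap_right
  have hex : ∀ h (α : Root) x, Jacobi (hEl h) (eEl α.1) x := fun h α x =>
    (ind (hEl h) (eEl α.1) (fun l => (jacobi_h_h_e l h α.1))
      (fun β => (jacobi_h_e_e h β α).swap_left) x).swap_left.swap_right
  have hxy : ∀ h x y, Jacobi (hEl h) x y := fun h x y =>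
    (ind (hEl h) y (fun l => hhx l h y)
      (fun α => (hex h α y).swap_left) x).swap_left
  have eex : ∀ (α β : Root) x, Jacobi (eEl α.1) (eEl β.1) x := fun α β x =>
    (ind (eEl α.1) (eEl β.1) (fun l => hxy l _ _)
      (fun δ => jacobi_e_e_e δ α β) x).swap_left.swap_right
  have exy : ∀ (α : Root) x y, Jacobi (eEl α.1) x y := fun α x y =>
    (ind (eEl α.1) y (fun l => hxy l _ _)
      (fun β => eex β α y) x).swap_left
  exact ind y z (fun h => hxy h y z) (fun α => exy α y z) x

noncomputable instance : LieRing E8Algebra where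
  add_lie := add_bracket
  lie_add := bracket_add
  lie_self := bracket_self
  leibniz_lie := jacobi

noncomputable instance : LieAlgebra ℂ E8Algebra where
  lie_smul := bracket_smul

theorem real_smul_eq (c : ℝ) (x : E8Algebra) : c • x = (c : ℂ) • x := by
  apply ext' <;> intro I <;> simp

noncomputable instance : LieAlgebra ℝ E8Algebra where
  lie_smul c x y := by rw [real_smul_eq, real_smul_eq, bracket_smul]

end E8Algebra

namespace E8Algebra

/-- The compact real form of `E8Algebra`, i.e. the Lie algebra of the compact group `E₈`. In the
basis above it is cut out by `conj h = -h` and `x_{-α} = conj x_α`. -/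
noncomputable def compactForm : LieSubalgebra ℝ E8Algebra where
  carrier := {x | (∀ I, conj (x.cartan I) = -x.cartan I) ∧
    ∀ α, x.root (-α) = conj (x.root α)}
  add_mem' := by
    rintro x y ⟨hx, hx'⟩ ⟨hy, hy'⟩
    refine ⟨fun I => ?_, fun α => ?_⟩
    · simp only [cartan_add, Pi.add_apply, map_add, hx, hy]; ring
    · simp only [root_add, Pi.add_apply, map_add, hx', hy']
  zero_mem' := by simp
  smul_mem' := by
    rintro c x ⟨hx, hx'⟩
    refine ⟨fun I => ?_, fun α => ?_⟩
    · simp [hx]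
    · simp [hx']
  lie_mem' := by
    rintro x y ⟨hx, hx'⟩ ⟨hy, hy'⟩
    have hr : ∀ (z : E8Algebra), (∀ I, conj (z.cartan I) = -z.cartan I) → ∀ m,
        conj (rootValue m z.cartan) = -rootValue m z.cartan := by
      intro z hz m
      simp [rootValue_apply, hz]
    refine ⟨fun I => ?_, fun γ => ?_⟩
    · simp only [bracket_fst, map_neg, map_sum, map_mul, Complex.conj_ofReal, neg_neg]
      rw [← Equiv.sum_comp (Equiv.neg Root), ← Finset.sum_neg_distrib]
      refine Finset.sum_congr rfl fun α _ => ?_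
      simp only [Equiv.neg_apply, neg_neg, Root.neg_val, latticeVec_neg, Pi.neg_apply,
        ← hx', ← hy']
      push_cast; ring
    · simp only [bracket_snd, map_sub, map_add, map_sum, map_mul, hr x hx, hr y hy,
        Root.neg_val, rootValue_neg, hx', hy']
      congr 1
      rw [← Equiv.sum_comp (Equiv.neg Root)]
      refine Finset.sum_congr rfl fun α _ => ?_
      rw [← Equiv.sum_comp (Equiv.neg Root)]
      refine Finset.sum_congr rfl fun β _ => ?_
      have hc : conj (cocycle α.1 β.1) = cocycle α.1 β.1 := by simp [cocycle]
      have hn : cocycle (-α.1) (-β.1) = cocycle α.1 β.1 := by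
        rw [cocycle, cocycle, asymForm_neg_left, asymForm_neg_right, neg_neg]
      have hi : (-α.1 + -β.1 = -γ.1) ↔ (α.1 + β.1 = γ.1) := by rw [← neg_add, neg_inj]
      simp only [Equiv.neg_apply, Root.neg_val, hi, hn, hx', hy']
      split_ifs
      · simp [hc]
      · simp

/-- The phase `exp (2πi α · v)` of the root `α = ∑ mᵢ αᵢ`. -/
noncomputable def phase (v : Fin 8 → ℝ) (m : Fin 8 → ℤ) : ℂ :=
  Complex.exp (2 * Real.pi * Complex.I * (latticeVec m ⬝ᵥ v : ℝ))

theorem phase_add (v : Fin 8 → ℝ) (a b : Fin 8 → ℤ) :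
    phase v (a + b) = phase v a * phase v b := by
  rw [phase, phase, phase, ← Complex.exp_add, latticeVec_add, add_dotProduct]
  congr 1; push_cast; ring

theorem phase_zero (v : Fin 8 → ℝ) : phase v 0 = 1 := by
  simp [phase, latticeVec]

/-- The inner automorphism by which the embedding vector `v` acts on the `E₈` gauge degrees of
freedom: it fixes the Cartan subalgebra and multiplies `e_α` by `exp (2πi α · v)`. -/
noncomputable def shiftAction (v : Fin 8 → ℝ) : E8Algebra →ₗ⁅ℂ⁆ E8Algebra where
  toFun x := ⟨x.cartan, fun α => phase v α.1 * x.root α⟩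
  map_add' x y := by apply ext' <;> intro I <;> simp [mul_add]
  map_smul' c x := by
    apply ext' <;> intro I
    · simp
    · simp; ring
  map_lie' := by
    intro x y
    apply ext' <;> intro I
    · simp only [bracket_fst]
      congr 1
      refine Finset.sum_congr rfl fun α _ => ?_
      have h : phase v α.1 * phase v (-α).1 = 1 := by
        rw [← phase_add, Root.neg_val, add_neg_cancel, phase_zero]
      linear_combination -(latticeVec α.1 I : ℂ) * (x.root α * y.root (-α)) * h
    · simp only [bracket_snd, mul_add, Finset.mul_sum]
      congr 1
      · ring
      · refine Finset.sum_congr rfl fun α _ => Finset.sum_congr rfl fun β _ => ?_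
        split_ifs with h
        · rw [← h, phase_add]; ring
        · simp

end E8Algebra

/-- The set `{V, a₁, a₃}` of vectors embedding one `E₈` factor. -/
structure Embedding where
  V : Fin 8 → ℝ
  a₁ : Fin 8 → ℝ
  a₃ : Fin 8 → ℝ

/-- The Lie algebra of the unbroken gauge group: the elements of the compact real Lie algebra `E₈`
which are invariant under the action of the twist embedding and of both Wilson lines. -/
noncomputable def gaugeAlgebra (E : Embedding) : LieSubalgebra ℝ E8Algebra where
  carrier := {x | x ∈ E8Algebra.compactForm ∧ E8Algebra.shiftAction E.V x = x ∧
    E8Algebra.shiftAction E.a₁ x = x ∧ E8Algebra.shiftAction E.a₃ x = x}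
  add_mem' := by
    rintro x y ⟨hx, h1, h2, h3⟩ ⟨hy, k1, k2, k3⟩
    exact ⟨add_mem hx hy, by rw [map_add, h1, k1], by rw [map_add, h2, k2],
      by rw [map_add, h3, k3]⟩
  zero_mem' := ⟨zero_mem _, map_zero _, map_zero _, map_zero _⟩
  smul_mem' := by
    rintro c x ⟨hx, h1, h2, h3⟩
    refine ⟨E8Algebra.compactForm.smul_mem c hx, ?_, ?_, ?_⟩ <;>
      rw [E8Algebra.real_smul_eq, map_smul] <;> simp only [h1, h2, h3]
  lie_mem' := by
    rintro x y ⟨hx, h1, h2, h3⟩ ⟨hy, k1, k2, k3⟩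
    exact ⟨E8Algebra.compactForm.lie_mem hx hy, by rw [LieHom.map_lie, h1, k1],
      by rw [LieHom.map_lie, h2, k2], by rw [LieHom.map_lie, h3, k3]⟩

-- matrix algebras are Lie algebras with the commutator as bracket
attribute [local instance 100] LieRing.ofAssociativeRing

/-- `su(n)`: the traceless skew-Hermitian matrices. -/
def su (n : ℕ) : LieSubalgebra ℝ (Matrix (Fin n) (Fin n) ℂ) where
  carrier := {A | Aᴴ = -A ∧ A.trace = 0}
  add_mem' := by
    rintro A B ⟨hA, hA'⟩ ⟨hB, hB'⟩
    exact ⟨by rw [Matrix.conjTranspose_add, hA, hB, neg_add],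
      by rw [Matrix.trace_add, hA', hB', add_zero]⟩
  zero_mem' := by simp
  smul_mem' := by
    rintro c A ⟨hA, hA'⟩
    exact ⟨by rw [Matrix.conjTranspose_smul, hA, star_trivial, smul_neg],
      by rw [Matrix.trace_smul, hA', smul_zero]⟩
  lie_mem' := by
    rintro A B ⟨hA, hA'⟩ ⟨hB, hB'⟩
    refine ⟨?_, ?_⟩
    · rw [Ring.lie_def, Matrix.conjTranspose_sub, Matrix.conjTranspose_mul,
        Matrix.conjTranspose_mul, hA, hB]
      simp
    · rw [Ring.lie_def, Matrix.trace_sub, Matrix.trace_mul_comm, sub_self]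

/-- `so(n)`: the real skew-symmetric matrices. -/
abbrev so (n : ℕ) : LieSubalgebra ℝ (Matrix (Fin n) (Fin n) ℝ) :=
  LieAlgebra.Orthogonal.so (Fin n) ℝ

/-- The Lie algebra of `U(1)^k`; the bracket is zero. -/
abbrev u1 (k : ℕ) : Type := Fin k → ℝ

/-- The labels of the five hidden sector gauge groups. -/
inductive GaugeCase
  | case1 | case2 | case3 | case4 | case5
  deriving DecidableEq

/-- `HasGaugeGroup E k`: the unbroken gauge group of the embedding `E` is, as usual up to finite
coverings, i.e. at the level of Lie algebras, the group with label `k`. -/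
def HasGaugeGroup (E : Embedding) : GaugeCase → Prop
  -- `SO(10) × U(1)³`
  | .case1 => Nonempty (gaugeAlgebra E ≃ₗ⁅ℝ⁆ so 10 × u1 3)
  -- `SU(5) × SU(2) × U(1)³`
  | .case2 => Nonempty (gaugeAlgebra E ≃ₗ⁅ℝ⁆ su 5 × su 2 × u1 3)
  -- `SU(4) × SU(2)² × U(1)³`
  | .case3 => Nonempty (gaugeAlgebra E ≃ₗ⁅ℝ⁆ su 4 × su 2 × su 2 × u1 3)
  -- `SU(3) × SU(2)² × U(1)⁴`
  | .case4 => Nonempty (gaugeAlgebra E ≃ₗ⁅ℝ⁆ su 3 × su 2 × su 2 × u1 4)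
  -- `SU(2)² × U(1)⁶`
  | .case5 => Nonempty (gaugeAlgebra E ≃ₗ⁅ℝ⁆ su 2 × su 2 × u1 6)

/-- The embeddings whose gauge group is viable for dynamical supersymmetry breaking: all but those
of Case 5. -/
def IsViable (E : Embedding) : Prop := ¬ HasGaugeGroup E .case5

/-- The embedding with given integer vectors `3V`, `3a₁`, `3a₃`. -/
noncomputable def Embedding.ofThirds (V a₁ a₃ : Fin 8 → ℤ) : Embedding where
  V := fun I => V I / 3
  a₁ := fun I => a₁ I / 3
  a₃ := fun I => a₃ I / 3

/-- The six inequivalent observable sector embeddings of Casas, Mondragon and Muñoz, with their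
numbering. -/
inductive CMM
  | cmm1 | cmm2 | cmm4 | cmm6 | cmm8 | cmm9
  deriving DecidableEq

/-- The observable sector vectors `V_A`, `a_{1A}`, `a_{3A}`. -/
noncomputable def CMM.observable : CMM → Embedding
  | .cmm1 => .ofThirds ![-1,-1,0,0,0,2,0,0] ![1,1,-1,-1,2,0,0,0] ![0,0,0,0,0,0,2,0]
  | .cmm2 => .ofThirds ![-1,-1,0,0,0,2,0,0] ![1,1,-1,-1,-1,-1,0,0] ![0,0,0,0,0,0,2,0]
  | .cmm4 => .ofThirds ![-1,-1,0,0,0,2,0,0] ![1,1,-1,-1,-1,0,1,0] ![0,0,0,0,0,0,2,0]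
  | .cmm6 => .ofThirds ![-1,-1,0,0,0,2,0,0] ![1,1,-1,-1,-1,2,1,0] ![0,0,0,0,0,1,1,2]
  | .cmm8 => .ofThirds ![-1,-1,0,0,0,1,1,0] ![1,1,-1,-1,-1,1,1,1] ![0,0,0,0,0,1,2,1]
  | .cmm9 => .ofThirds ![-1,-1,0,0,0,1,1,0] ![1,1,-1,-1,-1,-2,0,1] ![0,0,0,0,0,0,0,2]

/-- Three times each of the embedding vectors lies in the `E₈` root lattice. -/
def Embedding.IsThirdIntegral (E : Embedding) : Prop :=
  (3 : ℝ) • E.V ∈ e8Lattice ∧ (3 : ℝ) • E.a₁ ∈ e8Lattice ∧ (3 : ℝ) • E.a₃ ∈ e8Lattice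

/-- The consistency conditions for the pair of an observable embedding `A` and a hidden embedding
`B`, i.e. for the sixteen-dimensional vectors `(V_A; V_B)`, `(a_{1A}; a_{1B})`,
`(a_{3A}; a_{3B})`: three times each vector is in the `E₈ × E₈` root lattice and three times each
scalar product of two of the vectors is an integer. -/
def IsConsistent (A B : Embedding) : Prop :=
  A.IsThirdIntegral ∧ B.IsThirdIntegral ∧
  (∃ n : ℤ, 3 * (A.V ⬝ᵥ A.V + B.V ⬝ᵥ B.V) = n) ∧
  (∃ n : ℤ, 3 * (A.a₁ ⬝ᵥ A.a₁ + B.a₁ ⬝ᵥ B.a₁) = n) ∧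
  (∃ n : ℤ, 3 * (A.a₃ ⬝ᵥ A.a₃ + B.a₃ ⬝ᵥ B.a₃) = n) ∧
  (∃ n : ℤ, 3 * (A.a₁ ⬝ᵥ A.a₃ + B.a₁ ⬝ᵥ B.a₃) = n) ∧
  (∃ n : ℤ, 3 * (A.V ⬝ᵥ A.a₁ + B.V ⬝ᵥ B.a₁) = n) ∧
  (∃ n : ℤ, 3 * (A.V ⬝ᵥ A.a₃ + B.V ⬝ᵥ B.a₃) = n)

/-- The elementary equivalences of embeddings: (I) adding a root lattice vector to one of the three
vectors, (II) a Weyl reflection performed simultaneously on the three vectors. -/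
inductive EquivStep : Embedding → Embedding → Prop
  | shiftV (E : Embedding) (l : Fin 8 → ℝ) (hl : l ∈ e8Lattice) :
      EquivStep E ⟨E.V + l, E.a₁, E.a₃⟩
  | shift_a₁ (E : Embedding) (l : Fin 8 → ℝ) (hl : l ∈ e8Lattice) :
      EquivStep E ⟨E.V, E.a₁ + l, E.a₃⟩
  | shift_a₃ (E : Embedding) (l : Fin 8 → ℝ) (hl : l ∈ e8Lattice) :
      EquivStep E ⟨E.V, E.a₁, E.a₃ + l⟩
  | reflect (E : Embedding) (e : Fin 8 → ℝ) (he : e ∈ e8Lattice) (hn : e ⬝ᵥ e = 2) :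
      EquivStep E ⟨E.V - (E.V ⬝ᵥ e) • e, E.a₁ - (E.a₁ ⬝ᵥ e) • e, E.a₃ - (E.a₃ ⬝ᵥ e) • e⟩

/-- Equivalence of embeddings, generated by the operations (I) and (II). -/
def Equivalent : Embedding → Embedding → Prop := Relation.EqvGen EquivStep

/-- A model: an observable embedding together with a hidden embedding. -/
abbrev Model : Type := CMM × Embedding

/-- The hidden embedding of the model is consistent with its observable embedding. -/
def Model.Consistent (m : Model) : Prop := IsConsistent m.1.observable m.2

/-- A line of the list of hidden sector embeddings: the observable embedding which it completes,
the vectors `3V_B`, `3a_{1B}`, `3a_{3B}` and the label of the gauge group. -/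
structure TableEntry where
  cmm : CMM
  V : Fin 8 → ℤ
  a₁ : Fin 8 → ℤ
  a₃ : Fin 8 → ℤ
  gaugeCase : GaugeCase
  deriving DecidableEq

/-- The model given by a line of the list. -/
noncomputable def TableEntry.model (t : TableEntry) : Model :=
  (t.cmm, .ofThirds t.V t.a₁ t.a₃)

/-- The lines with common observable embedding and common `3V_B`. -/
def table (c : CMM) (V : Fin 8 → ℤ) (rows : List ((Fin 8 → ℤ) × (Fin 8 → ℤ) × GaugeCase)) :
    List TableEntry :=
  rows.map fun r => ⟨c, V, r.1, r.2.1, r.2.2⟩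

/-- Hidden sector embeddings completing CMM 1 with `3V_B = (2,1,1,0,0,0,0,0)`. -/
def table1 : List TableEntry :=
  table .cmm1 ![2,1,1,0,0,0,0,0]
   [(![-2,0,0,0,0,0,0,0], ![0,1,-1,0,0,0,0,0], .case1),
    (![0,2,0,0,0,0,0,0], ![-1,0,-1,0,0,0,0,0], .case1),
    (![0,2,0,0,0,0,0,0], ![1,0,1,0,0,0,0,0], .case1),
    (![-2,0,0,0,0,0,0,0], ![0,0,0,2,1,1,1,-1], .case2),
    (![-2,0,0,0,0,0,0,0], ![0,0,0,2,1,1,1,1], .case2),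
    (![-1,1,0,1,1,0,0,0], ![-1,-1,0,0,0,0,0,0], .case2),
    (![-1,1,0,1,1,0,0,0], ![0,0,0,1,-1,0,0,0], .case2),
    (![-1,1,0,1,1,0,0,0], ![1,1,0,0,0,0,0,0], .case2),
    (![0,1,1,1,1,0,0,0], ![0,0,0,1,-1,0,0,0], .case2),
    (![0,1,1,1,1,0,0,0], ![0,1,-1,0,0,0,0,0], .case2),
    (![0,2,0,0,0,0,0,0], ![0,0,0,2,1,1,1,-1], .case2),
    (![0,2,0,0,0,0,0,0], ![0,0,0,2,1,1,1,1], .case2),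
    (![-2,0,0,0,0,0,0,0], ![0,0,0,1,1,0,0,0], .case3),
    (![-1,1,0,1,1,0,0,0], ![-2,-1,-1,1,1,0,0,0], .case3),
    (![-1,1,0,1,1,0,0,0], ![2,1,1,-1,-1,0,0,0], .case3),
    (![0,1,1,1,1,0,0,0], ![-2,-1,-1,1,1,0,0,0], .case3),
    (![0,1,1,1,1,0,0,0], ![2,1,1,-1,-1,0,0,0], .case3),
    (![0,2,0,0,0,0,0,0], ![0,0,0,1,1,0,0,0], .case3),
    (![-2,0,0,0,0,0,0,0], ![0,-1,-2,1,1,1,0,0], .case4),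
    (![-1,1,0,1,1,0,0,0], ![-2,-1,-1,0,-1,1,0,0], .case4),
    (![-1,1,0,1,1,0,0,0], ![-2,0,1,-1,-1,1,0,0], .case4),
    (![-1,1,0,1,1,0,0,0], ![-2,1,0,0,0,1,1,-1], .case4),
    (![-1,1,0,1,1,0,0,0], ![-2,1,0,0,0,1,1,1], .case4),
    (![-1,1,0,1,1,0,0,0], ![2,1,1,1,0,1,0,0], .case4),
    (![-1,1,0,1,1,0,0,0], ![2,-1,0,0,0,1,1,1], .case4),
    (![-1,1,0,1,1,0,0,0], ![-1,1,1,-1,-1,1,1,-1], .case4),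
    (![0,1,1,1,1,0,0,0], ![-2,-1,-1,0,-1,1,0,0], .case4),
    (![0,1,1,1,1,0,0,0], ![-2,1,0,1,1,1,0,0], .case4),
    (![0,1,1,1,1,0,0,0], ![2,0,-1,-1,-1,1,0,0], .case4),
    (![0,1,1,1,1,0,0,0], ![2,1,1,1,0,1,0,0], .case4),
    (![0,1,1,1,1,0,0,0], ![-1,1,1,-1,-1,1,1,-1], .case4),
    (![0,2,0,0,0,0,0,0], ![-2,0,1,1,1,1,0,0], .case4),
    (![0,2,0,0,0,0,0,0], ![2,0,-1,1,1,1,0,0], .case4)]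

/-- Hidden sector embeddings completing CMM 2 with `3V_B = (2,1,1,0,0,0,0,0)`. -/
def table2 : List TableEntry :=
  table .cmm2 ![2,1,1,0,0,0,0,0]
   [(![-2,0,-1,1,0,0,0,0], ![-1,0,-1,0,0,0,0,0], .case1),
    (![-2,0,-1,1,0,0,0,0], ![1,0,1,0,0,0,0,0], .case1),
    (![-2,1,1,0,0,0,0,0], ![0,1,-1,0,0,0,0,0], .case1),
    (![-2,0,-1,1,0,0,0,0], ![-2,-1,-1,1,1,0,0,0], .case2),
    (![-2,0,-1,1,0,0,0,0], ![2,1,1,-1,1,0,0,0], .case2),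
    (![-2,1,1,0,0,0,0,0], ![0,0,0,2,1,1,1,-1], .case2),
    (![-2,1,1,0,0,0,0,0], ![0,0,0,2,1,1,1,1], .case2),
    (![-1,0,0,1,1,1,1,-1], ![-1,1,1,1,1,1,1,-1], .case2),
    (![-1,0,0,1,1,1,1,-1], ![0,1,-1,0,0,0,0,0], .case2),
    (![-1,1,-1,1,1,1,0,0], ![-1,-1,0,0,0,0,0,0], .case2),
    (![-1,1,-1,1,1,1,0,0], ![0,0,0,0,0,0,1,1], .case2),
    (![-1,1,-1,1,1,1,0,0], ![1,1,0,0,0,0,0,0], .case2),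
    (![-2,0,-1,1,0,0,0,0], ![-1,1,1,-1,1,1,1,1], .case3),
    (![-2,1,1,0,0,0,0,0], ![0,0,0,1,1,0,0,0], .case3),
    (![-1,0,0,1,1,1,1,-1], ![0,0,0,2,1,-1,-1,1], .case3),
    (![-1,0,0,1,1,1,1,-1], ![0,0,0,1,1,-1,-2,-1], .case3),
    (![-1,1,-1,1,1,1,0,0], ![-2,-1,-1,0,-1,-1,0,0], .case3),
    (![-1,1,-1,1,1,1,0,0], ![2,1,1,1,1,0,0,0], .case3),
    (![-2,0,-1,1,0,0,0,0], ![-2,0,1,0,1,1,1,0], .case4),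
    (![-2,0,-1,1,0,0,0,0], ![-2,1,0,-1,1,1,0,0], .case4),
    (![-2,1,1,0,0,0,0,0], ![0,-1,-2,1,1,1,0,0], .case4),
    (![-1,0,0,1,1,1,1,-1], ![-2,-1,-1,0,0,-1,-1,0], .case4),
    (![-1,0,0,1,1,1,1,-1], ![2,1,1,1,0,0,0,-1], .case4),
    (![-1,0,0,1,1,1,1,-1], ![0,-1,-2,0,-1,-1,-1,0], .case4),
    (![-1,0,0,1,1,1,1,-1], ![0,-1,-2,1,1,0,0,-1], .case4),
    (![-1,0,0,1,1,1,1,-1], ![0,0,0,0,0,0,-1,-1], .case4),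
    (![-1,1,-1,1,1,1,0,0], ![-2,-1,-1,1,0,0,1,0], .case4),
    (![-1,1,-1,1,1,1,0,0], ![-2,0,1,0,0,-1,1,-1], .case4),
    (![-1,1,-1,1,1,1,0,0], ![-2,0,1,1,-1,-1,0,0], .case4),
    (![-1,1,-1,1,1,1,0,0], ![-2,1,0,-1,-1,-1,0,0], .case4),
    (![-1,1,-1,1,1,1,0,0], ![-2,1,0,1,1,1,0,0], .case4),
    (![-1,1,-1,1,1,1,0,0], ![2,1,1,0,0,-1,1,0], .case4),
    (![-1,1,-1,1,1,1,0,0], ![-1,1,1,1,-1,-1,1,-1], .case4)]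

/-- Hidden sector embeddings completing CMM 4 with `3V_B = (2,1,1,0,0,0,0,0)`. -/
def table4 : List TableEntry :=
  table .cmm4 ![2,1,1,0,0,0,0,0]
   [(![-2,1,-1,0,0,0,0,0], ![-1,-1,0,0,0,0,0,0], .case1),
    (![-2,1,-1,0,0,0,0,0], ![0,-1,1,0,0,0,0,0], .case1),
    (![2,-1,-1,0,0,0,0,0], ![1,1,0,0,0,0,0,0], .case1),
    (![-2,0,0,1,1,0,0,0], ![-2,-1,-1,1,-1,0,0,0], .case2),
    (![-2,0,0,1,1,0,0,0], ![1,1,0,0,0,0,0,0], .case2),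
    (![-2,1,-1,0,0,0,0,0], ![1,-1,-1,1,1,1,1,-1], .case2),
    (![-2,1,-1,0,0,0,0,0], ![1,-1,-1,1,1,1,1,1], .case2),
    (![-1,1,0,1,1,1,1,0], ![-1,0,-1,0,0,0,0,0], .case2),
    (![-1,1,0,1,1,1,1,0], ![-1,1,1,-1,-1,-1,-1,1], .case2),
    (![-1,1,0,1,1,1,1,0], ![0,1,-1,0,0,0,0,0], .case2),
    (![2,-1,-1,0,0,0,0,0], ![1,-1,-1,1,1,1,1,-1], .case2),
    (![2,-1,-1,0,0,0,0,0], ![1,-1,-1,1,1,1,1,1], .case2),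
    (![-2,0,0,1,1,0,0,0], ![2,1,1,1,1,0,0,0], .case3),
    (![-2,0,0,1,1,0,0,0], ![-1,1,1,1,1,1,1,-1], .case3),
    (![-2,1,-1,0,0,0,0,0], ![-2,-1,-1,1,1,0,0,0], .case3),
    (![-1,1,0,1,1,1,1,0], ![2,1,1,0,0,0,-1,-1], .case3),
    (![-1,1,0,1,1,1,1,0], ![-1,1,1,-1,-1,-1,-1,-1], .case3),
    (![2,-1,-1,0,0,0,0,0], ![-2,-1,-1,1,1,0,0,0], .case3),
    (![-2,0,0,1,1,0,0,0], ![-2,-1,-1,0,0,1,1,0], .case4),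
    (![-2,0,0,1,1,0,0,0], ![-2,1,0,0,0,1,1,-1], .case4),
    (![-2,0,0,1,1,0,0,0], ![-2,1,0,0,0,1,1,1], .case4),
    (![-2,0,0,1,1,0,0,0], ![2,1,1,0,-1,1,0,0], .case4),
    (![-2,0,0,1,1,0,0,0], ![0,0,0,1,0,1,0,0], .case4),
    (![-2,1,-1,0,0,0,0,0], ![2,-1,0,1,1,1,0,0], .case4),
    (![-2,1,-1,0,0,0,0,0], ![0,-1,-2,1,1,1,0,0], .case4),
    (![-1,1,0,1,1,1,1,0], ![-2,-1,-1,1,0,0,-1,0], .case4),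
    (![-1,1,0,1,1,1,1,0], ![-2,0,1,1,1,0,0,-1], .case4),
    (![-1,1,0,1,1,1,1,0], ![-2,1,0,0,0,-1,-1,1], .case4),
    (![-1,1,0,1,1,1,1,0], ![2,1,1,0,0,0,-1,1], .case4),
    (![-1,1,0,1,1,1,1,0], ![2,-1,0,0,0,-1,-1,1], .case4),
    (![-1,1,0,1,1,1,1,0], ![2,0,-1,0,-1,-1,-1,0], .case4),
    (![-1,1,0,1,1,1,1,0], ![-1,1,1,1,1,1,-1,1], .case4),
    (![2,-1,-1,0,0,0,0,0], ![-2,1,0,1,1,1,0,0], .case4)]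

/-- Hidden sector embeddings completing CMM 6 with `3V_B = (2,1,1,0,0,0,0,0)`. -/
def table6 : List TableEntry :=
  table .cmm6 ![2,1,1,0,0,0,0,0]
   [(![-1,0,0,1,0,0,0,0], ![-2,0,-1,1,0,0,0,0], .case1),
    (![0,1,0,1,0,0,0,0], ![-2,-1,0,1,0,0,0,0], .case1),
    (![0,1,0,1,0,0,0,0], ![0,-1,2,1,0,0,0,0], .case1),
    (![-1,0,0,1,0,0,0,0], ![-1,0,0,-1,1,1,1,-1], .case2),
    (![-1,0,0,1,0,0,0,0], ![2,0,0,-1,1,0,0,0], .case2),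
    (![0,1,0,1,0,0,0,0], ![-2,0,-1,0,1,0,0,0], .case2),
    (![0,1,0,1,0,0,0,0], ![0,-2,0,-1,1,0,0,0], .case2),
    (![-2,0,-1,1,1,1,0,0], ![-1,1,-1,1,1,1,0,0], .case2),
    (![-2,0,-1,1,1,1,0,0], ![0,1,0,1,1,1,1,1], .case2),
    (![-2,0,-1,1,1,1,0,0], ![1,1,1,1,1,1,0,0], .case2),
    (![-2,1,1,1,1,0,0,0], ![0,2,-1,0,-1,0,0,0], .case2),
    (![-2,1,1,1,1,0,0,0], ![0,0,-2,1,1,0,0,0], .case2),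
    (![-1,0,0,1,0,0,0,0], ![-1,0,0,-1,1,1,1,1], .case3),
    (![0,1,0,1,0,0,0,0], ![-1,-1,1,1,1,1,0,0], .case3),
    (![-2,0,-1,1,1,1,0,0], ![-2,0,-1,1,0,0,0,0], .case3),
    (![-2,0,-1,1,1,1,0,0], ![-1,-1,1,1,-1,-1,0,0], .case3),
    (![-2,1,1,1,1,0,0,0], ![-2,1,1,0,0,0,0,0], .case3),
    (![-2,1,1,1,1,0,0,0], ![2,0,0,-1,-1,0,0,0], .case3),
    (![-1,0,0,1,0,0,0,0], ![-1,1,-1,-1,1,1,0,0], .case4),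
    (![0,1,0,1,0,0,0,0], ![2,0,0,0,1,1,0,0], .case4),
    (![0,1,0,1,0,0,0,0], ![-1,1,-1,-1,1,1,0,0], .case4),
    (![-2,0,-1,1,1,1,0,0], ![-2,-1,0,0,0,-1,0,0], .case4),
    (![-2,0,-1,1,1,1,0,0], ![-2,1,1,0,0,0,0,0], .case4),
    (![-2,0,-1,1,1,1,0,0], ![-1,-1,1,0,0,-1,1,-1], .case4),
    (![-2,0,-1,1,1,1,0,0], ![-1,-1,1,0,0,-1,1,1], .case4),
    (![-2,0,-1,1,1,1,0,0], ![-1,-1,1,1,1,0,1,0], .case4),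
    (![-2,0,-1,1,1,1,0,0], ![2,0,0,0,-1,-1,0,0], .case4),
    (![-2,0,-1,1,1,1,0,0], ![-1,1,-1,-1,-1,-1,0,0], .case4),
    (![-2,1,1,1,1,0,0,0], ![-2,0,-1,0,0,1,0,0], .case4),
    (![-2,1,1,1,1,0,0,0], ![-1,0,0,-1,-1,1,1,-1], .case4),
    (![-2,1,1,1,1,0,0,0], ![2,0,0,1,0,1,0,0], .case4),
    (![-2,1,1,1,1,0,0,0], ![-1,1,-1,-1,-1,1,0,0], .case4),
    (![-2,1,1,1,1,0,0,0], ![0,-1,-1,0,-1,1,1,1], .case4)]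

/-- Hidden sector embeddings completing CMM 8 with `3V_B = (1,1,0,0,0,0,0,0)`. -/
def table8a : List TableEntry :=
  table .cmm8 ![1,1,0,0,0,0,0,0]
   [(![0,0,1,1,1,1,0,0], ![0,0,-1,-1,-1,-1,1,1], .case1),
    (![0,0,1,1,1,1,0,0], ![-1,-2,0,0,0,-1,0,0], .case2),
    (![0,0,1,1,1,1,0,0], ![0,0,2,0,0,0,1,-1], .case2),
    (![0,0,1,1,1,1,0,0], ![0,0,-1,-1,-1,-1,1,-1], .case3),
    (![0,0,1,1,1,1,0,0], ![0,0,2,0,0,0,1,1], .case4)]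

/-- Hidden sector embeddings completing CMM 8 with `3V_B = (2,1,1,1,1,0,0,0)`. -/
def table8b : List TableEntry :=
  table .cmm8 ![2,1,1,1,1,0,0,0]
   [(![-1,0,0,0,-1,1,1,0], ![-1,-1,-1,-1,-1,0,0,-1], .case2),
    (![-1,0,0,0,-1,1,1,0], ![-1,1,1,1,-1,0,0,1], .case2),
    (![0,1,1,1,0,1,0,0], ![1,-1,-1,-1,1,-1,0,0], .case2),
    (![-1,0,0,0,-1,1,1,0], ![-1,1,1,0,0,-1,-1,1], .case3),
    (![-1,0,0,0,-1,1,1,0], ![0,0,-1,-1,-1,-1,-1,-1], .case3),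
    (![-1,1,1,0,0,1,0,0], ![-2,0,0,-1,-1,0,0,0], .case3),
    (![-1,1,1,0,0,1,0,0], ![1,1,1,1,1,1,0,0], .case3),
    (![-1,0,0,0,-1,1,1,0], ![-2,0,-1,-1,0,0,0,0], .case4),
    (![-1,0,0,0,-1,1,1,0], ![-2,0,0,0,1,1,0,0], .case4),
    (![-1,0,0,0,-1,1,1,0], ![-2,1,0,0,0,0,0,1], .case4),
    (![-1,0,0,0,-1,1,1,0], ![-1,0,-1,-1,1,0,-1,1], .case4),
    (![-1,0,0,0,-1,1,1,0], ![-1,1,1,-1,1,0,-1,0], .case4),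
    (![-1,1,1,0,0,1,0,0], ![-2,1,0,0,0,-1,0,0], .case4),
    (![-1,1,1,0,0,1,0,0], ![-1,-1,-1,-1,-1,0,1,0], .case4),
    (![-1,1,1,0,0,1,0,0], ![-1,-1,-1,1,0,0,1,-1], .case4),
    (![0,1,1,1,0,1,0,0], ![-2,0,0,0,1,-1,0,0], .case4),
    (![0,1,1,1,0,1,0,0], ![0,1,0,-2,1,0,0,0], .case4)]

/-- Hidden sector embeddings completing CMM 9 with `3V_B = (1,1,0,0,0,0,0,0)`. -/
def table9a : List TableEntry :=
  table .cmm9 ![1,1,0,0,0,0,0,0]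
   [(![1,0,1,0,0,0,0,0], ![-1,1,-1,1,1,1,1,1], .case1),
    (![1,0,1,0,0,0,0,0], ![1,2,0,1,1,1,0,0], .case2),
    (![-1,-1,1,1,1,1,1,-1], ![0,0,2,0,-1,-1,-1,1], .case2),
    (![-1,-1,1,1,1,1,1,-1], ![0,0,0,0,0,-1,-1,0], .case3),
    (![-1,-1,1,1,1,1,1,-1], ![-1,-2,1,0,0,0,-1,-1], .case4)]

/-- Hidden sector embeddings completing CMM 9 with `3V_B = (2,1,1,1,1,0,0,0)`. -/
def table9b : List TableEntry :=
  table .cmm9 ![2,1,1,1,1,0,0,0]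
   [(![-1,0,0,0,0,1,0,0], ![-1,0,0,0,-1,0,0,0], .case2),
    (![0,1,0,0,0,1,0,0], ![-1,-1,-1,-1,-1,-1,1,1], .case2),
    (![-2,0,0,0,-1,1,1,1], ![-1,-1,-1,-1,-1,1,1,-1], .case2),
    (![-1,0,0,0,0,1,0,0], ![-2,1,0,0,0,-1,1,-1], .case3),
    (![-2,0,0,0,-1,1,1,1], ![-2,0,0,-1,-1,1,1,0], .case3),
    (![-1,0,0,0,0,1,0,0], ![-2,0,0,-1,-1,-1,1,0], .case4),
    (![0,1,0,0,0,1,0,0], ![-2,-1,0,0,-1,-1,1,0], .case4),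
    (![-2,0,0,0,-1,1,1,-1], ![-2,0,0,-1,-1,1,0,-1], .case4),
    (![-2,0,0,0,-1,1,1,-1], ![-2,1,0,0,0,-1,-1,1], .case4),
    (![-2,0,0,0,-1,1,1,-1], ![-2,1,0,0,0,1,1,-1], .case4),
    (![-2,0,0,0,-1,1,1,-1], ![-1,-1,-1,-1,-1,1,-1,-1], .case4),
    (![-2,0,0,0,-1,1,1,-1], ![-1,1,1,-1,1,-1,-1,1], .case4),
    (![-2,0,0,0,-1,1,1,-1], ![-1,1,1,1,-1,1,-1,-1], .case4),
    (![-2,0,0,0,-1,1,1,-1], ![1,-1,-1,-1,1,1,-1,-1], .case4),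
    (![-2,0,0,0,-1,1,1,-1], ![1,1,1,1,1,1,-1,-1], .case4),
    (![-2,0,0,0,-1,1,1,1], ![-2,0,-1,-1,0,1,0,-1], .case4)]

/-- All displayed hidden sector embeddings. -/
def displayedTable : List TableEntry :=
  table1 ++ table2 ++ table4 ++ table6 ++ table8a ++ table8b ++ table9a ++ table9b

end HiddenSector

/-! ### Sign identities and the coordinates of root vectors -/

namespace HiddenSector

attribute [local instance 100] LieRing.ofAssociativeRing

/-! The problem depends only on classes modulo three. Multiplied by three, a hidden embedding
becomes a triple of vectors of `Λ/3Λ`, and since 2 is invertible modulo three this quotient is `𝔽₃⁸`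
with its standard scalar product. Operation (I) forgets everything except the class
(`equivalent_of_hasClass`), operation (II) is the action of the Weyl group, consistency prescribes
the Gram matrix of the triple over `𝔽₃` (`isConsistent_iff`), and the unbroken roots are those
orthogonal modulo three to all three vectors (`rootSet_eq_of_hasClass`). What remains is a finite
problem about triples with given Gram matrix.

It is solved along a chain of stabilisers: the vector `3V` is moved to a representative, then `3a₁`
by reflections which fix `3V`, then `3a₃` by reflections words which fix both. Every step is a
descent in which a word of reflections lowers the vector, read as a number in base three, or sends
it directly to a representative (`exists_equiv_mem`). This proves that every triple reaches the list
of 192 (`exists_entry`). Inequivalence of the members of the list is neither claimed nor used.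

For each entry a search finds, among the unbroken roots, a basis with one of five Cartan matrices
(`hasBasis_of_gaugeCheck`). The passage from such a basis to an isomorphism of real Lie algebras is
`hasGaugeGroup_of_basis`. The weights of a standard or vector representation are realised as lattice
vectors `b i`, up to a common translation. Suitable signs absorb the cocycle `ε`, so that sending
`e_α` to the signed matrix units with `b i - b j = α` is a representation on the elements supported
on the unbroken roots (`blockMatrix_lie`). On the compact form the matrices are skew-Hermitian,
which gives maps to `su(n)`; for the vector representation of `D₅` they also respect a real
structure, which gives a map to `so(10)`. With the projection of the Cartan part to the quotient of
`ℝ⁸` by the span of the unbroken roots one obtains an injective homomorphism, and equality of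
dimensions makes it bijective.

The five algebras have different dimensions, so the label of an embedding is unique, and viability
can be read off from the label. -/

theorem asymForm_sub_left (a b c : Fin 8 → ℤ) :
    asymForm (a - b) c = asymForm a c - asymForm b c := by
  rw [sub_eq_add_neg, asymForm_add_left, asymForm_neg_left, sub_eq_add_neg]

theorem asymForm_sub_right (a b c : Fin 8 → ℤ) :
    asymForm a (b - c) = asymForm a b - asymForm a c := by
  rw [sub_eq_add_neg, asymForm_add_right, asymForm_neg_right, sub_eq_add_neg]

theorem pairing_sub_left (a b c : Fin 8 → ℤ) :
    pairing (a - b) c = pairing a c - pairing b c := by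
  rw [sub_eq_add_neg, pairing_add_left, pairing_neg_left, sub_eq_add_neg]

theorem pairing_sub_right (a b c : Fin 8 → ℤ) :
    pairing a (b - c) = pairing a b - pairing a c := by
  rw [sub_eq_add_neg, pairing_add_right, pairing_neg_right, sub_eq_add_neg]

theorem neg_one_zpow_congr {a b : ℤ} (h : Even (a - b)) : (-1 : ℂ) ^ a = (-1) ^ b := by
  rw [show a = b + (a - b) by ring, zpow_add₀ (by norm_num), h.neg_one_zpow, mul_one]

theorem neg_one_zpow_eq_neg {a b : ℤ} (h : Odd (a - b)) : (-1 : ℂ) ^ a = -(-1) ^ b := by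
  rw [show a = b + (a - b) by ring, zpow_add₀ (by norm_num), h.neg_one_zpow, mul_neg_one]

theorem rootValue_sub (a b : Fin 8 → ℤ) (h : Fin 8 → ℂ) :
    rootValue (a - b) h = rootValue a h - rootValue b h := by
  rw [sub_eq_add_neg, rootValue_add, rootValue_neg, sub_eq_add_neg]

namespace E8Algebra

/-- The coefficient of the root vector `e_m`, and `0` if `m` is not a root. -/
noncomputable def rootAt (m : Fin 8 → ℤ) : E8Algebra →ₗ[ℂ] ℂ where
  toFun x := ∑ γ : Root, if γ.1 = m then x.root γ else 0
  map_add' x y := by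
    simp only [root_add, Pi.add_apply, ← Finset.sum_add_distrib]
    exact Finset.sum_congr rfl fun _ _ => by split_ifs <;> simp
  map_smul' c x := by
    simp only [root_smul, Pi.smul_apply, smul_eq_mul, RingHom.id_apply, Finset.mul_sum]
    exact Finset.sum_congr rfl fun _ _ => by split_ifs <;> simp

theorem rootAt_apply (m : Fin 8 → ℤ) (x : E8Algebra) :
    rootAt m x = ∑ γ : Root, if γ.1 = m then x.root γ else 0 := rfl

theorem rootAt_root (γ : Root) (x : E8Algebra) : rootAt γ.1 x = x.root γ := by
  rw [rootAt_apply, Finset.sum_eq_single γ]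
  · simp
  · intro δ _ hδ
    rw [if_neg fun h => hδ (Subtype.ext h)]
  · simp

theorem rootAt_of_ne (m : Fin 8 → ℤ) (hm : pairing m m ≠ 2) (x : E8Algebra) :
    rootAt m x = 0 := by
  rw [rootAt_apply]
  refine Finset.sum_eq_zero fun γ _ => if_neg ?_
  rintro rfl
  exact hm γ.2

theorem rootAt_hEl (m : Fin 8 → ℤ) (h) : rootAt m (hEl h) = 0 := by simp [rootAt_apply]

theorem rootAt_eEl (m n : Fin 8 → ℤ) (hn : pairing n n = 2) :
    rootAt m (eEl n) = if m = n then 1 else 0 := by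
  split_ifs with h
  · subst h
    rw [show rootAt m (eEl m) = (eEl m).root ⟨m, hn⟩ from rootAt_root ⟨m, hn⟩ _]
    simp
  · rw [rootAt_apply]
    refine Finset.sum_eq_zero fun γ _ => ?_
    rw [eEl_root]
    split_ifs with h1 h2
    · exact (h (h1.symm.trans h2)).elim
    · rfl
    · rfl

/-- The elements whose root components are supported on `R`. -/
def IsSupported (R : Set Root) (x : E8Algebra) : Prop := ∀ α ∉ R, x.root α = 0

end E8Algebra

open E8Algebra

/-! ### Matrix representations from minuscule weights -/

section Block

variable {ι : Type*}

/-- The sign by which a root vector enters the matrix of the block. -/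
noncomputable def blockSign (b : ι → Fin 8 → ℤ) (f : ι → ℤ) (i j : ι) : ℂ :=
  (-1) ^ (f i + f j + asymForm (b i) (b j) + asymForm (b j) (b j))

theorem blockSign_ne_zero (b : ι → Fin 8 → ℤ) (f : ι → ℤ) (i j : ι) : blockSign b f i j ≠ 0 :=
  zpow_ne_zero _ (by norm_num)

/-- By bilinearity of `q` the exponents differ by `2 (f j + q (b j, b j))`. Thus signed matrix units
multiply with the structure constants of the root vectors. The function `f` is the freedom of
conjugating by a diagonal matrix of signs; it is needed only for the vector representation. -/
theorem blockSign_mul (b : ι → Fin 8 → ℤ) (f : ι → ℤ) (i j k : ι) :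
    blockSign b f i j * blockSign b f j k =
      cocycle (b i - b j) (b j - b k) * blockSign b f i k := by
  rw [blockSign, blockSign, blockSign, cocycle, ← zpow_add₀ (by norm_num),
    ← zpow_add₀ (by norm_num)]
  refine neg_one_zpow_congr ?_
  simp only [asymForm_sub_left, asymForm_sub_right]
  exact ⟨f j + asymForm (b j) (b j), by ring⟩

/-- The exponent is `q` of the root `b i - b j`, which is one, plus an even number. The sign matches
the convention `[e_α, e_{-α}] = -∑ α_I H_I`. -/
theorem blockSign_mul_swap (b : ι → Fin 8 → ℤ) (f : ι → ℤ) (i j : ι)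
    (h : pairing (b i - b j) (b i - b j) = 2) : blockSign b f i j * blockSign b f j i = -1 := by
  rw [blockSign, blockSign, ← zpow_add₀ (by norm_num)]
  rw [pairing_eq] at h
  simp only [asymForm_sub_left, asymForm_sub_right] at h
  refine Odd.neg_one_zpow ⟨f i + f j + asymForm (b i) (b j) + asymForm (b j) (b i), ?_⟩
  linarith

theorem conj_blockSign (b : ι → Fin 8 → ℤ) (f : ι → ℤ) (i j : ι) :
    conj (blockSign b f i j) = blockSign b f i j := by
  simp [blockSign]

theorem blockSign_swap (b : ι → Fin 8 → ℤ) (f : ι → ℤ) (i j : ι)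
    (h : pairing (b i - b j) (b i - b j) = 2) : blockSign b f j i = -blockSign b f i j := by
  have h1 := blockSign_mul_swap b f i j h
  have h2 : blockSign b f i j * blockSign b f i j = 1 := by
    rw [blockSign, ← zpow_add₀ (by norm_num)]
    exact Even.neg_one_zpow ⟨_, rfl⟩
  linear_combination blockSign b f i j * h1 - blockSign b f j i * h2

variable [Fintype ι]

/-- `n` times the value on `m` of the weight `b i - (∑ b j) / n`. -/
def centeredPairing (b : ι → Fin 8 → ℤ) (i : ι) (m : Fin 8 → ℤ) : ℤ :=
  Fintype.card ι * pairing (b i) m - ∑ j, pairing (b j) m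

/-- The value on a Cartan element of the weight `b i - (∑ b j) / n`. -/
noncomputable def centeredWeight (b : ι → Fin 8 → ℤ) (i : ι) : (Fin 8 → ℂ) →ₗ[ℂ] ℂ :=
  rootValue (b i) - (Fintype.card ι : ℂ)⁻¹ • ∑ j, rootValue (b j)

theorem centeredWeight_apply (b : ι → Fin 8 → ℤ) (i : ι) (h : Fin 8 → ℂ) :
    centeredWeight b i h = rootValue (b i) h - (Fintype.card ι : ℂ)⁻¹ * ∑ j, rootValue (b j) h := by
  simp [centeredWeight]

theorem centeredWeight_sub (b : ι → Fin 8 → ℤ) (i j : ι) (h : Fin 8 → ℂ) :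
    centeredWeight b i h - centeredWeight b j h = rootValue (b i - b j) h := by
  rw [centeredWeight_apply, centeredWeight_apply, rootValue_sub]; ring

/-- Clearing the denominator `n` moves conditions on the values of the centred weights to integers,
where they can be decided. -/
theorem card_mul_centeredWeight [Nonempty ι] (b : ι → Fin 8 → ℤ) (i : ι) (m : Fin 8 → ℤ) :
    (Fintype.card ι : ℂ) * centeredWeight b i (fun I => (latticeVec m I : ℂ)) =
      centeredPairing b i m := by
  have : (Fintype.card ι : ℂ) ≠ 0 := by exact_mod_cast Fintype.card_ne_zero
  simp only [centeredWeight_apply, rootValue_latticeVec, centeredPairing]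
  push_cast
  field_simp

theorem sum_centeredWeight [Nonempty ι] (b : ι → Fin 8 → ℤ) (h : Fin 8 → ℂ) :
    ∑ i, centeredWeight b i h = 0 := by
  have : (Fintype.card ι : ℂ) ≠ 0 := by exact_mod_cast Fintype.card_ne_zero
  simp only [centeredWeight_apply, Finset.sum_sub_distrib, Finset.sum_const, Finset.card_univ,
    nsmul_eq_mul]
  field_simp
  ring

variable [DecidableEq ι]

/-- The vectors `b i` are, up to a common translation, the weights of a representation of the Lie
algebra with root system `R` on which all roots take values in `{-1, 0, 1}`. -/
structure IsMinuscule (R : Set Root) (b : ι → Fin 8 → ℤ) (f : ι → ℤ) : Prop where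
  injective : Function.Injective b
  -- A value 1, -1 or 0 of the weight on `α` means that one can go down by `α`, go up by `α`, or do
  -- neither.
  trichotomy : ∀ α ∈ R, ∀ i,
    ((∃ k, b i - b k = α.1) ∧ (∀ k, b k - b i ≠ α.1) ∧
      centeredPairing b i α.1 = Fintype.card ι) ∨
    ((∀ k, b i - b k ≠ α.1) ∧ (∃ k, b k - b i = α.1) ∧
      centeredPairing b i α.1 = -Fintype.card ι) ∨
    ((∀ k, b i - b k ≠ α.1) ∧ (∀ k, b k - b i ≠ α.1) ∧ centeredPairing b i α.1 = 0)
  -- Here `α + β` is a difference of weights but not a root, so `[e_α, e_β] = 0`; the two products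
  -- in the commutator of matrices then have to agree.
  cancel : ∀ α ∈ R, ∀ β ∈ R, pairing α.1 β.1 ≠ -1 → ∀ i l, i ≠ l → b i - b l = α.1 + β.1 →
    (∑ j, if b i - b j = α.1 then blockSign b f i j * blockSign b f j l else 0) =
    ∑ j, if b i - b j = β.1 then blockSign b f i j * blockSign b f j l else 0

/-- The matrices of the representation with weights `b i - (∑ b j) / n`. -/
noncomputable def blockMatrix (b : ι → Fin 8 → ℤ) (f : ι → ℤ) :
    E8Algebra →ₗ[ℂ] Matrix ι ι ℂ where
  toFun x := Matrix.of fun i j =>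
    if i = j then centeredWeight b i x.cartan else blockSign b f i j * rootAt (b i - b j) x
  map_add' x y := by
    ext i j
    by_cases h : i = j <;> simp [h, mul_add]
  map_smul' c x := by
    ext i j
    by_cases h : i = j <;> simp [h]; ring

theorem blockMatrix_apply (b : ι → Fin 8 → ℤ) (f : ι → ℤ) (x : E8Algebra) (i j : ι) :
    blockMatrix b f x i j =
      if i = j then centeredWeight b i x.cartan else blockSign b f i j * rootAt (b i - b j) x :=
  rfl

theorem blockMatrix_hEl (b : ι → Fin 8 → ℤ) (f : ι → ℤ) (h : Fin 8 → ℂ) :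
    blockMatrix b f (hEl h) = Matrix.diagonal fun i => centeredWeight b i h := by
  ext i j
  rw [blockMatrix_apply, Matrix.diagonal_apply]
  split_ifs <;> simp [rootAt_hEl]

theorem blockMatrix_eEl (b : ι → Fin 8 → ℤ) (f : ι → ℤ) (α : Root) (i j : ι) :
    blockMatrix b f (eEl α.1) i j = if b i - b j = α.1 then blockSign b f i j else 0 := by
  rw [blockMatrix_apply, rootAt_eEl _ _ α.2]
  split_ifs with h1 h2 h2
  · subst h1
    have := α.2
    rw [← h2, sub_self] at this
    simp [pairing] at this
  · simp
  · simp
  · simp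

variable {R : Set Root} {b : ι → Fin 8 → ℤ} {f : ι → ℤ}

theorem blockMatrix_hEl_eEl (h : Fin 8 → ℂ) (α : Root) :
    blockMatrix b f ⁅hEl h, eEl α.1⁆ = ⁅blockMatrix b f (hEl h), blockMatrix b f (eEl α.1)⁆ := by
  ext i j
  rw [bracket_h_e, map_smul, blockMatrix_hEl, Ring.lie_def, Matrix.sub_apply,
    Matrix.diagonal_mul, Matrix.mul_diagonal, Matrix.smul_apply, blockMatrix_eEl]
  split_ifs with hij
  · rw [← hij, ← centeredWeight_sub b, smul_eq_mul]; ring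
  · simp

/-- Both sides live at the positions with `b i - b l = α + β`. On the diagonal `β = -α`, and the
trichotomy says that the commutator has the value of the weight. Off the diagonal, either `α + β` is
not a root and `cancel` applies, or exactly one of the orders "first `α`" and "first `β`" has an
intermediate weight, and `blockSign_mul` gives its coefficient. -/
theorem blockMatrix_eEl_eEl [Nonempty ι] (hb : IsMinuscule R b f) {α β : Root} (hα : α ∈ R)
    (hβ : β ∈ R) :
    blockMatrix b f ⁅eEl α.1, eEl β.1⁆ =
      ⁅blockMatrix b f (eEl α.1), blockMatrix b f (eEl β.1)⁆ := by
  have hn : (Fintype.card ι : ℤ) ≠ 0 := by exact_mod_cast Fintype.card_ne_zero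
  have hn' : 0 < (Fintype.card ι : ℤ) := by exact_mod_cast Fintype.card_pos
  have hnC : (Fintype.card ι : ℂ) ≠ 0 := by exact_mod_cast Fintype.card_ne_zero
  have hz : ∀ γ : Root, γ.1 ≠ 0 := fun γ h => by
    have := γ.2; rw [h] at this; simp [pairing] at this
  -- the products of two matrices of root vectors
  have hprod : ∀ γ δ : Root, ∀ i l, (blockMatrix b f (eEl γ.1) * blockMatrix b f (eEl δ.1)) i l =
      if b i - b l = γ.1 + δ.1 then
        ∑ j, if b i - b j = γ.1 then blockSign b f i j * blockSign b f j l else 0 else 0 := by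
    intro γ δ i l
    rw [Matrix.mul_apply]
    simp only [blockMatrix_eEl]
    split_ifs with h
    · refine Finset.sum_congr rfl fun j _ => ?_
      by_cases h1 : b i - b j = γ.1
      · have h2 : b j - b l = δ.1 := by
          rw [← h1] at h
          have : b j - b l = (b i - b l) - (b i - b j) := by abel
          rw [this, h]; abel
        simp [h1, h2]
      · simp [h1]
    · refine Finset.sum_eq_zero fun j _ => ?_
      by_cases h1 : b i - b j = γ.1
      · have h2 : b j - b l ≠ δ.1 := by
          intro h2
          exact h (by rw [← h1, ← h2]; abel)
        simp [h2]
      · simp [h1]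
  have huniq : ∀ i j l, b i - b j = α.1 → b i - b l = α.1 → l = j := fun i j l h1 h2 =>
    hb.injective (sub_right_injective (h2.trans h1.symm))
  ext i l
  rw [Ring.lie_def, Matrix.sub_apply, hprod, hprod, add_comm β.1 α.1]
  by_cases hil : b i - b l = α.1 + β.1
  swap
  · rw [if_neg hil, if_neg hil, sub_zero, bracket_e_e, map_add, map_smul, Matrix.add_apply,
      Matrix.smul_apply]
    have h1 : blockMatrix b f (eEl (α.1 + β.1)) i l = 0 := by
      by_cases hr : pairing (α.1 + β.1) (α.1 + β.1) = 2
      · exact (blockMatrix_eEl b f ⟨_, hr⟩ i l).trans (if_neg hil)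
      · rw [eEl_eq_zero _ hr]; simp
    rw [h1]
    split_ifs with h0
    · rw [blockMatrix_hEl, Matrix.diagonal_apply, if_neg]
      · simp
      · rintro rfl
        rw [h0, sub_self] at hil
        exact hil rfl
    · simp
  rw [if_pos hil, if_pos hil]
  by_cases hii : i = l
  · subst hii
    rw [sub_self] at hil
    have hβα : β = -α := Subtype.ext (by
      rw [Root.neg_val]; exact eq_neg_of_add_eq_zero_right hil.symm)
    have hs : ∀ j, pairing (b i - b j) (b i - b j) = 2 →
      blockSign b f i j * blockSign b f j i = -1 := fun j => blockSign_mul_swap b f i j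
    rw [bracket_e_e, if_pos hil.symm, ← hil, eEl_zero, smul_zero, add_zero, blockMatrix_hEl,
      Matrix.diagonal_apply_eq]
    have hw : centeredWeight b i (fun I => -(latticeVec α.1 I : ℂ)) =
        -centeredWeight b i (fun I => (latticeVec α.1 I : ℂ)) := by
      rw [← map_neg]; rfl
    rw [hw]
    have hc := card_mul_centeredWeight b i α.1
    have hneg : ∀ k, b i - b k = β.1 ↔ b k - b i = α.1 := fun k => by
      rw [hβα, Root.neg_val, ← neg_sub (b k), neg_inj]
    simp only [hneg]
    rcases hb.trichotomy α hα i with ⟨⟨k, hk⟩, h2, h3⟩ | ⟨h1, ⟨k, hk⟩, h3⟩ | ⟨h1, h2, h3⟩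
    · rw [Finset.sum_eq_single k, if_pos hk, hs k (by rw [hk, α.2]), Finset.sum_eq_zero]
      · rw [h3] at hc
        have : centeredWeight b i (fun I => (latticeVec α.1 I : ℂ)) = 1 := by
          apply mul_left_cancel₀ hnC; rw [hc]; simp
        rw [this]; ring
      · intro j _; rw [if_neg (h2 j)]
      · intro j _ hj
        rw [if_neg fun h => hj (huniq i k j hk h)]
      · simp
    · rw [Finset.sum_eq_zero, Finset.sum_eq_single k, if_pos hk,
        hs k (by rw [(hneg k).2 hk, β.2])]
      · rw [h3] at hc
        have : centeredWeight b i (fun I => (latticeVec α.1 I : ℂ)) = -1 := by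
          apply mul_left_cancel₀ hnC; rw [hc]; simp
        rw [this]; ring
      · intro j _ hj
        refine if_neg fun h => hj (hb.injective (sub_left_injective (h.trans hk.symm)))
      · simp
      · intro j _; rw [if_neg (h1 j)]
    · rw [Finset.sum_eq_zero, Finset.sum_eq_zero]
      · rw [h3] at hc
        have : centeredWeight b i (fun I => (latticeVec α.1 I : ℂ)) = 0 := by
          apply mul_left_cancel₀ hnC; rw [hc]; simp
        rw [this]; ring
      · intro j _; rw [if_neg (h2 j)]
      · intro j _; rw [if_neg (h1 j)]
  have hne0 : α.1 + β.1 ≠ 0 := fun h => by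
    rw [h] at hil; exact hii (hb.injective (sub_eq_zero.1 hil))
  rw [bracket_e_e, if_neg hne0, zero_add, map_smul, Matrix.smul_apply]
  by_cases hp : pairing α.1 β.1 = -1
  swap
  · rw [eEl_eq_zero _ (by rw [pairing_self_add]; omega), map_zero,
      hb.cancel α hα β hβ hp i l hii hil]
    simp
  have hroot : pairing (α.1 + β.1) (α.1 + β.1) = 2 := by rw [pairing_self_add, hp]; rfl
  have hM : blockMatrix b f (eEl (α.1 + β.1)) i l = blockSign b f i l :=
    (blockMatrix_eEl b f ⟨_, hroot⟩ i l).trans (if_pos hil)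
  rw [hM, smul_eq_mul]
  -- the value of `α` on the weights
  have hdiff : centeredPairing b i α.1 - centeredPairing b l α.1 = Fintype.card ι := by
    have h1 : pairing (b i) α.1 - pairing (b l) α.1 = 1 := by
      rw [← pairing_sub_left, hil, pairing_add_left, α.2, pairing_comm, hp]; rfl
    simp only [centeredPairing]
    linear_combination (Fintype.card ι : ℤ) * h1
  -- Two numbers among `n, 0, -n` with difference `n` are `n, 0` or `0, -n`: either the path through
  -- `α` first exists, or the one through `β` first, and never both.
  have hcases : ((∃ k, b i - b k = α.1) ∧ ∀ k, b k - b l ≠ α.1) ∨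
      ((∃ k, b k - b l = α.1) ∧ ∀ k, b i - b k ≠ α.1) := by
    rcases hb.trichotomy α hα i with ⟨h1, h2, h3⟩ | ⟨h1, h2, h3⟩ | ⟨h1, h2, h3⟩ <;>
    rcases hb.trichotomy α hα l with ⟨k1, k2, k3⟩ | ⟨k1, k2, k3⟩ | ⟨k1, k2, k3⟩ <;>
    first
    | exact Or.inl ⟨h1, k2⟩
    | exact Or.inr ⟨k2, h1⟩
    | (exfalso; omega)
  have hβl : ∀ j, b i - b j = β.1 ↔ b j - b l = α.1 := fun j => by
    constructor
    · intro h
      have : b j - b l = (b i - b l) - (b i - b j) := by abel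
      rw [this, h, hil]; abel
    · intro h
      have : b i - b j = (b i - b l) - (b j - b l) := by abel
      rw [this, h, hil]; abel
  simp only [hβl]
  rcases hcases with ⟨⟨k, hk⟩, h2⟩ | ⟨⟨k, hk⟩, h1⟩
  · rw [Finset.sum_eq_single k, if_pos hk, Finset.sum_eq_zero, sub_zero, blockSign_mul, hk]
    · congr 2
      have : b k - b l = (b i - b l) - (b i - b k) := by abel
      rw [this, hk, hil]; abel
    · intro j _; rw [if_neg (h2 j)]
    · intro j _ hj
      rw [if_neg fun h => hj (huniq i k j hk h)]
    · simp
  · rw [Finset.sum_eq_zero, Finset.sum_eq_single k, if_pos hk, zero_sub, blockSign_mul, hk,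
      (hβl k).2 hk, ← neg_mul]
    · congr 1
      -- `q(α, β) + q(β, α) = -1` is odd, so `ε(β, α) = -ε(α, β)`, which absorbs the minus sign of
      -- the commutator.
      have := pairing_eq α.1 β.1
      rw [hp] at this
      exact neg_one_zpow_eq_neg ⟨-1 - asymForm β.1 α.1, by omega⟩
    · intro j _ hj
      refine if_neg fun h => hj (hb.injective (sub_left_injective (h.trans hk.symm)))
    · simp
    · intro j _; rw [if_neg (h1 j)]

/-- The defect from being a homomorphism is bilinear, so Cartan elements and the root vectors of `R`
suffice. The supports are essential: nothing is known about root vectors outside `R`. -/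
theorem blockMatrix_lie [Nonempty ι] (hb : IsMinuscule R b f) {x y : E8Algebra}
    (hx : IsSupported R x) (hy : IsSupported R y) :
    blockMatrix b f ⁅x, y⁆ = ⁅blockMatrix b f x, blockMatrix b f y⁆ := by
  have hhh : ∀ h k, blockMatrix b f ⁅hEl h, hEl k⁆ =
      ⁅blockMatrix b f (hEl h), blockMatrix b f (hEl k)⁆ := fun h k => by
    rw [bracket_h_h, map_zero, blockMatrix_hEl, blockMatrix_hEl, Ring.lie_def,
      Matrix.diagonal_mul_diagonal, Matrix.diagonal_mul_diagonal]
    simp [mul_comm]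
  have heh : ∀ (α : Root) h, blockMatrix b f ⁅eEl α.1, hEl h⁆ =
      ⁅blockMatrix b f (eEl α.1), blockMatrix b f (hEl h)⁆ := fun α h => by
    rw [← lie_skew, map_neg, blockMatrix_hEl_eEl, lie_skew]
  -- sums over the roots
  have hsum : ∀ (B : E8Algebra →ₗ[ℂ] Matrix ι ι ℂ) (z : E8Algebra), IsSupported R z →
      (∀ h, B (hEl h) = 0) → (∀ α ∈ R, B (eEl α.1) = 0) → B z = 0 := by
    intro B z hz h1 h2
    rw [eq_sum z, map_add, h1, zero_add, map_sum]
    refine Finset.sum_eq_zero fun α _ => ?_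
    by_cases hα : α ∈ R
    · rw [map_smul, h2 α hα, smul_zero]
    · rw [hz α hα, zero_smul, map_zero]
  let D : E8Algebra →ₗ[ℂ] E8Algebra →ₗ[ℂ] Matrix ι ι ℂ :=
    LinearMap.mk₂ ℂ (fun u v => blockMatrix b f ⁅u, v⁆ - ⁅blockMatrix b f u, blockMatrix b f v⁆)
      (fun u u' v => by simp only [add_lie, map_add]; abel)
      (fun c u v => by simp only [smul_lie, map_smul, smul_sub])
      (fun u v v' => by simp only [lie_add, map_add]; abel)
      (fun c u v => by simp only [lie_smul, map_smul, smul_sub])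
  have hD : ∀ u v, D u v = blockMatrix b f ⁅u, v⁆ - ⁅blockMatrix b f u, blockMatrix b f v⁆ :=
    fun _ _ => rfl
  rw [← sub_eq_zero, ← hD]
  refine hsum (D.flip y) x hx (fun h => ?_) (fun α hα => ?_)
  · refine hsum (D (hEl h)) y hy (fun k => ?_) (fun β hβ => ?_)
    · rw [hD, hhh, sub_self]
    · rw [hD, blockMatrix_hEl_eEl, sub_self]
  · refine hsum (D (eEl α.1)) y hy (fun k => ?_) (fun β hβ => ?_)
    · rw [hD, heh, sub_self]
    · rw [hD, blockMatrix_eEl_eEl hb hα hβ, sub_self]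

end Block

end HiddenSector

/-! ### Real coordinates and dimensions of the gauge algebra, `su(n)` and `so(n)` -/

namespace HiddenSector

attribute [local instance 100] LieRing.ofAssociativeRing

open E8Algebra

/-- The roots on which the twist embedding and the Wilson lines act trivially. -/
def rootSet (E : Embedding) : Set Root :=
  {α | phase E.V α.1 = 1 ∧ phase E.a₁ α.1 = 1 ∧ phase E.a₃ α.1 = 1}

theorem shiftAction_eq_self_iff (v : Fin 8 → ℝ) (x : E8Algebra) :
    shiftAction v x = x ↔ ∀ α : Root, phase v α.1 = 1 ∨ x.root α = 0 := by
  have h : ∀ α : Root, phase v α.1 * x.root α = x.root α ↔ phase v α.1 = 1 ∨ x.root α = 0 :=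
    fun α => by
      rw [← sub_eq_zero, ← sub_one_mul, mul_eq_zero, sub_eq_zero]
  constructor
  · intro hx α
    exact (h α).1 (congrFun (congrArg E8Algebra.root hx) α)
  · intro hx
    exact E8Algebra.ext rfl (funext fun α => (h α).2 (hx α))

/-- The three automorphisms are diagonal in the root vectors, so invariance only restricts the
support. -/
theorem mem_gaugeAlgebra (E : Embedding) (x : E8Algebra) :
    x ∈ gaugeAlgebra E ↔ x ∈ compactForm ∧ IsSupported (rootSet E) x := by
  change (x ∈ compactForm ∧ shiftAction E.V x = x ∧ shiftAction E.a₁ x = x ∧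
    shiftAction E.a₃ x = x) ↔ _
  simp only [shiftAction_eq_self_iff, IsSupported, rootSet, Set.mem_ofPred_eq]
  refine and_congr_right fun _ => ⟨fun h α hα => ?_, fun h => ?_⟩
  · by_contra h0
    exact hα ⟨(h.1 α).resolve_right h0, (h.2.1 α).resolve_right h0, (h.2.2 α).resolve_right h0⟩
  · refine ⟨fun α => ?_, fun α => ?_, fun α => ?_⟩ <;>
    · by_cases h0 : x.root α = 0
      · exact Or.inr h0
      · by_contra h1
        exact h0 (h α (by tauto))

theorem phase_neg (v : Fin 8 → ℝ) (m : Fin 8 → ℤ) (h : phase v m = 1) : phase v (-m) = 1 := by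
  have := phase_add v m (-m)
  rw [add_neg_cancel, phase_zero, h, one_mul] at this
  exact this.symm

theorem neg_mem_rootSet {E : Embedding} {α : Root} (h : α ∈ rootSet E) : -α ∈ rootSet E :=
  ⟨phase_neg _ _ h.1, phase_neg _ _ h.2.1, phase_neg _ _ h.2.2⟩

theorem cartan_conj {E : Embedding} (x : gaugeAlgebra E) (I : Fin 8) :
    conj (x.1.cartan I) = -x.1.cartan I := ((mem_gaugeAlgebra E x.1).1 x.2).1.1 I

theorem root_neg_eq_conj {E : Embedding} (x : gaugeAlgebra E) (α : Root) :
    x.1.root (-α) = conj (x.1.root α) := ((mem_gaugeAlgebra E x.1).1 x.2).1.2 α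

theorem isSupported {E : Embedding} (x : gaugeAlgebra E) : IsSupported (rootSet E) x.1 :=
  ((mem_gaugeAlgebra E x.1).1 x.2).2

theorem rootAt_neg {E : Embedding} (x : gaugeAlgebra E) (m : Fin 8 → ℤ) :
    rootAt (-m) x.1 = conj (rootAt m x.1) := by
  by_cases hm : pairing m m = 2
  · have h1 := rootAt_root (⟨m, hm⟩ : Root) x.1
    have h2 := rootAt_root (-⟨m, hm⟩ : Root) x.1
    rw [Root.neg_val] at h2
    simp only at h1 h2
    rw [h1, h2, root_neg_eq_conj]
  · rw [rootAt_of_ne _ hm, rootAt_of_ne _ (by rwa [pairing_neg_left, pairing_neg_right, neg_neg]),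
      map_zero]

theorem cartan_eq {E : Embedding} (x : gaugeAlgebra E) (I : Fin 8) :
    x.1.cartan I = Complex.I * ((x.1.cartan I).im : ℂ) := by
  have h := congrArg Complex.re (cartan_conj x I)
  simp only [Complex.conj_re, Complex.neg_re] at h
  apply Complex.ext
  · simp; linarith
  · simp

/-- The element of the gauge algebra is determined by the imaginary parts of its Cartan components
and by the sums of the real and the imaginary parts of its root components. -/
noncomputable def gaugeAlgebraEquiv (E : Embedding) :
    gaugeAlgebra E ≃ₗ[ℝ] (Fin 8 → ℝ) × (rootSet E → ℝ) := by
  classical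
  refine LinearEquiv.ofBijective
    { toFun := fun x => (fun I => (x.1.cartan I).im,
        fun α => (x.1.root α.1).re + (x.1.root α.1).im)
      map_add' := fun x y => by
        ext I
        · simp
        · simp; ring
      map_smul' := fun c x => by
        ext I
        · simp
        · simp; ring } ⟨?_, ?_⟩
  · rw [← LinearMap.ker_eq_bot, LinearMap.ker_eq_bot']
    intro x hx
    have h1 : ∀ I, (x.1.cartan I).im = 0 := fun I => congrFun (congrArg Prod.fst hx) I
    have h2 : ∀ α (h : α ∈ rootSet E), (x.1.root α).re + (x.1.root α).im = 0 := fun α h =>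
      congrFun (congrArg Prod.snd hx) ⟨α, h⟩
    refine Subtype.ext (E8Algebra.ext' (fun I => ?_) (fun α => ?_))
    · rw [cartan_eq x I, h1]; simp
    · by_cases hα : α ∈ rootSet E
      · have e1 := h2 α hα
        -- By conjugation the coordinate at `-α` is the difference of the real and the imaginary
        -- part at `α`.
        have e2 := h2 (-α) (neg_mem_rootSet hα)
        rw [root_neg_eq_conj] at e2
        simp only [Complex.conj_re, Complex.conj_im] at e2
        apply Complex.ext
        · simp; linarith
        · simp; linarith
      · rw [isSupported x α hα]; rfl
  · rintro ⟨u, w⟩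
    let g : Root → ℝ := fun α => if h : α ∈ rootSet E then w ⟨α, h⟩ else 0
    have hg : ∀ α ∉ rootSet E, g α = 0 := fun α h => dif_neg h
    -- The sum and the difference of real and imaginary part at `α` are to be `g α` and `g (-α)`;
    -- these are the solutions.
    refine ⟨⟨⟨fun I => ⟨0, u I⟩, fun α => ⟨(g α + g (-α)) / 2, (g α - g (-α)) / 2⟩⟩,
      (mem_gaugeAlgebra E _).2 ⟨⟨fun I => ?_, fun α => ?_⟩, fun α hα => ?_⟩⟩, ?_⟩
    · apply Complex.ext <;> simp
    · apply Complex.ext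
      · simp; ring
      · simp; ring
    · have hα' : -α ∉ rootSet E := fun h => hα (neg_neg α ▸ neg_mem_rootSet h)
      simp only [hg α hα, hg _ hα']
      apply Complex.ext <;> simp
    · refine Prod.ext rfl (funext fun α => ?_)
      change (g α.1 + g (-α.1)) / 2 + (g α.1 - g (-α.1)) / 2 = w α
      have : g α.1 = w α := dif_pos α.2
      rw [this]; ring

theorem finrank_gaugeAlgebra (E : Embedding) :
    Module.finrank ℝ (gaugeAlgebra E) = 8 + (rootSet E).ncard := by
  classical
  have := Fintype.ofFinite (rootSet E)
  rw [(gaugeAlgebraEquiv E).finrank_eq, Module.finrank_prod, Module.finrank_pi,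
    Module.finrank_pi, Fintype.card_fin, ← Nat.card_coe_set_eq, Nat.card_eq_fintype_card]

instance (E : Embedding) : Module.Finite ℝ (gaugeAlgebra E) :=
  Module.Finite.equiv (gaugeAlgebraEquiv E).symm

theorem mem_su {n : ℕ} (A : Matrix (Fin n) (Fin n) ℂ) : A ∈ su n ↔ Aᴴ = -A ∧ A.trace = 0 :=
  Iff.rfl

theorem su_apply {n : ℕ} (A : su n) (i j : Fin n) : A.1 j i = -conj (A.1 i j) := by
  have h := congrFun (congrFun ((mem_su A.1).1 A.2).1 j) i
  rw [Matrix.conjTranspose_apply, Matrix.neg_apply] at h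
  rw [← neg_eq_iff_eq_neg, ← h]; rfl

/-- Real coordinates on `u(n) = su(n) × ℝ`. -/
noncomputable def suEquiv (n : ℕ) [NeZero n] : (su n × ℝ) ≃ₗ[ℝ] (Fin n × Fin n → ℝ) := by
  have hn : (n : ℝ) ≠ 0 := Nat.cast_ne_zero.2 (NeZero.ne n)
  refine LinearEquiv.ofBijective
    { toFun := fun (x : su n × ℝ) (p : Fin n × Fin n) =>
        (x.1.1 p.1 p.2).re + (x.1.1 p.1 p.2).im + if p.1 = p.2 then x.2 else 0
      map_add' := fun x y => funext fun p => by
        have h : (x + y).1.1 p.1 p.2 = x.1.1 p.1 p.2 + y.1.1 p.1 p.2 := rfl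
        simp only [h, Prod.snd_add, Complex.add_re, Complex.add_im, Pi.add_apply]
        split_ifs <;> ring
      map_smul' := fun c x => funext fun p => by
        have h : (c • x).1.1 p.1 p.2 = (c : ℂ) * x.1.1 p.1 p.2 := by
          rw [← Complex.real_smul]; rfl
        simp only [h, Prod.smul_snd, Complex.re_ofReal_mul, Complex.im_ofReal_mul, Pi.smul_apply,
          smul_eq_mul, RingHom.id_apply]
        split_ifs <;> ring } ⟨?_, ?_⟩
  · rw [← LinearMap.ker_eq_bot, LinearMap.ker_eq_bot']
    rintro ⟨A, t⟩ hx
    have h : ∀ i j, (A.1 i j).re + (A.1 i j).im + (if i = j then t else 0) = 0 := fun i j =>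
      congrFun hx (i, j)
    have hre : ∀ i, (A.1 i i).re = 0 := fun i => by
      have := congrArg Complex.re (su_apply A i i)
      simp at this; linarith
    have ht : t = 0 := by
      have htr : ∑ i, (A.1 i i).im = 0 := by
        have := congrArg Complex.im ((mem_su A.1).1 A.2).2
        simpa [Matrix.trace] using this
      have h1 : ∑ i : Fin n, ((A.1 i i).re + (A.1 i i).im + t) = 0 :=
        Finset.sum_eq_zero fun i _ => by simpa using h i i
      simp only [hre, zero_add, Finset.sum_add_distrib, htr, Finset.sum_const, Finset.card_univ,
        Fintype.card_fin, nsmul_eq_mul] at h1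
      exact (mul_eq_zero.1 h1).resolve_left hn
    subst ht
    simp only [ite_self, add_zero] at h
    refine Prod.ext (Subtype.ext (Matrix.ext fun i j => ?_)) rfl
    have e1 := h i j
    have e2 := h j i
    rw [su_apply A i j] at e2
    simp only [Complex.neg_re, Complex.neg_im, Complex.conj_re, Complex.conj_im] at e2
    apply Complex.ext
    · change (A.1 i j).re = 0; linarith
    · change (A.1 i j).im = 0; linarith
  · intro w
    -- The mean of the diagonal is the `u(1)` part; removing it makes the trace zero.
    let t : ℝ := (∑ i, w (i, i)) / n
    let A : Matrix (Fin n) (Fin n) ℂ := Matrix.of fun i j =>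
      ⟨(w (i, j) - w (j, i)) / 2, (w (i, j) + w (j, i)) / 2 - if i = j then t else 0⟩
    have hA : A ∈ su n := by
      refine (mem_su A).2 ⟨?_, ?_⟩
      · ext i j
        rw [Matrix.conjTranspose_apply, Matrix.neg_apply]
        apply Complex.ext
        · simp [A]; ring
        · simp only [A, Matrix.of_apply, Complex.star_def, Complex.conj_im, Complex.neg_im,
            eq_comm (a := i)]
          ring
      · apply Complex.ext
        · simp [A, Matrix.trace]
        · simp [A, Matrix.trace, t]
          field_simp
          simp
    refine ⟨(⟨A, hA⟩, t), funext fun p => ?_⟩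
    change (w (p.1, p.2) - w (p.2, p.1)) / 2 + ((w (p.1, p.2) + w (p.2, p.1)) / 2 -
      if p.1 = p.2 then t else 0) + (if p.1 = p.2 then t else 0) = w p
    ring

theorem finrank_su (n : ℕ) [NeZero n] : Module.finrank ℝ (su n) + 1 = n ^ 2 := by
  have : Module.Finite ℝ (su n × ℝ) := Module.Finite.equiv (suEquiv n).symm
  have : Module.Finite ℝ (su n) := Module.Finite.of_surjective (LinearMap.fst ℝ (su n) ℝ)
    LinearMap.fst_surjective
  have h := (suEquiv n).finrank_eq
  rw [Module.finrank_prod, Module.finrank_self, Module.finrank_pi] at h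
  rw [h, Fintype.card_prod, Fintype.card_fin, sq]

instance (n : ℕ) : Module.Finite ℝ (su n) := Module.Finite.of_injective
  (su n).toSubmodule.subtype (Submodule.subtype_injective _)

theorem so_apply {n : ℕ} (A : so n) (i j : Fin n) : A.1 j i = -A.1 i j := by
  have h := congrFun (congrFun ((LieAlgebra.Orthogonal.mem_so (Fin n) ℝ A.1).1 A.2) i) j
  exact h

/-- The entries above the diagonal are coordinates on `so(n)`. -/
noncomputable def soEquiv (n : ℕ) : so n ≃ₗ[ℝ] ({p : Fin n × Fin n // p.1 < p.2} → ℝ) := by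
  refine LinearEquiv.ofBijective
    { toFun := fun x p => x.1 p.1.1 p.1.2
      map_add' := fun x y => rfl
      map_smul' := fun c x => rfl } ⟨?_, ?_⟩
  · rw [← LinearMap.ker_eq_bot, LinearMap.ker_eq_bot']
    intro A hA
    have h : ∀ i j, i < j → A.1 i j = 0 := fun i j hij => congrFun hA ⟨(i, j), hij⟩
    refine Subtype.ext (Matrix.ext fun i j => ?_)
    rcases lt_trichotomy i j with hij | rfl | hij
    · exact h i j hij
    · have := so_apply A i i
      change A.1 i i = 0
      linarith
    · rw [so_apply A j i, h j i hij]; simp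
  · intro w
    refine ⟨⟨Matrix.of fun i j => if h : i < j then w ⟨(i, j), h⟩ else
      if h : j < i then -w ⟨(j, i), h⟩ else 0,
      (LieAlgebra.Orthogonal.mem_so (Fin n) ℝ _).2 (Matrix.ext fun i j => ?_)⟩, funext fun p => ?_⟩
    · simp only [Matrix.transpose_apply, Matrix.of_apply, Matrix.neg_apply]
      rcases lt_trichotomy i j with hij | rfl | hij
      · simp [hij, hij.not_gt]
      · simp
      · simp [hij, hij.not_gt]
    · exact dif_pos p.2

theorem finrank_so_ten : Module.finrank ℝ (so 10) = 45 := by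
  rw [(soEquiv 10).finrank_eq, Module.finrank_pi]
  decide

instance (n : ℕ) : Module.Finite ℝ (so n) := Module.Finite.equiv (soEquiv n).symm

end HiddenSector

/-! ### Homomorphisms from the gauge algebra to `su(n)` -/

namespace HiddenSector

attribute [local instance 100] LieRing.ofAssociativeRing

open E8Algebra

section Block

variable {ι : Type*} [Fintype ι] [DecidableEq ι] {E : Embedding} {b : ι → Fin 8 → ℤ} {f : ι → ℤ}

theorem conj_rootValue (x : gaugeAlgebra E) (m : Fin 8 → ℤ) :
    conj (rootValue m x.1.cartan) = -rootValue m x.1.cartan := by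
  simp [rootValue_apply, cartan_conj x]

/-- The Cartan components are imaginary; off the diagonal, `x_{-α} = conj x_α` meets the
antisymmetry of the signs. -/
theorem conjTranspose_blockMatrix (x : gaugeAlgebra E) :
    (blockMatrix b f x.1)ᴴ = -blockMatrix b f x.1 := by
  ext i j
  rw [Matrix.conjTranspose_apply, Matrix.neg_apply, blockMatrix_apply, blockMatrix_apply]
  by_cases hij : i = j
  · subst hij
    simp only [if_true, centeredWeight_apply, Complex.star_def, map_sub, map_mul, map_sum,
      conj_rootValue, map_inv₀, Complex.conj_natCast, Finset.sum_neg_distrib]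
    ring
  · rw [if_neg hij, if_neg (Ne.symm hij), Complex.star_def, map_mul, conj_blockSign, ← neg_sub,
      rootAt_neg, Complex.conj_conj]
    by_cases hr : pairing (b i - b j) (b i - b j) = 2
    · rw [blockSign_swap b f i j hr]; ring
    · rw [rootAt_of_ne _ hr]; simp

theorem trace_blockMatrix [Nonempty ι] (x : E8Algebra) : (blockMatrix b f x).trace = 0 := by
  simp only [Matrix.trace, Matrix.diag_apply, blockMatrix_apply, if_true]
  exact sum_centeredWeight b x.cartan

/-- This is the source of injectivity: for a root that is a difference of weights, the off-diagonal
entry controls its root component, and two diagonal entries control its value on the Cartan part. -/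
theorem of_blockMatrix_eq_zero {x : E8Algebra} (h : blockMatrix b f x = 0) {i j : ι}
    (hij : i ≠ j) : rootAt (b i - b j) x = 0 ∧ rootValue (b i - b j) x.cartan = 0 := by
  constructor
  · have := congrFun (congrFun h i) j
    rw [blockMatrix_apply, if_neg hij] at this
    exact (mul_eq_zero.1 this).resolve_left (blockSign_ne_zero b f i j)
  · have h1 := congrFun (congrFun h i) i
    have h2 := congrFun (congrFun h j) j
    rw [blockMatrix_apply, if_pos rfl] at h1 h2
    rw [← centeredWeight_sub, h1, h2]; simp

/-- The representation of the gauge algebra on a block of `n` weights. -/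
noncomputable def suHom {n : ℕ} [NeZero n] {b : Fin n → Fin 8 → ℤ} {f : Fin n → ℤ}
    (hb : IsMinuscule (rootSet E) b f) : gaugeAlgebra E →ₗ⁅ℝ⁆ su n where
  toFun x := ⟨blockMatrix b f x.1, conjTranspose_blockMatrix x, trace_blockMatrix x.1⟩
  map_add' x y := Subtype.ext (map_add (blockMatrix b f) x.1 y.1)
  map_smul' c x := Subtype.ext (by
    change blockMatrix b f (c • x.1) = c • blockMatrix b f x.1
    rw [real_smul_eq, map_smul]; rfl)
  map_lie' {x y} := Subtype.ext (blockMatrix_lie hb (isSupported x) (isSupported y))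

theorem suHom_eq_zero {n : ℕ} [NeZero n] {b : Fin n → Fin 8 → ℤ} {f : Fin n → ℤ}
    (hb : IsMinuscule (rootSet E) b f) {x : gaugeAlgebra E} (h : suHom hb x = 0) :
    blockMatrix b f x.1 = 0 := congrArg Subtype.val h

end Block

/-! ### The vector representation and `so(2n)` -/

section Orthogonal

/-- The change of basis between `ℂ⁵ ⊕ ℂ⁵`, with the real structure which exchanges the two
summands, and the complexification of `ℝ⁵ ⊕ ℝ⁵`. -/
noncomputable def realBasis (n : ℕ) : Matrix (Fin n ⊕ Fin n) (Fin n ⊕ Fin n) ℂ :=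
  Matrix.fromBlocks 1 1 (-Complex.I • 1) (Complex.I • 1)

/-- The inverse of `realBasis`. -/
noncomputable def realBasisInv (n : ℕ) : Matrix (Fin n ⊕ Fin n) (Fin n ⊕ Fin n) ℂ :=
  (2⁻¹ : ℂ) • (realBasis n)ᴴ

theorem realBasis_mul_inv (n : ℕ) : realBasis n * realBasisInv n = 1 := by
  rw [realBasisInv, realBasis, Matrix.mul_smul, Matrix.fromBlocks_conjTranspose,
    Matrix.fromBlocks_multiply, ← Matrix.fromBlocks_one, Matrix.fromBlocks_smul]
  congr 1 <;> ext i j <;> by_cases h : i = j <;>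
    simp [h, Matrix.one_apply] <;> norm_num

theorem realBasisInv_mul (n : ℕ) : realBasisInv n * realBasis n = 1 :=
  mul_eq_one_comm.1 (realBasis_mul_inv n)

theorem conj_realBasis (n : ℕ) :
    (realBasis n).map conj = (realBasis n).submatrix id (Equiv.sumComm _ _) := by
  ext i j
  rcases i with i | i <;> rcases j with j | j <;>
    by_cases h : i = j <;> simp [realBasis, h]

theorem conj_realBasisInv (n : ℕ) :
    (realBasisInv n).map conj = (realBasisInv n).submatrix (Equiv.sumComm _ _) id := by
  have h : (2⁻¹ : ℂ) = ((2⁻¹ : ℝ) : ℂ) := by norm_num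
  ext i j
  rw [Matrix.map_apply, realBasisInv, Matrix.submatrix_apply, Matrix.smul_apply,
    Matrix.smul_apply, smul_eq_mul, smul_eq_mul, map_mul, h, Complex.conj_ofReal]
  congr 1
  rcases i with i | i <;> rcases j with j | j <;>
    by_cases h : j = i <;> simp [realBasis, h]

variable {n : ℕ}

/-- The matrix of `A` in the basis `realBasis`. -/
noncomputable def realForm (A : Matrix (Fin n ⊕ Fin n) (Fin n ⊕ Fin n) ℂ) :
    Matrix (Fin n ⊕ Fin n) (Fin n ⊕ Fin n) ℂ := realBasis n * A * realBasisInv n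

theorem realForm_mul (A B : Matrix (Fin n ⊕ Fin n) (Fin n ⊕ Fin n) ℂ) :
    realForm (A * B) = realForm A * realForm B := by
  simp only [realForm, Matrix.mul_assoc]
  rw [← Matrix.mul_assoc (realBasisInv n) (realBasis n), realBasisInv_mul, Matrix.one_mul]

theorem realForm_eq_zero {A : Matrix (Fin n ⊕ Fin n) (Fin n ⊕ Fin n) ℂ} (h : realForm A = 0) :
    A = 0 := by
  have : A = realBasisInv n * realForm A * realBasis n := by
    simp only [realForm, Matrix.mul_assoc]
    rw [realBasisInv_mul, Matrix.mul_one, ← Matrix.mul_assoc, realBasisInv_mul, Matrix.one_mul]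
  rw [this, h]; simp

/-- Conjugating `realBasis` exchanges its two halves of columns, which cancels the exchange that
conjugation causes in `A`. -/
theorem conj_realForm {A : Matrix (Fin n ⊕ Fin n) (Fin n ⊕ Fin n) ℂ}
    (hA : A.map conj = A.submatrix (Equiv.sumComm _ _) (Equiv.sumComm _ _)) :
    (realForm A).map conj = realForm A := by
  rw [realForm, Matrix.map_mul, Matrix.map_mul, conj_realBasis, conj_realBasisInv, hA,
    Matrix.submatrix_mul_equiv, Matrix.submatrix_mul_equiv, Matrix.submatrix_id_id]

/-- The change of basis is unitary up to the factor `√2`, so it preserves skew-Hermitian matrices.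
With reality this yields skew-symmetric ones. -/
theorem conjTranspose_realForm {A : Matrix (Fin n ⊕ Fin n) (Fin n ⊕ Fin n) ℂ}
    (hA : Aᴴ = -A) : (realForm A)ᴴ = -realForm A := by
  rw [realForm, Matrix.conjTranspose_mul, Matrix.conjTranspose_mul, hA, realBasisInv,
    Matrix.conjTranspose_smul, Matrix.conjTranspose_conjTranspose]
  simp [Matrix.mul_assoc]

theorem map_re_realForm {A : Matrix (Fin n ⊕ Fin n) (Fin n ⊕ Fin n) ℂ}
    (hA : A.map conj = A.submatrix (Equiv.sumComm _ _) (Equiv.sumComm _ _)) :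
    ((realForm A).map Complex.re).map Complex.ofRealHom = realForm A := by
  ext i j
  exact Complex.conj_eq_iff_re.1 (congrFun (congrFun (conj_realForm hA) i) j)

theorem map_ofReal_injective {ι : Type*} :
    Function.Injective fun A : Matrix ι ι ℝ => A.map Complex.ofRealHom :=
  fun _ _ h => Matrix.ext fun i j => Complex.ofReal_injective (congrFun (congrFun h i) j)

variable {ι : Type*} [Fintype ι] [DecidableEq ι] {E : Embedding}

/-- The weights `b i`, together with the signs `f`, are those of the vector representation of
`so(2n)`. -/
structure IsVector (b : Fin n ⊕ Fin n → Fin 8 → ℤ) (f : Fin n ⊕ Fin n → ℤ) : Prop where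
  -- The vector `c` is twice the centre of the weights. The choice of `f` on the first half makes `f
  -- i + f i.swap` congruent to `q (b i, c)` modulo two for every `i`.
  sum_eq : ∃ c, pairing c c = 4 ∧ (∀ i, b i + b i.swap = c) ∧
    ∀ k, f (.inl k) = asymForm (b (.inl k)) c
  sign : ∀ k, f (.inr k) = 0
  norm : ∀ i j, i ≠ j → j ≠ i.swap → pairing (b i - b j) (b i - b j) = 2
  norm_swap : ∀ i, pairing (b i - b i.swap) (b i - b i.swap) = 4

variable {b : Fin n ⊕ Fin n → Fin 8 → ℤ} {f : Fin n ⊕ Fin n → ℤ}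

theorem IsVector.swap_sub (hb : IsVector b f) (i j : Fin n ⊕ Fin n) :
    b j.swap - b i.swap = b i - b j := by
  obtain ⟨c, -, h, -⟩ := hb.sum_eq
  rw [← sub_eq_zero, show b j.swap - b i.swap - (b i - b j) = (b j + b j.swap) -
    (b i + b i.swap) by abel, h, h, sub_self]

/-- The positions `(i, j)` and `(j.swap, i.swap)` carry the same root vector by `swap_sub`. Opposite
signs there mean that the matrix is skew for the bilinear form which pairs `i` with `i.swap`; the
function `f` was chosen for this. -/
theorem IsVector.blockSign_swap (hb : IsVector b f) {i j : Fin n ⊕ Fin n}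
    (hij : pairing (b i - b j) (b i - b j) = 2) :
    blockSign b f j.swap i.swap = -blockSign b f i j := by
  obtain ⟨c, hc, h, hf⟩ := hb.sum_eq
  have hcc : asymForm c c = 2 := by rw [pairing_eq] at hc; omega
  -- On the second half this uses `q (c, c) = 2`: replacing `b i` by `c - b i` does not change the
  -- parity of `q (b i, c)`.
  have hfe : ∀ i, ∃ t, f i + f i.swap = asymForm (b i) c + 2 * t := by
    rintro (k | k)
    · exact ⟨0, by rw [hf, Sum.swap_inl, hb.sign]; ring⟩
    · refine ⟨1 - asymForm (b (.inr k)) c, ?_⟩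
      have : b (.inl k) = c - b (.inr k) := eq_sub_of_add_eq (h (.inl k))
      rw [hb.sign, Sum.swap_inr, hf, this, asymForm_sub_left, hcc]; ring
  obtain ⟨t, ht⟩ := hfe i
  obtain ⟨u, hu⟩ := hfe j
  have hi : b i.swap = c - b i := eq_sub_of_add_eq' (h i)
  have hj : b j.swap = c - b j := eq_sub_of_add_eq' (h j)
  rw [blockSign, blockSign, hi, hj]
  refine neg_one_zpow_eq_neg ?_
  rw [pairing_eq] at hij
  simp only [asymForm_sub_left, asymForm_sub_right, hcc] at hij ⊢
  have hij' : asymForm (b i) (b i) - asymForm (b j) (b i) - (asymForm (b i) (b j)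
    - asymForm (b j) (b j)) = 1 := by omega
  refine ⟨t + u - f i - f j + 2 + asymForm (b i) (b i) - asymForm (b i) (b j)
    - asymForm c (b i) - 1, ?_⟩
  linear_combination ht + hu - hij'

/-- Only `cancel` needs an argument. If `α + β` is a difference of weights but not a root, the two
weights are opposite. Then `α` leads from `i` to some `j` and `β` leads from `i` to `j.swap`, and
two applications of `blockSign_swap` show that the products of signs agree. -/
theorem IsVector.isMinuscule (hb : IsVector b f) {R : Set Root} (hinj : Function.Injective b)
    (ht : ∀ α ∈ R, ∀ i,
      ((∃ k, b i - b k = α.1) ∧ (∀ k, b k - b i ≠ α.1) ∧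
        centeredPairing b i α.1 = Fintype.card (Fin n ⊕ Fin n)) ∨
      ((∀ k, b i - b k ≠ α.1) ∧ (∃ k, b k - b i = α.1) ∧
        centeredPairing b i α.1 = -Fintype.card (Fin n ⊕ Fin n)) ∨
      ((∀ k, b i - b k ≠ α.1) ∧ (∀ k, b k - b i ≠ α.1) ∧ centeredPairing b i α.1 = 0)) :
    IsMinuscule R b f where
  injective := hinj
  trichotomy := ht
  cancel := by
    intro α hα β hβ hp i l hil h
    have hn := pairing_self_add α β
    rw [← h] at hn
    have hl : l = i.swap := by
      by_contra hl
      rw [hb.norm i l hil hl] at hn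
      omega
    rw [hl, hb.norm_swap] at hn
    have hpos : 0 < (Fintype.card (Fin n ⊕ Fin n) : ℤ) := by
      have : Nonempty (Fin n ⊕ Fin n) := ⟨i⟩
      exact_mod_cast Fintype.card_pos
    -- The norm 4 of `α + β` makes `α` and `β` orthogonal. A difference of twice the number of
    -- weights forces the extreme values at `i` and `l`, so one can go down by `α` from `i`.
    have hdiff : centeredPairing b i α.1 - centeredPairing b l α.1 =
        2 * Fintype.card (Fin n ⊕ Fin n) := by
      have h1 : pairing (b i) α.1 - pairing (b l) α.1 = 2 := by
        rw [← pairing_sub_left, h, pairing_add_left, α.2, pairing_comm]; omega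
      simp only [centeredPairing]
      linear_combination (Fintype.card (Fin n ⊕ Fin n) : ℤ) * h1
    have hj : ∃ j, b i - b j = α.1 := by
      rcases ht α hα i with ⟨h1, -, -⟩ | ⟨-, -, h3⟩ | ⟨-, -, h3⟩
      · exact h1
      · rcases ht α hα l with ⟨-, -, k3⟩ | ⟨-, -, k3⟩ | ⟨-, -, k3⟩ <;> (exfalso; omega)
      · rcases ht α hα l with ⟨-, -, k3⟩ | ⟨-, -, k3⟩ | ⟨-, -, k3⟩ <;> (exfalso; omega)
    obtain ⟨j, hj⟩ := hj
    have hj' : b i - b j.swap = β.1 := by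
      have h1 : b j - b l = β.1 := by
        have : b j - b l = (b i - b l) - (b i - b j) := by abel
        rw [this, h, hj]; abel
      rw [← h1, hl, ← hb.swap_sub, Sum.swap_swap]
    rw [Finset.sum_eq_single j, if_pos hj, Finset.sum_eq_single j.swap, if_pos hj', hl,
      hb.blockSign_swap (i := i) (j := j) (by rw [hj, α.2])]
    · have := hb.blockSign_swap (i := i) (j := j.swap) (by rw [hj', β.2])
      rw [Sum.swap_swap] at this
      rw [this]; ring
    · intro k _ hk
      exact if_neg fun h => hk (hinj (sub_right_injective (h.trans hj'.symm)))
    · simp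
    · intro k _ hk
      exact if_neg fun h => hk (hinj (sub_right_injective (h.trans hj.symm)))
    · simp

/-- The matrix is skew-Hermitian and also skew for the form pairing `i` with `i.swap`; together
these describe its complex conjugate. -/
theorem IsVector.conj_blockMatrix [NeZero n] (hb : IsVector b f) (x : gaugeAlgebra E) :
    (blockMatrix b f x.1).map conj =
      (blockMatrix b f x.1).submatrix (Equiv.sumComm _ _) (Equiv.sumComm _ _) := by
  ext i j
  have h1 : conj (blockMatrix b f x.1 i j) = -blockMatrix b f x.1 j i :=
    congrFun (congrFun (conjTranspose_blockMatrix (b := b) (f := f) x) j) i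
  rw [Matrix.map_apply, h1, Matrix.submatrix_apply]
  change _ = blockMatrix b f x.1 i.swap j.swap
  rw [blockMatrix_apply, blockMatrix_apply]
  by_cases hij : i = j
  · subst hij
    simp only [if_true]
    obtain ⟨c, -, h, -⟩ := hb.sum_eq
    -- The mean of the weights is `c / 2`, so the centred weights of `i` and `i.swap` are opposite.
    have hs : ∑ k, rootValue (b k) x.1.cartan = n * rootValue c x.1.cartan := by
      rw [Fintype.sum_sum_type, ← Finset.sum_add_distrib]
      have : ∀ k, rootValue (b (.inl k)) x.1.cartan + rootValue (b (.inr k)) x.1.cartan =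
          rootValue c x.1.cartan := fun k => by rw [← rootValue_add, ← h (.inl k)]; rfl
      simp [this]
    have hc := congrArg (fun m => rootValue m x.1.cartan) (h i)
    simp only [rootValue_add] at hc
    have hn : (n : ℂ) ≠ 0 := Nat.cast_ne_zero.2 (NeZero.ne n)
    rw [centeredWeight_apply, centeredWeight_apply, hs, ← hc]
    simp only [Fintype.card_sum, Fintype.card_fin]
    push_cast
    field_simp
    ring
  · have hij' : i.swap ≠ j.swap := fun h => hij (by
      rw [← Sum.swap_swap i, h, Sum.swap_swap])
    rw [if_neg (Ne.symm hij), if_neg hij', hb.swap_sub]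
    by_cases hr : pairing (b j - b i) (b j - b i) = 2
    · rw [hb.blockSign_swap hr]; ring
    · rw [rootAt_of_ne _ hr]; simp

/-- The vector representation of the gauge algebra. -/
noncomputable def soHom [NeZero n] (hv : IsVector b f) (hb : IsMinuscule (rootSet E) b f) :
    gaugeAlgebra E →ₗ⁅ℝ⁆ so (n + n) where
  toFun x := ⟨((realForm (blockMatrix b f x.1)).map Complex.re).submatrix
      finSumFinEquiv.symm finSumFinEquiv.symm, by
    rw [LieAlgebra.Orthogonal.mem_so]
    ext i j
    have := congrArg Complex.re (congrFun (congrFun (conjTranspose_realForm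
      (conjTranspose_blockMatrix (b := b) (f := f) x)) (finSumFinEquiv.symm i))
      (finSumFinEquiv.symm j))
    rw [Matrix.conjTranspose_apply, Complex.star_def, Complex.conj_re] at this
    exact this⟩
  map_add' x y := Subtype.ext (by
    ext i j
    simp [realForm, Matrix.mul_add, Matrix.add_mul])
  map_smul' c x := Subtype.ext (by
    ext i j
    simp [realForm])
  map_lie' {x y} := Subtype.ext (by
    have hx := map_re_realForm (hv.conj_blockMatrix x)
    have hy := map_re_realForm (hv.conj_blockMatrix y)
    have hxy := map_re_realForm (hv.conj_blockMatrix ⁅x, y⁆)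
    have key : (realForm (blockMatrix b f ⁅x, y⁆.1)).map Complex.re =
        ⁅(realForm (blockMatrix b f x.1)).map Complex.re,
          (realForm (blockMatrix b f y.1)).map Complex.re⁆ := by
      -- Brackets are compared after complexification, where the real matrix is the conjugated block
      -- matrix itself.
      apply map_ofReal_injective
      simp only [Ring.lie_def]
      rw [hxy, Matrix.map_sub _ (by simp), Matrix.map_mul, Matrix.map_mul, hx, hy,
        ← realForm_mul, ← realForm_mul]
      change realForm (blockMatrix b f ⁅x.1, y.1⁆) = _
      rw [blockMatrix_lie hb (isSupported x) (isSupported y), Ring.lie_def]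
      simp [realForm, Matrix.mul_sub, Matrix.sub_mul]
    simp only [key]
    change _ = ⁅_, _⁆
    simp only [Ring.lie_def, Matrix.submatrix_mul_equiv, Matrix.submatrix_sub]
    rfl)

theorem soHom_eq_zero [NeZero n] (hv : IsVector b f) (hb : IsMinuscule (rootSet E) b f)
    {x : gaugeAlgebra E} (h : soHom hv hb x = 0) : blockMatrix b f x.1 = 0 := by
  apply realForm_eq_zero
  rw [← map_re_realForm (hv.conj_blockMatrix x)]
  have h1 : ((realForm (blockMatrix b f x.1)).map Complex.re).submatrix
      finSumFinEquiv.symm finSumFinEquiv.symm = 0 := congrArg Subtype.val h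
  have h2 : (realForm (blockMatrix b f x.1)).map Complex.re = 0 := by
    ext i j
    simpa using congrFun (congrFun h1 (finSumFinEquiv i)) (finSumFinEquiv j)
  rw [h2]
  ext i j; simp

end Orthogonal

end HiddenSector

/-! ### Root systems given by a basis, and the centre of the gauge algebra -/

namespace HiddenSector

attribute [local instance 100] LieRing.ofAssociativeRing

open E8Algebra

section Basis

variable {r : ℕ}

/-- The integer combinations of the vectors `β k`. -/
def rootComb (β : Fin r → Root) (v : Fin r → ℤ) : Fin 8 → ℤ := ∑ k, v k • (β k).1

theorem rootComb_sub (β : Fin r → Root) (u v : Fin r → ℤ) :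
    rootComb β (u - v) = rootComb β u - rootComb β v := by
  simp [rootComb, sub_smul]

theorem rootComb_add (β : Fin r → Root) (u v : Fin r → ℤ) :
    rootComb β (u + v) = rootComb β u + rootComb β v := by
  simp [rootComb, add_smul, Finset.sum_add_distrib]

/-- The root system `R` has a basis with Cartan matrix `C`, in which its elements are the vectors
with coefficients in the list `Φ`. -/
def HasBasis (R : Set Root) (C : Matrix (Fin r) (Fin r) ℤ) (Φ : List (Fin r → ℤ)) : Prop :=
  ∃ β : Fin r → Root, (∀ i j, pairing (β i).1 (β j).1 = C i j) ∧
    ∀ α : Root, α ∈ R ↔ ∃ v ∈ Φ, α.1 = rootComb β v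

theorem pairing_sum_left {κ : Type*} (s : Finset κ) (g : κ → Fin 8 → ℤ) (m : Fin 8 → ℤ) :
    pairing (∑ k ∈ s, g k) m = ∑ k ∈ s, pairing (g k) m := by
  rw [pairing, sum_dotProduct]; rfl

theorem pairing_smul_left (c : ℤ) (a m : Fin 8 → ℤ) : pairing (c • a) m = c * pairing a m := by
  rw [pairing, smul_dotProduct, smul_eq_mul, pairing]

variable {C : Matrix (Fin r) (Fin r) ℤ} {β : Fin r → Root}

theorem pairing_root_rootComb (hβ : ∀ i j, pairing (β i).1 (β j).1 = C i j) (k : Fin r)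
    (v : Fin r → ℤ) : pairing (β k).1 (rootComb β v) = (C *ᵥ v) k := by
  rw [pairing_comm, rootComb, pairing_sum_left, Matrix.mulVec, dotProduct]
  refine Finset.sum_congr rfl fun j _ => ?_
  rw [pairing_smul_left, pairing_comm, hβ, mul_comm]

theorem pairing_rootComb (hβ : ∀ i j, pairing (β i).1 (β j).1 = C i j) (u v : Fin r → ℤ) :
    pairing (rootComb β u) (rootComb β v) = u ⬝ᵥ C *ᵥ v := by
  rw [rootComb, pairing_sum_left, dotProduct]
  refine Finset.sum_congr rfl fun j _ => ?_
  rw [pairing_smul_left, pairing_root_rootComb hβ]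

/-- Pairing with the basis turns coefficients `v` into `C v`. Hence equations between lattice
vectors reduce to equations between coefficients, which no longer involve the embedding. -/
theorem rootComb_injective (hβ : ∀ i j, pairing (β i).1 (β j).1 = C i j) (hC : C.det ≠ 0) :
    Function.Injective (rootComb β) := by
  intro u v h
  rw [← sub_eq_zero, ← rootComb_sub] at h
  rw [← sub_eq_zero]
  refine Matrix.eq_zero_of_mulVec_eq_zero hC (funext fun k => ?_)
  rw [← pairing_root_rootComb hβ, h]
  simp [pairing]

/-- The vectors with coefficients `B i` in a basis with Cartan matrix `C` are the weights of a
representation on which all elements of `Φ` take values in `{-1, 0, 1}`. -/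
def IsMinusculeCoeff {ι : Type*} [Fintype ι] (C : Matrix (Fin r) (Fin r) ℤ)
    (Φ : List (Fin r → ℤ)) (B : ι → Fin r → ℤ) : Prop :=
  (∀ i j, B i = B j → i = j) ∧ ∀ v ∈ Φ, ∀ i,
    ((∃ k, B i - B k = v) ∧ (∀ k, B k - B i ≠ v) ∧
      Fintype.card ι * (B i ⬝ᵥ C *ᵥ v) - ∑ j, B j ⬝ᵥ C *ᵥ v = Fintype.card ι) ∨
    ((∀ k, B i - B k ≠ v) ∧ (∃ k, B k - B i = v) ∧
      Fintype.card ι * (B i ⬝ᵥ C *ᵥ v) - ∑ j, B j ⬝ᵥ C *ᵥ v = -Fintype.card ι) ∨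
    ((∀ k, B i - B k ≠ v) ∧ (∀ k, B k - B i ≠ v) ∧
      Fintype.card ι * (B i ⬝ᵥ C *ᵥ v) - ∑ j, B j ⬝ᵥ C *ᵥ v = 0)

instance {ι : Type*} [Fintype ι] [DecidableEq ι] (C : Matrix (Fin r) (Fin r) ℤ)
    (Φ : List (Fin r → ℤ)) (B : ι → Fin r → ℤ) : Decidable (IsMinusculeCoeff C Φ B) := by
  unfold IsMinusculeCoeff; infer_instance

variable {Φ : List (Fin r → ℤ)} {R : Set Root}

section

variable {ι : Type*} [Fintype ι] {B : ι → Fin r → ℤ}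

theorem injective_of_isMinusculeCoeff (hβ : ∀ i j, pairing (β i).1 (β j).1 = C i j)
    (hC : C.det ≠ 0) (hB : IsMinusculeCoeff C Φ B) :
    Function.Injective fun i => rootComb β (B i) :=
  fun i j h => hB.1 i j (rootComb_injective hβ hC h)

theorem trichotomy_of_isMinusculeCoeff (hβ : ∀ i j, pairing (β i).1 (β j).1 = C i j)
    (hC : C.det ≠ 0) (hB : IsMinusculeCoeff C Φ B)
    (hR : ∀ α : Root, α ∈ R ↔ ∃ v ∈ Φ, α.1 = rootComb β v) (α : Root) (hα : α ∈ R) (i : ι) :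
    ((∃ k, rootComb β (B i) - rootComb β (B k) = α.1) ∧
      (∀ k, rootComb β (B k) - rootComb β (B i) ≠ α.1) ∧
      centeredPairing (fun i => rootComb β (B i)) i α.1 = Fintype.card ι) ∨
    ((∀ k, rootComb β (B i) - rootComb β (B k) ≠ α.1) ∧
      (∃ k, rootComb β (B k) - rootComb β (B i) = α.1) ∧
      centeredPairing (fun i => rootComb β (B i)) i α.1 = -Fintype.card ι) ∨
    ((∀ k, rootComb β (B i) - rootComb β (B k) ≠ α.1) ∧
      (∀ k, rootComb β (B k) - rootComb β (B i) ≠ α.1) ∧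
      centeredPairing (fun i => rootComb β (B i)) i α.1 = 0) := by
  obtain ⟨v, hv, hαv⟩ := (hR α).1 hα
  simp only [hαv, centeredPairing, pairing_rootComb hβ, ← rootComb_sub, ne_eq,
    (rootComb_injective hβ hC).eq_iff]
  exact hB.2 v hv i

end

/-- For type `A` all differences of distinct weights have norm two, so the situation of `cancel`
does not occur and the signs `f` may be taken trivial. -/
theorem isMinuscule_of_coeff {n : ℕ} {B : Fin n → Fin r → ℤ}
    (hβ : ∀ i j, pairing (β i).1 (β j).1 = C i j) (hC : C.det ≠ 0)
    (hB : IsMinusculeCoeff C Φ B) (hR : ∀ α : Root, α ∈ R ↔ ∃ v ∈ Φ, α.1 = rootComb β v)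
    (hn : ∀ i j, i ≠ j → (B i - B j) ⬝ᵥ C *ᵥ (B i - B j) = 2) :
    IsMinuscule R (fun i => rootComb β (B i)) 0 where
  injective := injective_of_isMinusculeCoeff hβ hC hB
  trichotomy := trichotomy_of_isMinusculeCoeff hβ hC hB hR
  cancel α _ γ _ hp i l hil h := by
    have h1 := pairing_self_add α γ
    rw [← h, ← rootComb_sub, pairing_rootComb hβ, hn i l hil] at h1
    omega

/-- The vectors with coefficients `B i` in a basis with Cartan matrix `C` are, up to translation,
the weights of a vector representation. -/
def IsVectorCoeff {n : ℕ} (C : Matrix (Fin r) (Fin r) ℤ) (B : Fin n ⊕ Fin n → Fin r → ℤ)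
    (c : Fin r → ℤ) : Prop :=
  c ⬝ᵥ C *ᵥ c = 4 ∧ (∀ i, B i + B i.swap = c) ∧
  (∀ i j, i ≠ j → j ≠ i.swap → (B i - B j) ⬝ᵥ C *ᵥ (B i - B j) = 2) ∧
  ∀ i, (B i - B i.swap) ⬝ᵥ C *ᵥ (B i - B i.swap) = 4

instance {n : ℕ} (C : Matrix (Fin r) (Fin r) ℤ) (B : Fin n ⊕ Fin n → Fin r → ℤ)
    (c : Fin r → ℤ) : Decidable (IsVectorCoeff C B c) := by
  unfold IsVectorCoeff; infer_instance

theorem isVector_of_coeff {n : ℕ} {B : Fin n ⊕ Fin n → Fin r → ℤ} {c : Fin r → ℤ}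
    (hβ : ∀ i j, pairing (β i).1 (β j).1 = C i j) (hB : IsVectorCoeff C B c) :
    IsVector (fun i => rootComb β (B i))
      (Sum.elim (fun k => asymForm (rootComb β (B (.inl k))) (rootComb β c)) 0) where
  sum_eq := ⟨rootComb β c, by rw [pairing_rootComb hβ, hB.1],
    fun i => by rw [← rootComb_add, hB.2.1], fun _ => rfl⟩
  sign _ := rfl
  norm i j hij hij' := by rw [← rootComb_sub, pairing_rootComb hβ, hB.2.2.1 i j hij hij']
  norm_swap i := by rw [← rootComb_sub, pairing_rootComb hβ, hB.2.2.2 i]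

/-- The norm condition ensures that every listed combination really is a root; this count enters the
comparison of dimensions. -/
theorem ncard_of_basis (hβ : ∀ i j, pairing (β i).1 (β j).1 = C i j) (hC : C.det ≠ 0)
    (hR : ∀ α : Root, α ∈ R ↔ ∃ v ∈ Φ, α.1 = rootComb β v)
    (hΦ : ∀ v ∈ Φ, v ⬝ᵥ C *ᵥ v = 2) : R.ncard = Φ.toFinset.card := by
  classical
  have h : Subtype.val '' R = rootComb β '' (Φ.toFinset : Set (Fin r → ℤ)) := by
    ext m
    constructor
    · rintro ⟨α, hα, rfl⟩
      obtain ⟨v, hv, h⟩ := (hR α).1 hα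
      exact ⟨v, by simpa using hv, h.symm⟩
    · rintro ⟨v, hv, rfl⟩
      have hv : v ∈ Φ := by simpa using hv
      exact ⟨⟨rootComb β v, by rw [pairing_rootComb hβ, hΦ v hv]⟩, (hR _).2 ⟨v, hv, rfl⟩, rfl⟩
  rw [← Set.ncard_image_of_injective R Subtype.val_injective, h,
    Set.ncard_image_of_injective _ (rootComb_injective hβ hC), Set.ncard_coe_finset]

variable {E : Embedding}

theorem linearIndependent_of_basis (hβ : ∀ i j, pairing (β i).1 (β j).1 = C i j)
    (hC : C.det ≠ 0) : LinearIndependent ℝ fun k => latticeVec (β k).1 := by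
  rw [Fintype.linearIndependent_iff]
  intro g hg
  have hdet : (C.map (Int.castRingHom ℝ)).det ≠ 0 := by
    rw [← RingHom.mapMatrix_apply, ← RingHom.map_det]
    simpa using hC
  refine congrFun (Matrix.eq_zero_of_mulVec_eq_zero hdet (funext fun k => ?_))
  have h := congrArg (fun v => latticeVec (β k).1 ⬝ᵥ v) hg
  simp only [dotProduct_sum, dotProduct_smul, latticeVec_dot, dotProduct_zero, hβ] at h
  simpa [Matrix.mulVec, dotProduct, mul_comm] using h

theorem latticeVec_rootComb (v : Fin r → ℤ) :
    latticeVec (rootComb β v) = ∑ k, (v k : ℝ) • latticeVec (β k).1 := by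
  funext I
  simp only [latticeVec_apply, rootComb, Finset.sum_apply, Pi.smul_apply, smul_eq_mul]
  fin_cases I <;> simp [Finset.sum_div, mul_add, mul_sub, Finset.sum_add_distrib, mul_div_assoc]

/-- The projection of the gauge algebra to its centre. -/
theorem exists_centralHom {k : ℕ} (hk : r + k = 8)
    (hβ : ∀ i j, pairing (β i).1 (β j).1 = C i j) (hC : C.det ≠ 0)
    (hR : ∀ α : Root, α ∈ rootSet E → ∃ v, α.1 = rootComb β v) :
    ∃ ψ : gaugeAlgebra E →ₗ⁅ℝ⁆ u1 k, ∀ x, ψ x = 0 →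
      (∀ j, rootValue (β j).1 x.1.cartan = 0) → x.1.cartan = 0 := by
  -- The quotient by the span of the roots is an abelian quotient of the gauge algebra, of dimension
  -- `8 - r`; the centre maps isomorphically onto it.
  let S : Submodule ℝ (Fin 8 → ℝ) := Submodule.span ℝ (Set.range fun k => latticeVec (β k).1)
  have hS : Module.finrank ℝ S = r := by
    rw [finrank_span_eq_card (linearIndependent_of_basis hβ hC), Fintype.card_fin]
  have hQ : Module.finrank ℝ ((Fin 8 → ℝ) ⧸ S) = Module.finrank ℝ (Fin k → ℝ) := by
    have := S.finrank_quotient_add_finrank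
    rw [hS, Module.finrank_pi, Fintype.card_fin] at this
    rw [Module.finrank_pi, Fintype.card_fin]
    omega
  let g : (Fin 8 → ℝ) →ₗ[ℝ] (Fin k → ℝ) := (LinearEquiv.ofFinrankEq _ _ hQ).toLinearMap ∘ₗ S.mkQ
  have hg : ∀ u, g u = 0 ↔ u ∈ S := fun u => by
    simp [g]
  let h : gaugeAlgebra E →ₗ[ℝ] (Fin 8 → ℝ) :=
    { toFun := fun x I => (x.1.cartan I).im
      map_add' := fun x y => by ext I; simp
      map_smul' := fun c x => by ext I; simp }
  have hmem : ∀ x y : gaugeAlgebra E, h ⁅x, y⁆ ∈ S := by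
    intro x y
    -- Only roots in the support contribute, so the Cartan part of a bracket lies in their span.
    have : h ⁅x, y⁆ = -∑ α : Root, (x.1.root α * y.1.root (-α)).im • latticeVec α.1 := by
      ext I
      change (⁅x.1, y.1⁆.cartan I).im = _
      rw [bracket_fst, Complex.neg_im, Complex.im_sum]
      simp [mul_comm]
    rw [this]
    refine S.neg_mem (S.sum_mem fun α _ => ?_)
    by_cases hα : α ∈ rootSet E
    · obtain ⟨v, hv⟩ := hR α hα
      refine S.smul_mem _ ?_
      rw [hv, latticeVec_rootComb]
      exact S.sum_mem fun j _ => S.smul_mem _ (Submodule.subset_span ⟨j, rfl⟩)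
    · rw [isSupported x α hα]; simp
  refine ⟨{ g ∘ₗ h with map_lie' := fun {x y} => ?_ }, fun x hx hx' => ?_⟩
  · change g (h ⁅x, y⁆) = ⁅g (h x), g (h y)⁆
    rw [(hg _).2 (hmem x y)]
    ext i
    simp [Ring.lie_def, mul_comm]
  · have hxS : h x ∈ S := (hg _).1 hx
    -- Vanishing of the roots makes the Cartan part orthogonal to `S`. As it also lies in `S`, it is
    -- zero by positivity of the scalar product.
    have hzero : ∀ u ∈ S, h x ⬝ᵥ u = 0 := by
      intro u hu
      induction hu using Submodule.span_induction with
      | mem u hu =>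
        obtain ⟨j, rfl⟩ := hu
        have := congrArg Complex.im (hx' j)
        rw [rootValue_apply, Complex.im_sum] at this
        simpa [dotProduct, h] using this
      | zero => simp
      | add u v _ _ hu hv => rw [dotProduct_add, hu, hv, add_zero]
      | smul c u _ hu => rw [dotProduct_smul, hu, smul_zero]
    have h0 : h x = 0 := dotProduct_self_eq_zero.1 (hzero _ hxS)
    funext I
    rw [cartan_eq x I, show (x.1.cartan I).im = 0 from congrFun h0 I]
    simp

/-- The common end of the injectivity proofs: the blocks supply `h`, the central projection supplies
`hc`, and the simple roots link the two. -/
theorem eq_zero_of_rootAt (hR : ∀ α : Root, α ∈ rootSet E ↔ ∃ v ∈ Φ, α.1 = rootComb β v)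
    (hΦ : ∀ k, Pi.single k 1 ∈ Φ) {x : gaugeAlgebra E}
    (h : ∀ v ∈ Φ, rootAt (rootComb β v) x.1 = 0 ∧ rootValue (rootComb β v) x.1.cartan = 0)
    (hc : (∀ j, rootValue (β j).1 x.1.cartan = 0) → x.1.cartan = 0) : x = 0 := by
  refine Subtype.ext (E8Algebra.ext (hc fun j => ?_) (funext fun α => ?_))
  · have : rootComb β (Pi.single j 1) = (β j).1 := by
      simp [rootComb, Pi.single_apply, ite_smul]
    rw [← this]
    exact (h _ (hΦ j)).2
  · by_cases hα : α ∈ rootSet E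
    · obtain ⟨v, hv, hαv⟩ := (hR α).1 hα
      rw [← rootAt_root, hαv, (h v hv).1]; rfl
    · exact isSupported x α hα

/-- Surjectivity comes from equality of dimensions, so no preimages have to be constructed. -/
theorem nonempty_lieEquiv {G : Type*} [LieRing G] [LieAlgebra ℝ G] [Module.Finite ℝ G]
    (χ : gaugeAlgebra E →ₗ⁅ℝ⁆ G) (hχ : ∀ x, χ x = 0 → x = 0)
    (hG : Module.finrank ℝ G = 8 + (rootSet E).ncard) : Nonempty (gaugeAlgebra E ≃ₗ⁅ℝ⁆ G) := by
  have hinj : Function.Injective (χ : gaugeAlgebra E →ₗ[ℝ] G) :=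
    LinearMap.ker_eq_bot.1 (LinearMap.ker_eq_bot'.2 hχ)
  have hsurj := (LinearMap.injective_iff_surjective_of_finrank_eq_finrank
    (by rw [finrank_gaugeAlgebra, hG])).1 hinj
  exact ⟨LieEquiv.ofBijective χ ⟨hinj, hsurj⟩⟩

end Basis

end HiddenSector

/-! ### The five gauge groups -/

namespace HiddenSector

attribute [local instance 100] LieRing.ofAssociativeRing

open E8Algebra

/-- The weights `0, -β₀, -β₀-β₁, …` of the standard representation of the subsystem of type `Aₘ`
with simple roots `β₀, …, βₘ₋₁`, which start at the position `o` of the basis. -/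
def chainWeights (r o m : ℕ) : Fin (m + 1) → Fin r → ℤ :=
  fun i k => if o ≤ k.val ∧ k.val < o + i.val then -1 else 0

/-- The semisimple ranks of the five gauge groups. -/
def GaugeCase.rank : GaugeCase → ℕ
  | .case1 => 5
  | .case2 => 5
  | .case3 => 5
  | .case4 => 4
  | .case5 => 2

/-- The Cartan matrices of the root systems of the five gauge groups. -/
def GaugeCase.cartanMatrix : (k : GaugeCase) → Matrix (Fin k.rank) (Fin k.rank) ℤ
  | .case1 => !![2,-1,0,0,0; -1,2,-1,0,0; 0,-1,2,-1,-1; 0,0,-1,2,0; 0,0,-1,0,2]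
  | .case2 => !![2,-1,0,0,0; -1,2,-1,0,0; 0,-1,2,-1,0; 0,0,-1,2,0; 0,0,0,0,2]
  | .case3 => !![2,-1,0,0,0; -1,2,-1,0,0; 0,-1,2,0,0; 0,0,0,2,0; 0,0,0,0,2]
  | .case4 => !![2,-1,0,0; -1,2,0,0; 0,0,2,0; 0,0,0,2]
  | .case5 => !![2,0; 0,2]

/-- The coefficients of the positive roots in the basis of simple roots. -/
def GaugeCase.positiveRoots : (k : GaugeCase) → List (Fin k.rank → ℤ)
  | .case1 => [![1,0,0,0,0], ![0,1,0,0,0], ![0,0,1,0,0], ![0,0,0,1,0], ![0,0,0,0,1],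
      ![1,1,0,0,0], ![0,1,1,0,0], ![0,0,1,1,0], ![0,0,1,0,1], ![1,1,1,0,0], ![0,1,1,1,0],
      ![0,1,1,0,1], ![0,0,1,1,1], ![1,1,1,1,0], ![1,1,1,0,1], ![0,1,1,1,1], ![1,1,1,1,1],
      ![0,1,2,1,1], ![1,1,2,1,1], ![1,2,2,1,1]]
  | .case2 => [![1,0,0,0,0], ![0,1,0,0,0], ![0,0,1,0,0], ![0,0,0,1,0], ![1,1,0,0,0],
      ![0,1,1,0,0], ![0,0,1,1,0], ![1,1,1,0,0], ![0,1,1,1,0], ![1,1,1,1,0], ![0,0,0,0,1]]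
  | .case3 => [![1,0,0,0,0], ![0,1,0,0,0], ![0,0,1,0,0], ![1,1,0,0,0], ![0,1,1,0,0],
      ![1,1,1,0,0], ![0,0,0,1,0], ![0,0,0,0,1]]
  | .case4 => [![1,0,0,0], ![0,1,0,0], ![1,1,0,0], ![0,0,1,0], ![0,0,0,1]]
  | .case5 => [![1,0], ![0,1]]

/-- The coefficients of the roots in the basis of simple roots. -/
def GaugeCase.roots (k : GaugeCase) : List (Fin k.rank → ℤ) :=
  k.positiveRoots ++ k.positiveRoots.map (-·)

theorem GaugeCase.det_ne_zero (k : GaugeCase) : k.cartanMatrix.det ≠ 0 := by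
  cases k <;> decide +kernel

theorem GaugeCase.norm_roots (k : GaugeCase) :
    ∀ v ∈ k.roots, v ⬝ᵥ k.cartanMatrix *ᵥ v = 2 := by
  cases k <;> decide +kernel

theorem GaugeCase.single_mem_roots (k : GaugeCase) (i : Fin k.rank) :
    Pi.single i 1 ∈ k.roots := by
  cases k <;> revert i <;> decide +kernel

/-- The numbers of roots of the five gauge groups. -/
def GaugeCase.numRoots : GaugeCase → ℕ
  | .case1 => 40
  | .case2 => 22
  | .case3 => 16
  | .case4 => 10
  | .case5 => 4

theorem GaugeCase.card_roots (k : GaugeCase) : k.roots.toFinset.card = k.numRoots := by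
  cases k <;> decide +kernel

/-- The weights of the vector representation of `D₅`, translated so that the first one is zero. -/
def vectorWeights : Fin 5 ⊕ Fin 5 → Fin GaugeCase.case1.rank → ℤ :=
  Sum.elim (chainWeights 5 0 4) ![![-2,-2,-2,-1,-1], ![-1,-2,-2,-1,-1], ![-1,-1,-2,-1,-1],
    ![-1,-1,-1,-1,-1], ![-1,-1,-1,0,-1]]

theorem isMinusculeCoeff_vector :
    IsMinusculeCoeff GaugeCase.case1.cartanMatrix GaugeCase.case1.roots vectorWeights := by
  decide +kernel

/-- The first weight is zero, so the common sum of opposite weights is the weight opposite to it. -/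
theorem isVectorCoeff_vector :
    IsVectorCoeff GaugeCase.case1.cartanMatrix vectorWeights
      (vectorWeights (.inr 0)) := by
  decide +kernel

/-- The positions and the ranks of the components of type `A`. -/
def GaugeCase.chains : GaugeCase → List (ℕ × ℕ)
  | .case1 => []
  | .case2 => [(0, 4), (4, 1)]
  | .case3 => [(0, 3), (3, 1), (4, 1)]
  | .case4 => [(0, 2), (2, 1), (3, 1)]
  | .case5 => [(0, 1), (1, 1)]

theorem GaugeCase.chain_isMinusculeCoeff (k : GaugeCase) : ∀ p ∈ k.chains,
    IsMinusculeCoeff k.cartanMatrix k.roots (chainWeights k.rank p.1 p.2) ∧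
    ∀ i j, i ≠ j → (chainWeights k.rank p.1 p.2 i - chainWeights k.rank p.1 p.2 j) ⬝ᵥ
      k.cartanMatrix *ᵥ (chainWeights k.rank p.1 p.2 i - chainWeights k.rank p.1 p.2 j) = 2 := by
  cases k <;> decide +kernel

/-- Since each root is seen by some block, the blocks together are injective up to the centre. -/
theorem GaugeCase.exists_chain (k : GaugeCase) (hk : k ≠ .case1) : ∀ v ∈ k.roots,
    ∃ p ∈ k.chains, ∃ i j, i ≠ j ∧
      chainWeights k.rank p.1 p.2 i - chainWeights k.rank p.1 p.2 j = v := by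
  cases k <;> revert hk <;> decide +kernel

theorem exists_vector : ∀ v ∈ GaugeCase.case1.roots,
    ∃ i j, i ≠ j ∧ vectorWeights i - vectorWeights j = v := by
  decide +kernel

variable {E : Embedding}

section

variable {k : GaugeCase} {β : Fin k.rank → Root}

/-- The weights of the component of type `A` which starts at `o` and has rank `m`. -/
def chainVec (β : Fin k.rank → Root) (o m : ℕ) (i : Fin (m + 1)) : Fin 8 → ℤ :=
  rootComb β (chainWeights k.rank o m i)

theorem isMinuscule_chainVec
    (hβ : ∀ i j, pairing (β i).1 (β j).1 = k.cartanMatrix i j)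
    (hR : ∀ α : Root, α ∈ rootSet E ↔ ∃ v ∈ k.roots, α.1 = rootComb β v) {o m : ℕ}
    (h : (o, m) ∈ k.chains) : IsMinuscule (rootSet E) (chainVec β o m) 0 :=
  isMinuscule_of_coeff hβ k.det_ne_zero (k.chain_isMinusculeCoeff _ h).1 hR
    (k.chain_isMinusculeCoeff _ h).2

theorem eq_zero_of_chains (hk : k ≠ .case1)
    (hR : ∀ α : Root, α ∈ rootSet E ↔ ∃ v ∈ k.roots, α.1 = rootComb β v) {x : gaugeAlgebra E}
    (h : ∀ p ∈ k.chains, blockMatrix (chainVec β p.1 p.2) 0 x.1 = 0)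
    (hc : (∀ j, rootValue (β j).1 x.1.cartan = 0) → x.1.cartan = 0) : x = 0 := by
  refine eq_zero_of_rootAt hR k.single_mem_roots (fun v hv => ?_) hc
  obtain ⟨p, hp, i, j, hij, rfl⟩ := k.exists_chain hk v hv
  rw [rootComb_sub]
  exact of_blockMatrix_eq_zero (h p hp) hij

theorem finrank_eq_numRoots
    (hβ : ∀ i j, pairing (β i).1 (β j).1 = k.cartanMatrix i j)
    (hR : ∀ α : Root, α ∈ rootSet E ↔ ∃ v ∈ k.roots, α.1 = rootComb β v) :
    (rootSet E).ncard = k.numRoots := by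
  rw [ncard_of_basis hβ k.det_ne_zero hR k.norm_roots, k.card_roots]

end

theorem finrank_su_of {n d : ℕ} [NeZero n] (h : d + 1 = n ^ 2) : Module.finrank ℝ (su n) = d := by
  have := finrank_su n
  omega

theorem finrank_case1 : Module.finrank ℝ (so 10 × u1 3) = 48 := by
  rw [Module.finrank_prod, finrank_so_ten, Module.finrank_pi]; rfl

theorem finrank_case2 : Module.finrank ℝ (su 5 × su 2 × u1 3) = 30 := by
  rw [Module.finrank_prod, Module.finrank_prod, finrank_su_of (n := 5) (d := 24) rfl,
    finrank_su_of (n := 2) (d := 3) rfl, Module.finrank_pi]; rfl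

theorem finrank_case3 : Module.finrank ℝ (su 4 × su 2 × su 2 × u1 3) = 24 := by
  rw [Module.finrank_prod, Module.finrank_prod, Module.finrank_prod,
    finrank_su_of (n := 4) (d := 15) rfl, finrank_su_of (n := 2) (d := 3) rfl,
    Module.finrank_pi]; rfl

theorem finrank_case4 : Module.finrank ℝ (su 3 × su 2 × su 2 × u1 4) = 18 := by
  rw [Module.finrank_prod, Module.finrank_prod, Module.finrank_prod,
    finrank_su_of (n := 3) (d := 8) rfl, finrank_su_of (n := 2) (d := 3) rfl,
    Module.finrank_pi]; rfl

theorem finrank_case5 : Module.finrank ℝ (su 2 × su 2 × u1 6) = 12 := by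
  rw [Module.finrank_prod, Module.finrank_prod,
    finrank_su_of (n := 2) (d := 3) rfl, Module.finrank_pi]; rfl

theorem finrank_of_hasGaugeGroup {k : GaugeCase} (h : HasGaugeGroup E k) :
    Module.finrank ℝ (gaugeAlgebra E) = 8 + k.numRoots := by
  cases k <;> obtain ⟨e⟩ := h
  · rw [e.toLinearEquiv.finrank_eq, finrank_case1]; rfl
  · rw [e.toLinearEquiv.finrank_eq, finrank_case2]; rfl
  · rw [e.toLinearEquiv.finrank_eq, finrank_case3]; rfl
  · rw [e.toLinearEquiv.finrank_eq, finrank_case4]; rfl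
  · rw [e.toLinearEquiv.finrank_eq, finrank_case5]; rfl

/-- The dimensions 48, 30, 24, 18 and 12 are distinct. -/
theorem hasGaugeGroup_unique {k l : GaugeCase} (hk : HasGaugeGroup E k)
    (hl : HasGaugeGroup E l) : k = l := by
  have h := (finrank_of_hasGaugeGroup hk).symm.trans (finrank_of_hasGaugeGroup hl)
  cases k <;> cases l <;> first | rfl | (simp [GaugeCase.numRoots] at h)

/-- The blocks and the central projection combine to an injective homomorphism, and both sides have
dimension eight plus the number of roots. Case 1 uses the ten weights of the vector representation,
the other cases one standard representation for each factor. -/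
theorem hasGaugeGroup_of_basis {k : GaugeCase}
    (h : HasBasis (rootSet E) k.cartanMatrix k.roots) : HasGaugeGroup E k := by
  obtain ⟨β, hβ, hR⟩ := h
  have hcard := finrank_eq_numRoots hβ hR
  have hR' : ∀ α : Root, α ∈ rootSet E → ∃ v, α.1 = rootComb β v := fun α hα =>
    let ⟨v, _, hv⟩ := (hR α).1 hα; ⟨v, hv⟩
  cases k
  · obtain ⟨ψ, hψ⟩ := exists_centralHom (k := 3) rfl hβ (GaugeCase.det_ne_zero _) hR'
    have hv := isVector_of_coeff hβ isVectorCoeff_vector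
    have hm := hv.isMinuscule (R := rootSet E)
      (injective_of_isMinusculeCoeff hβ (GaugeCase.det_ne_zero _) isMinusculeCoeff_vector)
      (trichotomy_of_isMinusculeCoeff hβ (GaugeCase.det_ne_zero _) isMinusculeCoeff_vector hR)
    refine nonempty_lieEquiv ((soHom hv hm).prod ψ) (fun x hx => ?_)
      (finrank_case1.trans (by rw [hcard]; rfl))
    have h1 := soHom_eq_zero hv hm (x := x) (congrArg Prod.fst hx)
    refine eq_zero_of_rootAt hR (GaugeCase.single_mem_roots _) (fun v hv => ?_)
      (hψ x (congrArg Prod.snd hx))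
    obtain ⟨i, j, hij, rfl⟩ := exists_vector v hv
    rw [rootComb_sub]
    exact of_blockMatrix_eq_zero h1 hij
  · obtain ⟨ψ, hψ⟩ := exists_centralHom (k := 3) rfl hβ (GaugeCase.det_ne_zero _) hR'
    have h1 := isMinuscule_chainVec hβ hR (o := 0) (m := 4) (by decide)
    have h2 := isMinuscule_chainVec hβ hR (o := 4) (m := 1) (by decide)
    refine nonempty_lieEquiv ((suHom h1).prod ((suHom h2).prod ψ)) (fun x hx => ?_)
      (finrank_case2.trans (by rw [hcard]; rfl))
    have e1 := suHom_eq_zero h1 (x := x) (congrArg Prod.fst hx)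
    have e2 := suHom_eq_zero h2 (x := x) (congrArg (fun y => y.2.1) hx)
    refine eq_zero_of_chains (by decide) hR ?_ (hψ x (congrArg (fun y => y.2.2) hx))
    simp only [GaugeCase.chains, List.forall_mem_cons]
    exact ⟨e1, e2, by simp⟩
  · obtain ⟨ψ, hψ⟩ := exists_centralHom (k := 3) rfl hβ (GaugeCase.det_ne_zero _) hR'
    have h1 := isMinuscule_chainVec hβ hR (o := 0) (m := 3) (by decide)
    have h2 := isMinuscule_chainVec hβ hR (o := 3) (m := 1) (by decide)
    have h3 := isMinuscule_chainVec hβ hR (o := 4) (m := 1) (by decide)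
    refine nonempty_lieEquiv ((suHom h1).prod ((suHom h2).prod ((suHom h3).prod ψ)))
      (fun x hx => ?_) (finrank_case3.trans (by rw [hcard]; rfl))
    have e1 := suHom_eq_zero h1 (x := x) (congrArg Prod.fst hx)
    have e2 := suHom_eq_zero h2 (x := x) (congrArg (fun y => y.2.1) hx)
    have e3 := suHom_eq_zero h3 (x := x) (congrArg (fun y => y.2.2.1) hx)
    refine eq_zero_of_chains (by decide) hR ?_ (hψ x (congrArg (fun y => y.2.2.2) hx))
    simp only [GaugeCase.chains, List.forall_mem_cons]
    exact ⟨e1, e2, e3, by simp⟩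
  · obtain ⟨ψ, hψ⟩ := exists_centralHom (k := 4) rfl hβ (GaugeCase.det_ne_zero _) hR'
    have h1 := isMinuscule_chainVec hβ hR (o := 0) (m := 2) (by decide)
    have h2 := isMinuscule_chainVec hβ hR (o := 2) (m := 1) (by decide)
    have h3 := isMinuscule_chainVec hβ hR (o := 3) (m := 1) (by decide)
    refine nonempty_lieEquiv ((suHom h1).prod ((suHom h2).prod ((suHom h3).prod ψ)))
      (fun x hx => ?_) (finrank_case4.trans (by rw [hcard]; rfl))
    have e1 := suHom_eq_zero h1 (x := x) (congrArg Prod.fst hx)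
    have e2 := suHom_eq_zero h2 (x := x) (congrArg (fun y => y.2.1) hx)
    have e3 := suHom_eq_zero h3 (x := x) (congrArg (fun y => y.2.2.1) hx)
    refine eq_zero_of_chains (by decide) hR ?_ (hψ x (congrArg (fun y => y.2.2.2) hx))
    simp only [GaugeCase.chains, List.forall_mem_cons]
    exact ⟨e1, e2, e3, by simp⟩
  · obtain ⟨ψ, hψ⟩ := exists_centralHom (k := 6) rfl hβ (GaugeCase.det_ne_zero _) hR'
    have h1 := isMinuscule_chainVec hβ hR (o := 0) (m := 1) (by decide)
    have h2 := isMinuscule_chainVec hβ hR (o := 1) (m := 1) (by decide)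
    refine nonempty_lieEquiv ((suHom h1).prod ((suHom h2).prod ψ)) (fun x hx => ?_)
      (finrank_case5.trans (by rw [hcard]; rfl))
    have e1 := suHom_eq_zero h1 (x := x) (congrArg Prod.fst hx)
    have e2 := suHom_eq_zero h2 (x := x) (congrArg (fun y => y.2.1) hx)
    refine eq_zero_of_chains (by decide) hR ?_ (hψ x (congrArg (fun y => y.2.2) hx))
    simp only [GaugeCase.chains, List.forall_mem_cons]
    exact ⟨e1, e2, by simp⟩

end HiddenSector

/-! ### The root lattice modulo three -/

namespace HiddenSector

open E8Algebra

section ResidueClasses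

/-- The class modulo three of a root lattice vector, in standard coordinates. -/
def residue (m : Fin 8 → ℤ) : Fin 8 → ZMod 3 := fun i => -(doubledVec m i : ZMod 3)

theorem doubledVec_add (a b : Fin 8 → ℤ) : doubledVec (a + b) = doubledVec a + doubledVec b := by
  ext i; fin_cases i <;> simp [doubledVec] <;> ring

theorem doubledVec_smul (c : ℤ) (a : Fin 8 → ℤ) : doubledVec (c • a) = c • doubledVec a := by
  ext i; fin_cases i <;> simp [doubledVec] <;> ring

theorem residue_add (a b : Fin 8 → ℤ) : residue (a + b) = residue a + residue b := by
  funext i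
  simp [residue, doubledVec_add]; ring

theorem residue_smul (c : ℤ) (a : Fin 8 → ℤ) : residue (c • a) = (c : ZMod 3) • residue a := by
  funext i
  simp only [residue, doubledVec_smul, Pi.smul_apply, smul_eq_mul]
  push_cast
  ring

theorem residue_sub (a b : Fin 8 → ℤ) : residue (a - b) = residue a - residue b := by
  rw [show a - b = a + (-1 : ℤ) • b by simp [sub_eq_add_neg], residue_add, residue_smul]
  simp [sub_eq_add_neg]

/-- Doubling the coordinates multiplies scalar products by four, which is one modulo three. So the
lattice modulo three carries the standard form, half-integral vectors included. -/
theorem residue_dot (a b : Fin 8 → ℤ) : residue a ⬝ᵥ residue b = (pairing a b : ZMod 3) := by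
  have h : 4 * pairing a b = ∑ i, doubledVec a i * doubledVec b i := by
    simp [doubledVec, pairing, Fin.sum_univ_eight, CartanMatrix.E₈, dotProduct, Matrix.mulVec]
    ring
  have h3 : (4 : ZMod 3) = 1 := rfl
  have := congrArg (Int.cast : ℤ → ZMod 3) h
  push_cast at this
  rw [h3, one_mul] at this
  rw [this]
  simp [residue, dotProduct]

/-- The coordinate matrix is invertible modulo three. The last six coordinates determine the simple
root coordinates one after another. -/
theorem exists_of_residue_eq {a b : Fin 8 → ℤ} (h : residue a = residue b) :
    ∃ k : Fin 8 → ℤ, a = b + (3 : ℤ) • k := by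
  have k1 : ∀ x y : ℤ, 3 ∣ x → 3 ∣ -x + 2 * y → 3 ∣ y := by omega
  have k2 : ∀ x y z : ℤ, 3 ∣ x → 3 ∣ z → 3 ∣ -x + 2 * y - 2 * z → 3 ∣ y := by omega
  have k3 : ∀ x y z w : ℤ, 3 ∣ x → 3 ∣ w → 3 ∣ x + 2 * y - 2 * z →
    3 ∣ -x + 2 * y + 2 * z - 2 * w → 3 ∣ y ∧ 3 ∣ z := by omega
  obtain ⟨c, rfl⟩ : ∃ c, a = b + c := ⟨a - b, by abel⟩
  have hd : ∀ i, (3 : ℤ) ∣ doubledVec c i := fun i => by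
    rw [residue_add, add_eq_left] at h
    have : residue c i = 0 := congrFun h i
    rw [residue, neg_eq_zero] at this
    exact (ZMod.intCast_zmod_eq_zero_iff_dvd _ 3).1 (by exact_mod_cast this)
  have c0 : 3 ∣ c 0 := hd 7
  have c7 : 3 ∣ c 7 := k1 _ _ c0 (hd 6)
  have c6 : 3 ∣ c 6 := k2 _ _ _ c0 c7 (hd 5)
  have c5 : 3 ∣ c 5 := k2 _ _ _ c0 c6 (hd 4)
  have c4 : 3 ∣ c 4 := k2 _ _ _ c0 c5 (hd 3)
  have c3 : 3 ∣ c 3 := k2 _ _ _ c0 c4 (hd 2)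
  -- The first two coordinates involve only the difference and the sum of `c 1` and `c 2` as
  -- unknowns, and are therefore treated together.
  obtain ⟨c1, c2⟩ := k3 _ _ _ _ c0 c3 (hd 0) (hd 1)
  have hc : ∀ i, 3 ∣ c i := by
    simp only [Fin.forall_fin_succ, Fin.succ_zero_eq_one]
    exact ⟨c0, c1, c2, c3, c4, c5, c6, c7, by simp⟩
  choose k hk using hc
  exact ⟨k, by rw [show c = (3 : ℤ) • k from funext hk]⟩

theorem pairing_le (α β : Root) : pairing α.1 β.1 ≤ 2 := by
  have := pairing_ge α (-β)
  rw [Root.neg_val, pairing_neg_right] at this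
  omega

theorem eq_of_pairing (α β : Root) (h : pairing α.1 β.1 = 2) : α = β := by
  have := eq_neg_of_pairing α (-β) (by rw [Root.neg_val, pairing_neg_right, h])
  rw [← neg_neg α, ← this, neg_neg]

/-- Congruent roots have a difference whose norm is at most eight and divisible by nine. This allows
calculations with roots to be carried out modulo three. -/
theorem residue_injective_root : Function.Injective fun α : Root => residue α.1 := by
  intro α β h
  obtain ⟨k, hk⟩ := exists_of_residue_eq h
  have h1 : pairing (α.1 - β.1) (α.1 - β.1) = 9 * pairing k k := by
    rw [show α.1 - β.1 = (3 : ℤ) • k by rw [hk]; abel, pairing_smul_left, pairing_comm,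
      pairing_smul_left]
    ring
  rw [pairing_sub_left, pairing_sub_right, pairing_sub_right, α.2, β.2, pairing_comm β.1] at h1
  have h2 := pairing_ge α β
  have h3 := pairing_le α β
  exact eq_of_pairing α β (by omega)

/-- The reflection in the hyperplane orthogonal to the root `α`. -/
def Root.reflect (α : Root) (m : Fin 8 → ℤ) : Fin 8 → ℤ := m - pairing m α.1 • α.1

theorem pairing_reflect (α : Root) (a b : Fin 8 → ℤ) :
    pairing (α.reflect a) (α.reflect b) = pairing a b := by
  have hs : ∀ c m n, pairing m (c • n) = c * pairing m n := fun c m n => by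
    rw [pairing_comm, pairing_smul_left, pairing_comm]
  simp only [Root.reflect, pairing_sub_left, pairing_sub_right, pairing_smul_left, hs, α.2,
    pairing_comm α.1]
  ring

theorem Root.reflect_reflect (α : Root) (a : Fin 8 → ℤ) : α.reflect (α.reflect a) = a := by
  have h : pairing (α.reflect a) α.1 = -pairing a α.1 := by
    rw [Root.reflect, pairing_sub_left, pairing_smul_left, α.2]; ring
  rw [Root.reflect, h, Root.reflect]; simp

/-- The reflection of a root. -/
def Root.reflectRoot (α γ : Root) : Root := ⟨α.reflect γ.1, by rw [pairing_reflect, γ.2]⟩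

theorem reflect_rootComb {r : ℕ} (α : Root) (β : Fin r → Root) (v : Fin r → ℤ) :
    α.reflect (rootComb β v) = rootComb (fun i => α.reflectRoot (β i)) v := by
  simp only [Root.reflect, rootComb, Root.reflectRoot, pairing_sum_left, pairing_smul_left,
    smul_sub, Finset.sum_sub_distrib, Finset.sum_smul, mul_smul]

/-- The reflection of vectors modulo three. -/
def residueReflect (e x : Fin 8 → ZMod 3) : Fin 8 → ZMod 3 := x - (x ⬝ᵥ e) • e

theorem residue_reflect (α : Root) (m : Fin 8 → ℤ) :
    residue (α.reflect m) = residueReflect (residue α.1) (residue m) := by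
  rw [Root.reflect, residue_sub, residue_smul, residueReflect, residue_dot]

theorem residue_root_dot_self (α : Root) : residue α.1 ⬝ᵥ residue α.1 = 2 := by
  rw [residue_dot, α.2]; rfl

theorem residueReflect_dot (α : Root) (x y : Fin 8 → ZMod 3) :
    residueReflect (residue α.1) x ⬝ᵥ residueReflect (residue α.1) y = x ⬝ᵥ y := by
  simp only [residueReflect, sub_dotProduct, dotProduct_sub, smul_dotProduct, dotProduct_smul,
    residue_root_dot_self, smul_eq_mul, dotProduct_comm (residue α.1) y]
  ring

theorem residueReflect_residueReflect (α : Root) (x : Fin 8 → ZMod 3) :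
    residueReflect (residue α.1) (residueReflect (residue α.1) x) = x := by
  have h : residueReflect (residue α.1) x ⬝ᵥ residue α.1 = -(x ⬝ᵥ residue α.1) := by
    rw [residueReflect, sub_dotProduct, smul_dotProduct, residue_root_dot_self, smul_eq_mul]; ring
  rw [residueReflect, h, residueReflect]; simp

end ResidueClasses

/-! ### Embeddings as triples of vectors modulo three -/

section Classes

/-- The triples of vectors modulo three. -/
abbrev Triple : Type := Fin 3 → Fin 8 → ZMod 3

/-- The simultaneous reflection of the three vectors. -/
def Triple.reflect (α : Root) (t : Triple) : Triple := fun i => residueReflect (residue α.1) (t i)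

theorem Triple.reflect_reflect (α : Root) (t : Triple) : (t.reflect α).reflect α = t :=
  funext fun i => residueReflect_residueReflect α (t i)

/-- Equivalence under the Weyl group of triples of vectors modulo three. -/
def Triple.Equiv : Triple → Triple → Prop :=
  Relation.EqvGen fun t t' => ∃ α : Root, t' = t.reflect α

theorem Triple.Equiv.refl (t : Triple) : t.Equiv t := Relation.EqvGen.refl t

theorem Triple.Equiv.trans {t t' t'' : Triple} (h : t.Equiv t') (h' : t'.Equiv t'') :
    t.Equiv t'' := Relation.EqvGen.trans _ _ _ h h'

theorem Triple.equiv_reflect (α : Root) (t : Triple) : t.Equiv (t.reflect α) :=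
  Relation.EqvGen.rel _ _ ⟨α, rfl⟩

/-- To prove that a property of triples is invariant it suffices to consider one reflection. -/
theorem Triple.Equiv.iff {P : Triple → Prop} (hP : ∀ α t, P t → P (t.reflect α)) {t t' : Triple}
    (h : t.Equiv t') : P t ↔ P t' := by
  induction h with
  | rel t t' h =>
    obtain ⟨α, rfl⟩ := h
    exact ⟨hP α t, fun h => by have := hP α _ h; rwa [Triple.reflect_reflect] at this⟩
  | refl t => rfl
  | symm t t' _ h => exact h.symm
  | trans _ _ _ _ _ h h' => exact h.trans h'

/-- The Gram matrix, and with it consistency, is constant on orbits; the stepwise reduction relies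
on this. -/
theorem Triple.Equiv.dot {t t' : Triple} (h : t.Equiv t') (i j : Fin 3) :
    t' i ⬝ᵥ t' j = t i ⬝ᵥ t j :=
  (h.iff (P := fun u => u i ⬝ᵥ u j = t i ⬝ᵥ t j)
    (fun α u hu => (residueReflect_dot α (u i) (u j)).trans hu)).1 rfl

/-- The vector `v` is a third of a root lattice vector with class `x` modulo three. -/
def IsClass (v : Fin 8 → ℝ) (x : Fin 8 → ZMod 3) : Prop :=
  ∃ m, (3 : ℝ) • v = latticeVec m ∧ residue m = x

/-- The three vectors of the embedding are thirds of root lattice vectors with the classes `t`. -/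
def Embedding.HasClass (E : Embedding) (t : Triple) : Prop :=
  IsClass E.V (t 0) ∧ IsClass E.a₁ (t 1) ∧ IsClass E.a₃ (t 2)

theorem latticeVec_sub (a b : Fin 8 → ℤ) : latticeVec (a - b) = latticeVec a - latticeVec b := by
  rw [sub_eq_add_neg, latticeVec_add, latticeVec_neg, sub_eq_add_neg]

theorem latticeVec_smul (c : ℤ) (a : Fin 8 → ℤ) : latticeVec (c • a) = (c : ℝ) • latticeVec a := by
  simp only [latticeVec, Pi.smul_apply, smul_eq_mul, Finset.smul_sum, smul_smul]
  push_cast; rfl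

theorem eq_third_smul {v w : Fin 8 → ℝ} (h : (3 : ℝ) • v = w) : v = (3⁻¹ : ℝ) • w := by
  rw [← h, smul_smul]; norm_num

theorem IsClass.reflect {v : Fin 8 → ℝ} {x : Fin 8 → ZMod 3} (h : IsClass v x) (α : Root) :
    IsClass (v - (v ⬝ᵥ latticeVec α.1) • latticeVec α.1) (residueReflect (residue α.1) x) := by
  obtain ⟨m, hm, rfl⟩ := h
  refine ⟨α.reflect m, ?_, residue_reflect α m⟩
  rw [smul_sub, hm, Root.reflect, latticeVec_sub, latticeVec_smul, smul_smul, ← smul_eq_mul,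
    ← smul_dotProduct, hm, latticeVec_dot]

theorem IsClass.exists_add {v w : Fin 8 → ℝ} {x : Fin 8 → ZMod 3} (hv : IsClass v x)
    (hw : IsClass w x) : ∃ l ∈ e8Lattice, w = v + l := by
  obtain ⟨m, hm, rfl⟩ := hv
  obtain ⟨n, hn, hmn⟩ := hw
  obtain ⟨k, rfl⟩ := exists_of_residue_eq hmn
  refine ⟨latticeVec k, range_latticeVec ▸ ⟨k, rfl⟩, ?_⟩
  rw [eq_third_smul hm, eq_third_smul hn, latticeVec_add, latticeVec_smul, smul_add, smul_smul]
  norm_num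

/-- Congruence modulo `3Λ` of the tripled vectors is congruence modulo `Λ` of the vectors, so one
lattice shift of each suffices. -/
theorem equivalent_of_hasClass {E E' : Embedding} {t : Triple} (h : E.HasClass t)
    (h' : E'.HasClass t) : Equivalent E E' := by
  obtain ⟨l, hl, e⟩ := h.1.exists_add h'.1
  obtain ⟨l₁, hl₁, e₁⟩ := h.2.1.exists_add h'.2.1
  obtain ⟨l₃, hl₃, e₃⟩ := h.2.2.exists_add h'.2.2
  refine (Relation.EqvGen.rel _ _ (EquivStep.shiftV E l hl)).trans _ _ _
    ((Relation.EqvGen.rel _ _ (EquivStep.shift_a₁ _ l₁ hl₁)).trans _ _ _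
    ((Relation.EqvGen.rel _ _ (EquivStep.shift_a₃ _ l₃ hl₃)).trans _ _ _ ?_))
  rw [show E' = ⟨E'.V, E'.a₁, E'.a₃⟩ from rfl, e, e₁, e₃]
  exact Relation.EqvGen.refl _

theorem exists_equivalent_of_equiv {t t' : Triple} (h : t.Equiv t') {E : Embedding}
    (hE : E.HasClass t) : ∃ E' : Embedding, E'.HasClass t' ∧ Equivalent E E' := by
  refine (h.iff (P := fun u => ∃ E' : Embedding, E'.HasClass u ∧ Equivalent E E') ?_).1
    ⟨E, hE, Relation.EqvGen.refl E⟩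
  rintro α u ⟨E', ⟨h0, h1, h2⟩, hE'⟩
  refine ⟨_, ⟨h0.reflect α, h1.reflect α, h2.reflect α⟩, hE'.trans _ _ _
    (Relation.EqvGen.rel _ _ (EquivStep.reflect E' (latticeVec α.1)
      (range_latticeVec ▸ ⟨α.1, rfl⟩) ?_))⟩
  rw [latticeVec_dot, α.2]; rfl

theorem equivalent_of_equiv {t t' : Triple} (h : t.Equiv t') {E E' : Embedding}
    (hE : E.HasClass t) (hE' : E'.HasClass t') : Equivalent E E' := by
  obtain ⟨E'', h1, h2⟩ := exists_equivalent_of_equiv h hE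
  exact h2.trans _ _ _ (equivalent_of_hasClass h1 hE')

/-- The roots which are orthogonal modulo three to the three vectors. -/
def Triple.rootSet (t : Triple) : Set Root := {α | ∀ i, residue α.1 ⬝ᵥ t i = 0}

/-- The phase is a cube root of unity, with exponent given by an integral pairing. -/
theorem phase_eq_one_iff {v : Fin 8 → ℝ} {x : Fin 8 → ZMod 3} (h : IsClass v x) (m : Fin 8 → ℤ) :
    phase v m = 1 ↔ residue m ⬝ᵥ x = 0 := by
  obtain ⟨n, hn, rfl⟩ := h
  have h1 : latticeVec m ⬝ᵥ v = (pairing m n : ℝ) / 3 := by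
    rw [eq_third_smul hn, dotProduct_smul, latticeVec_dot, smul_eq_mul]; ring
  rw [residue_dot, phase, h1, Complex.exp_eq_one_iff,
    show ((pairing m n : ZMod 3) = 0) ↔ (3 : ℤ) ∣ pairing m n from
      by exact_mod_cast ZMod.intCast_zmod_eq_zero_iff_dvd (pairing m n) 3]
  have hpi : (2 * Real.pi * Complex.I : ℂ) ≠ 0 := Complex.two_pi_I_ne_zero
  constructor
  · rintro ⟨k, hk⟩
    rw [mul_comm (k : ℂ)] at hk
    have h2 := mul_left_cancel₀ hpi hk
    refine ⟨k, ?_⟩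
    have h3 : ((pairing m n : ℤ) : ℂ) = ((3 * k : ℤ) : ℂ) := by
      push_cast at h2 ⊢
      rw [← h2]; ring
    exact_mod_cast h3
  · rintro ⟨k, hk⟩
    refine ⟨k, ?_⟩
    rw [hk]; push_cast; ring

theorem rootSet_eq_of_hasClass {E : Embedding} {t : Triple} (h : E.HasClass t) :
    rootSet E = t.rootSet := by
  ext α
  simp only [rootSet, Triple.rootSet, Set.mem_ofPred_eq, phase_eq_one_iff h.1,
    phase_eq_one_iff h.2.1, phase_eq_one_iff h.2.2, Fin.forall_fin_succ]
  simp

/-- A reflection is a linear isometry which maps the root set of a triple to that of the reflected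
triple, so it carries the basis along with unchanged coefficients. -/
theorem Triple.Equiv.hasBasis_iff {t t' : Triple} (h : t.Equiv t') {r : ℕ}
    (C : Matrix (Fin r) (Fin r) ℤ) (Φ : List (Fin r → ℤ)) :
    HasBasis t.rootSet C Φ ↔ HasBasis t'.rootSet C Φ := by
  refine h.iff (P := fun u : Triple => HasBasis u.rootSet C Φ) ?_
  rintro α u ⟨β, hβ, hR⟩
  refine ⟨fun i => α.reflectRoot (β i), fun i j => (pairing_reflect α _ _).trans (hβ i j),
    fun γ => ?_⟩
  have h1 : γ ∈ (u.reflect α).rootSet ↔ α.reflectRoot γ ∈ u.rootSet := by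
    refine forall_congr' fun i => ?_
    change _ ↔ residue (α.reflect γ.1) ⬝ᵥ u i = 0
    rw [residue_reflect, ← residueReflect_dot α _ (u i), residueReflect_residueReflect]
    rfl
  rw [h1, hR]
  refine exists_congr fun v => and_congr_right fun _ => ?_
  rw [← reflect_rootComb]
  constructor
  · intro h
    rw [← h]; exact (Root.reflect_reflect α γ.1).symm
  · intro h
    change α.reflect γ.1 = _
    rw [h, Root.reflect_reflect]

end Classes

/-! ### Consistency as a condition on Gram matrices -/

section Consistency

theorem isClass_third {v : Fin 8 → ℤ} (hv : Even (∑ i, v i)) :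
    IsClass (fun I => (v I : ℝ) / 3) (fun i => (v i : ZMod 3)) := by
  have h3 : ((3 : ℝ) • fun I => (v I : ℝ) / 3) = fun I => (v I : ℝ) := by
    funext I
    simp only [Pi.smul_apply, smul_eq_mul]; ring
  have hmem : (fun I => (v I : ℝ)) ∈ e8Lattice := ⟨v, hv, Or.inl fun _ => rfl⟩
  rw [← range_latticeVec] at hmem
  obtain ⟨m, hm⟩ := hmem
  refine ⟨m, h3.trans hm.symm, funext fun i => ?_⟩
  have h1 := congrFun hm i
  rw [latticeVec_eq_doubledVec, div_eq_iff (by norm_num)] at h1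
  have h2 : doubledVec m i = v i * 2 := by exact_mod_cast h1
  have h4 : (2 : ZMod 3) = -1 := rfl
  rw [residue, h2]
  push_cast
  rw [h4]; ring

theorem smul_mem_of_isClass {v : Fin 8 → ℝ} {x : Fin 8 → ZMod 3} (h : IsClass v x) :
    (3 : ℝ) • v ∈ e8Lattice := by
  obtain ⟨m, hm, -⟩ := h
  rw [hm, ← range_latticeVec]
  exact ⟨m, rfl⟩

theorem exists_isClass {v : Fin 8 → ℝ} (h : (3 : ℝ) • v ∈ e8Lattice) : ∃ x, IsClass v x := by
  rw [← range_latticeVec] at h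
  obtain ⟨m, hm⟩ := h
  exact ⟨_, m, hm.symm, rfl⟩

/-- The scalar products of the vectors carry a denominator nine, of which the factor three removes
one third; what is left is divisibility by three of an integer. -/
theorem exists_int_iff {a b : Fin 8 → ℤ} {v w : Fin 8 → ℝ} {x y : Fin 8 → ZMod 3}
    (hv : IsClass v x) (hw : IsClass w y) :
    (∃ n : ℤ, 3 * ((fun I => (a I : ℝ) / 3) ⬝ᵥ (fun I => (b I : ℝ) / 3) + v ⬝ᵥ w) = n) ↔
      x ⬝ᵥ y = -((a ⬝ᵥ b : ℤ) : ZMod 3) := by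
  obtain ⟨m, hm, rfl⟩ := hv
  obtain ⟨n, hn, rfl⟩ := hw
  have h1 : v ⬝ᵥ w = (pairing m n : ℝ) / 9 := by
    rw [eq_third_smul hm, eq_third_smul hn, dotProduct_smul, smul_dotProduct, latticeVec_dot,
      smul_eq_mul, smul_eq_mul]
    ring
  have h2 : (fun I => (a I : ℝ) / 3) ⬝ᵥ (fun I => (b I : ℝ) / 3) = ((a ⬝ᵥ b : ℤ) : ℝ) / 9 := by
    simp only [dotProduct]
    push_cast
    rw [Finset.sum_div]
    exact Finset.sum_congr rfl fun _ _ => by ring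
  have h3 : residue m ⬝ᵥ residue n = -((a ⬝ᵥ b : ℤ) : ZMod 3) ↔
      (3 : ℤ) ∣ pairing m n + a ⬝ᵥ b := by
    rw [residue_dot, eq_neg_iff_add_eq_zero]
    exact_mod_cast ZMod.intCast_zmod_eq_zero_iff_dvd (pairing m n + a ⬝ᵥ b) 3
  rw [h1, h2, h3]
  constructor
  · rintro ⟨k, hk⟩
    refine ⟨k, ?_⟩
    have : ((pairing m n + a ⬝ᵥ b : ℤ) : ℝ) = ((3 * k : ℤ) : ℝ) := by
      push_cast at hk ⊢; linarith
    exact_mod_cast this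
  · rintro ⟨k, hk⟩
    refine ⟨k, ?_⟩
    have : ((pairing m n + a ⬝ᵥ b : ℤ) : ℝ) = ((3 * k : ℤ) : ℝ) := by rw [hk]
    push_cast at this ⊢; linarith

/-- Three times the observable sector vectors. -/
def CMM.thirds : CMM → Fin 3 → Fin 8 → ℤ
  | .cmm1 => ![![-1,-1,0,0,0,2,0,0], ![1,1,-1,-1,2,0,0,0], ![0,0,0,0,0,0,2,0]]
  | .cmm2 => ![![-1,-1,0,0,0,2,0,0], ![1,1,-1,-1,-1,-1,0,0], ![0,0,0,0,0,0,2,0]]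
  | .cmm4 => ![![-1,-1,0,0,0,2,0,0], ![1,1,-1,-1,-1,0,1,0], ![0,0,0,0,0,0,2,0]]
  | .cmm6 => ![![-1,-1,0,0,0,2,0,0], ![1,1,-1,-1,-1,2,1,0], ![0,0,0,0,0,1,1,2]]
  | .cmm8 => ![![-1,-1,0,0,0,1,1,0], ![1,1,-1,-1,-1,1,1,1], ![0,0,0,0,0,1,2,1]]
  | .cmm9 => ![![-1,-1,0,0,0,1,1,0], ![1,1,-1,-1,-1,-2,0,1], ![0,0,0,0,0,0,0,2]]

theorem CMM.observable_eq (c : CMM) :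
    c.observable = .ofThirds (c.thirds 0) (c.thirds 1) (c.thirds 2) := by
  cases c <;> rfl

theorem CMM.even_thirds (c : CMM) (i : Fin 3) : Even (∑ j, c.thirds i j) := by
  revert i; cases c <;> decide

/-- The scalar products modulo three of a hidden embedding which completes `c`. -/
def CMM.gram (c : CMM) (i j : Fin 3) : ZMod 3 := -((c.thirds i ⬝ᵥ c.thirds j : ℤ) : ZMod 3)

/-- The triple has the scalar products required by the observable embedding. -/
def Triple.Completes (t : Triple) (c : CMM) : Prop := ∀ i j, t i ⬝ᵥ t j = c.gram i j

theorem isConsistent_iff {c : CMM} {E : Embedding} {t : Triple} (h : E.HasClass t) :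
    IsConsistent c.observable E ↔ t.Completes c := by
  have hA : c.observable.IsThirdIntegral := by
    rw [c.observable_eq]
    exact ⟨smul_mem_of_isClass (isClass_third (c.even_thirds 0)),
      smul_mem_of_isClass (isClass_third (c.even_thirds 1)),
      smul_mem_of_isClass (isClass_third (c.even_thirds 2))⟩
  have hE : E.IsThirdIntegral := ⟨smul_mem_of_isClass h.1, smul_mem_of_isClass h.2.1,
    smul_mem_of_isClass h.2.2⟩
  have hsymm : ∀ i j, c.gram i j = c.gram j i := fun i j => by
    rw [CMM.gram, CMM.gram, dotProduct_comm]
  rw [IsConsistent, and_iff_right hA, and_iff_right hE, c.observable_eq]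
  simp only [Embedding.ofThirds]
  rw [exists_int_iff h.1 h.1, exists_int_iff h.2.1 h.2.1, exists_int_iff h.2.2 h.2.2,
    exists_int_iff h.2.1 h.2.2, exists_int_iff h.1 h.2.1, exists_int_iff h.1 h.2.2]
  constructor
  · rintro ⟨h00, h11, h22, h12, h01, h02⟩ i j
    fin_cases i <;> fin_cases j
    · exact h00
    · exact h01
    · exact h02
    · exact (dotProduct_comm _ _).trans (h01.trans (hsymm 0 1))
    · exact h11
    · exact h12
    · exact (dotProduct_comm _ _).trans (h02.trans (hsymm 0 2))
    · exact (dotProduct_comm _ _).trans (h12.trans (hsymm 1 2))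
    · exact h22
  · intro h
    exact ⟨h 0 0, h 1 1, h 2 2, h 1 2, h 0 1, h 0 2⟩

theorem exists_hasClass {c : CMM} {E : Embedding} (h : IsConsistent c.observable E) :
    ∃ t : Triple, E.HasClass t ∧ t.Completes c := by
  obtain ⟨-, ⟨h0, h1, h2⟩, -⟩ := id h
  obtain ⟨x0, h0⟩ := exists_isClass h0
  obtain ⟨x1, h1⟩ := exists_isClass h1
  obtain ⟨x2, h2⟩ := exists_isClass h2
  have hc : E.HasClass ![x0, x1, x2] := ⟨h0, h1, h2⟩
  exact ⟨_, hc, (isConsistent_iff hc).1 h⟩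

theorem Triple.Completes.of_equiv {t t' : Triple} {c : CMM} (ht : t.Completes c)
    (h : t.Equiv t') : t'.Completes c := fun i j => (h.dot i j).trans (ht i j)

end Consistency

end HiddenSector

/-! ### Computable arithmetic modulo three -/

namespace HiddenSector

/-- Eight natural numbers, used for kernel computations with vectors modulo three. -/
@[ext] structure Digits where
  d0 : ℕ
  d1 : ℕ
  d2 : ℕ
  d3 : ℕ
  d4 : ℕ
  d5 : ℕ
  d6 : ℕ
  d7 : ℕ

namespace Digits

/-- The vector modulo three with the given digits. -/
def toVec (x : Digits) : Fin 8 → ZMod 3 := ![x.d0, x.d1, x.d2, x.d3, x.d4, x.d5, x.d6, x.d7]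

/-- The digits of a vector modulo three. -/
def ofVec (v : Fin 8 → ZMod 3) : Digits :=
  ⟨(v 0).val, (v 1).val, (v 2).val, (v 3).val, (v 4).val, (v 5).val, (v 6).val, (v 7).val⟩

theorem toVec_ofVec (v : Fin 8 → ZMod 3) : (ofVec v).toVec = v := by
  funext i
  fin_cases i <;> simp [ofVec, toVec]

theorem ofVec_injective : Function.Injective ofVec := fun v w h => by
  rw [← toVec_ofVec v, h, toVec_ofVec]

/-- All digits are less than three. -/
def IsTernary (x : Digits) : Prop :=
  x.d0 < 3 ∧ x.d1 < 3 ∧ x.d2 < 3 ∧ x.d3 < 3 ∧ x.d4 < 3 ∧ x.d5 < 3 ∧ x.d6 < 3 ∧ x.d7 < 3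

theorem ofVec_toVec {x : Digits} (h : x.IsTernary) : ofVec x.toVec = x := by
  obtain ⟨h0, h1, h2, h3, h4, h5, h6, h7⟩ := h
  ext <;> simp [ofVec, toVec, ZMod.val_natCast, Nat.mod_eq_of_lt, *]

theorem isTernary_ofVec (v : Fin 8 → ZMod 3) : (ofVec v).IsTernary :=
  have h (a : ZMod 3) : a.val < 3 := ZMod.val_lt a
  ⟨h _, h _, h _, h _, h _, h _, h _, h _⟩

/-- Equality of the digits. -/
def eqb (x y : Digits) : Bool :=
  Nat.beq x.d0 y.d0 && (Nat.beq x.d1 y.d1 && (Nat.beq x.d2 y.d2 && (Nat.beq x.d3 y.d3 &&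
    (Nat.beq x.d4 y.d4 && (Nat.beq x.d5 y.d5 && (Nat.beq x.d6 y.d6 && Nat.beq x.d7 y.d7))))))

theorem eqb_iff {x y : Digits} : x.eqb y = true ↔ x = y := by
  simp [eqb, Digits.ext_iff]

/-- The existence of an element of a list, by direct recursion. -/
noncomputable def existsIn {α : Type} (p : α → Bool) (l : List α) : Bool :=
  List.rec false (fun a _ b => Bool.rec b true (p a)) l

theorem existsIn_iff {α : Type} {p : α → Bool} {l : List α} :
    existsIn p l = true ↔ ∃ a ∈ l, p a = true := by
  induction l with
  | nil => simp [existsIn]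
  | cons a l ih =>
    have h : existsIn p (a :: l) = Bool.rec (existsIn p l) true (p a) := rfl
    rw [h]
    simp only [List.mem_cons, exists_eq_or_imp, ← ih]
    cases p a <;> simp

/-- Membership in a list. -/
noncomputable def memb (x : Digits) (l : List Digits) : Bool := existsIn x.eqb l

theorem memb_iff {x : Digits} {l : List Digits} : x.memb l = true ↔ x ∈ l := by
  simp [memb, existsIn_iff, eqb_iff]

/-- The number with the given digits in base three. -/
def value (x : Digits) : ℕ :=
  .add (.mul 3 (.add (.mul 3 (.add (.mul 3 (.add (.mul 3 (.add (.mul 3 (.add (.mul 3 (.add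
    (.mul 3 x.d0) x.d1)) x.d2)) x.d3)) x.d4)) x.d5)) x.d6)) x.d7

/-- The ternary digits of a number. -/
def ofNat (n : ℕ) : Digits :=
  ⟨n / 2187 % 3, n / 729 % 3, n / 243 % 3, n / 81 % 3, n / 27 % 3, n / 9 % 3, n / 3 % 3, n % 3⟩

/-- The scalar product modulo three. -/
def dot (x y : Digits) : ℕ :=
  .mod (.add (.mul x.d0 y.d0) (.add (.mul x.d1 y.d1) (.add (.mul x.d2 y.d2) (.add (.mul x.d3 y.d3)
    (.add (.mul x.d4 y.d4) (.add (.mul x.d5 y.d5) (.add (.mul x.d6 y.d6) (.mul x.d7 y.d7)))))))) 3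

theorem dot_eq (x y : Digits) : x.dot y = (x.d0 * y.d0 + (x.d1 * y.d1 + (x.d2 * y.d2 +
    (x.d3 * y.d3 + (x.d4 * y.d4 + (x.d5 * y.d5 + (x.d6 * y.d6 + x.d7 * y.d7))))))) % 3 := rfl

theorem natCast_mod_three (n : ℕ) : ((n % 3 : ℕ) : ZMod 3) = n := by simp

theorem dot_cast (x y : Digits) : (x.dot y : ZMod 3) = x.toVec ⬝ᵥ y.toVec := by
  rw [dot_eq, natCast_mod_three]
  simp [toVec, dotProduct, Fin.sum_univ_eight, add_assoc]

theorem dot_ofVec (v w : Fin 8 → ZMod 3) : (ofVec v).dot (ofVec w) = (v ⬝ᵥ w).val := by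
  have h := dot_cast (ofVec v) (ofVec w)
  rw [toVec_ofVec, toVec_ofVec] at h
  rw [← h, ZMod.val_natCast, Nat.mod_eq_of_lt]
  exact Nat.mod_lt _ (by norm_num : 0 < 3)

/-- The vector `x + c • e` modulo three. -/
def addMul (c : ℕ) (x e : Digits) : Digits where
  d0 := .mod (.add x.d0 (.mul c e.d0)) 3
  d1 := .mod (.add x.d1 (.mul c e.d1)) 3
  d2 := .mod (.add x.d2 (.mul c e.d2)) 3
  d3 := .mod (.add x.d3 (.mul c e.d3)) 3
  d4 := .mod (.add x.d4 (.mul c e.d4)) 3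
  d5 := .mod (.add x.d5 (.mul c e.d5)) 3
  d6 := .mod (.add x.d6 (.mul c e.d6)) 3
  d7 := .mod (.add x.d7 (.mul c e.d7)) 3

theorem addMul_eq (c : ℕ) (x e : Digits) : addMul c x e = ⟨(x.d0 + c * e.d0) % 3,
    (x.d1 + c * e.d1) % 3, (x.d2 + c * e.d2) % 3, (x.d3 + c * e.d3) % 3, (x.d4 + c * e.d4) % 3,
    (x.d5 + c * e.d5) % 3, (x.d6 + c * e.d6) % 3, (x.d7 + c * e.d7) % 3⟩ := rfl

theorem toVec_addMul (c : ℕ) (x e : Digits) :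
    (addMul c x e).toVec = x.toVec + (c : ZMod 3) • e.toVec := by
  funext i
  fin_cases i <;> simp [addMul_eq, toVec]

theorem isTernary_addMul (c : ℕ) (x e : Digits) : (addMul c x e).IsTernary :=
  have h (n : ℕ) : n % 3 < 3 := Nat.mod_lt _ (by norm_num)
  ⟨h _, h _, h _, h _, h _, h _, h _, h _⟩

/-- The reflection modulo three in the hyperplane orthogonal to `e`. -/
def reflect (x e : Digits) : Digits := addMul (.mul 2 (x.dot e)) x e

/-- The coefficient 2 stands for -1, so that subtraction of natural numbers is avoided. -/
theorem toVec_reflect (x e : Digits) : (x.reflect e).toVec = residueReflect e.toVec x.toVec := by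
  rw [reflect, Nat.mul_eq, toVec_addMul, residueReflect, sub_eq_add_neg, ← neg_smul, Nat.cast_mul,
    dot_cast,
    show ((2 : ℕ) : ZMod 3) = -1 from rfl, neg_one_mul]

theorem ofVec_residueReflect (e : Digits) (v : Fin 8 → ZMod 3) :
    ofVec (residueReflect e.toVec v) = (ofVec v).reflect e := by
  have h : ((ofVec v).reflect e).IsTernary := isTernary_addMul _ _ _
  rw [← ofVec_toVec h, toVec_reflect, toVec_ofVec]

/-- A property of the three possible digits. -/
def forallDigit (p : ℕ → Bool) : Bool := p 0 && (p 1 && p 2)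

theorem of_forallDigit {p : ℕ → Bool} (h : forallDigit p = true) {n : ℕ} (hn : n < 3) :
    p n = true := by
  simp only [forallDigit, Bool.and_eq_true] at h
  interval_cases n
  exacts [h.1, h.2.1, h.2.2]

/-- A property of all 6561 vectors. -/
def forallVec (p : Digits → Bool) : Bool :=
  forallDigit fun a => forallDigit fun b => forallDigit fun c => forallDigit fun d =>
    forallDigit fun e => forallDigit fun f => forallDigit fun g => forallDigit fun h =>
      p ⟨a, b, c, d, e, f, g, h⟩

theorem of_forallVec {p : Digits → Bool} (h : forallVec p = true) {x : Digits}
    (hx : x.IsTernary) : p x = true := by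
  obtain ⟨h0, h1, h2, h3, h4, h5, h6, h7⟩ := hx
  exact of_forallDigit (of_forallDigit (of_forallDigit (of_forallDigit (of_forallDigit
    (of_forallDigit (of_forallDigit (of_forallDigit h h0) h1) h2) h3) h4) h5) h6) h7

end Digits

/-! ### Recognising the classes of roots -/

section RootCodes

open Digits

/-- One for a nonzero digit. -/
def nonzero (n : ℕ) : ℕ := if n = 0 then 0 else 1

/-- The number of nonzero digits. -/
def Digits.support (x : Digits) : ℕ :=
  nonzero x.d0 + nonzero x.d1 + nonzero x.d2 + nonzero x.d3 + nonzero x.d4 + nonzero x.d5 +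
    nonzero x.d6 + nonzero x.d7

/-- The sum of the digits. -/
def Digits.sum (x : Digits) : ℕ := x.d0 + x.d1 + x.d2 + x.d3 + x.d4 + x.d5 + x.d6 + x.d7

/-- The criterion for being the class modulo three of a root. -/
def Digits.isRoot (x : Digits) : Bool :=
  Nat.beq x.support 2 || (Nat.beq x.support 8 && Nat.beq (x.sum % 2) 0)

theorem exists_doubledVec (α : Root) : ∃ (n : Fin 8 → ℤ) (δ : ℤ), (δ = 0 ∨ δ = 1) ∧
    Even (∑ i, n i) ∧ ∑ i, (2 * n i + δ) ^ 2 = 8 ∧ ∀ i, doubledVec α.1 i = 2 * n i + δ := by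
  have h : latticeVec α.1 ∈ e8Lattice := range_latticeVec ▸ ⟨α.1, rfl⟩
  obtain ⟨n, hn, h⟩ := h
  have h8 := four_mul_pairing_self α.1
  rw [α.2] at h8
  have key : ∃ δ : ℤ, (δ = 0 ∨ δ = 1) ∧ ∀ i, doubledVec α.1 i = 2 * n i + δ := by
    rcases h with h | h
    · refine ⟨0, Or.inl rfl, fun i => ?_⟩
      have := h i
      rw [latticeVec_eq_doubledVec] at this
      have : (doubledVec α.1 i : ℝ) = ((2 * n i + 0 : ℤ) : ℝ) := by push_cast; linarith
      exact_mod_cast this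
    · refine ⟨1, Or.inr rfl, fun i => ?_⟩
      have := h i
      rw [latticeVec_eq_doubledVec] at this
      have : (doubledVec α.1 i : ℝ) = ((2 * n i + 1 : ℤ) : ℝ) := by push_cast; linarith
      exact_mod_cast this
  obtain ⟨δ, hδ, hd⟩ := key
  refine ⟨n, δ, hδ, hn, ?_, hd⟩
  simp only [hd] at h8
  rw [← h8]; norm_num

theorem exists_root_of_sum_sq {n : Fin 8 → ℤ} {δ : ℤ} (hδ : δ = 0 ∨ δ = 1) (hn : Even (∑ i, n i))
    (h8 : ∑ i, (2 * n i + δ) ^ 2 = 8) : ∃ α : Root, ∀ i, doubledVec α.1 i = 2 * n i + δ := by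
  have hmem : (fun i => (n i : ℝ) + δ / 2) ∈ e8Lattice := by
    refine ⟨n, hn, ?_⟩
    rcases hδ with rfl | rfl
    · exact Or.inl fun i => by simp
    · exact Or.inr fun i => by simp
  rw [← range_latticeVec] at hmem
  obtain ⟨m, hm⟩ := hmem
  have hd : ∀ i, doubledVec m i = 2 * n i + δ := fun i => by
    have := congrFun hm i
    rw [latticeVec_eq_doubledVec] at this
    have : (doubledVec m i : ℝ) = ((2 * n i + δ : ℤ) : ℝ) := by push_cast; linarith
    exact_mod_cast this
  refine ⟨⟨m, ?_⟩, hd⟩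
  have h4 := four_mul_pairing_self m
  simp only [hd, h8] at h4
  omega

theorem residue_of_doubledVec {m n : Fin 8 → ℤ} {δ : ℤ} {i : Fin 8}
    (h : doubledVec m i = 2 * n i + δ) : residue m i = ((n i - δ : ℤ) : ZMod 3) := by
  rw [residue, h]
  push_cast
  rw [show (2 : ZMod 3) = -1 from rfl]
  ring

theorem sum_sq_bound {f : Fin 8 → ℤ} (h : ∑ i, f i ^ 2 = 8) (i : Fin 8) : -2 ≤ f i ∧ f i ≤ 2 := by
  have := Finset.single_le_sum (f := fun i => f i ^ 2) (fun i _ => sq_nonneg _) (Finset.mem_univ i)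
  simp only [h] at this
  constructor <;> nlinarith

theorem isRoot_residue (α : Root) : (ofVec (residue α.1)).isRoot = true := by
  obtain ⟨n, δ, hδ, ⟨s, hs⟩, h8, hd⟩ := exists_doubledVec α
  have hr := fun i => residue_of_doubledVec (hd i)
  have hb := sum_sq_bound (f := fun i => 2 * n i + δ) h8
  simp only [isRoot, Bool.or_eq_true, Bool.and_eq_true, Nat.beq_eq, support, Digits.sum,
    ofVec, hr]
  rcases hδ with rfl | rfl
  · left
    -- The squares of the coordinates of an integral root sum to two, so two coordinates are `±1`
    -- and the others vanish.
    have hz : ∀ i, (nonzero ((n i - 0 : ℤ) : ZMod 3).val : ℤ) = n i ^ 2 := fun i => by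
      obtain ⟨h1, h2⟩ := hb i
      obtain h | h | h : n i = -1 ∨ n i = 0 ∨ n i = 1 := by omega
      all_goals rw [h]; decide
    simp only [Fin.sum_univ_eight] at h8
    have := hz 0; have := hz 1; have := hz 2; have := hz 3
    have := hz 4; have := hz 5; have := hz 6; have := hz 7
    rw [← Int.natCast_inj]
    simp only [Nat.cast_add, hz]
    push_cast
    linarith
  · right
    -- Modulo three, `1/2` is 2 and `-1/2` is 1. Hence no digit vanishes, and the sum of the digits
    -- has the parity of `∑ n i`.
    have hz : ∀ i, (((n i - 1 : ℤ) : ZMod 3).val : ℤ) = n i + 2 ∧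
        nonzero ((n i - 1 : ℤ) : ZMod 3).val = 1 := fun i => by
      obtain ⟨h1, h2⟩ := hb i
      obtain h | h : n i = -1 ∨ n i = 0 := by omega
      all_goals rw [h]; decide
    simp only [Fin.sum_univ_eight] at hs
    have := hz 0; have := hz 1; have := hz 2; have := hz 3
    have := hz 4; have := hz 5; have := hz 6; have := hz 7
    omega

/-- The integer which represents a digit, minimal or in `{-1, 0}`. -/
def liftDigit (δ a : ℕ) : ℤ := if δ = 0 then (if a = 2 then -1 else a) else a - 2

/-- The sum of a function of the digits. -/
def Digits.sumOf (f : ℕ → ℤ) (x : Digits) : ℤ :=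
  f x.d0 + f x.d1 + f x.d2 + f x.d3 + f x.d4 + f x.d5 + f x.d6 + f x.d7

/-- Zero for the integral roots, one for the half-integral roots. -/
def Digits.shift (x : Digits) : ℕ := if x.support = 2 then 0 else 1

/-- For the converse, each of the 6561 vectors which meets the criterion is lifted digit by digit,
and the lift is checked to have even sum and the norm of a root. -/
theorem liftDigit_spec : forallVec (fun x => !x.isRoot ||
    (decide (x.sumOf (liftDigit x.shift) % 2 = 0) &&
      decide (x.sumOf (fun a => (2 * liftDigit x.shift a + x.shift) ^ 2) = 8))) = true := by
  decide +kernel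

theorem exists_root_of_isRoot {x : Digits} (hx : x.IsTernary) (h : x.isRoot = true) :
    ∃ α : Root, residue α.1 = x.toVec := by
  have hs := of_forallVec liftDigit_spec hx
  simp only [h, Bool.not_true, Bool.false_or, Bool.and_eq_true, decide_eq_true_eq] at hs
  obtain ⟨he, h8⟩ := hs
  have hδ : (x.shift : ℤ) = 0 ∨ (x.shift : ℤ) = 1 := by
    unfold Digits.shift; split_ifs <;> simp
  obtain ⟨α, hα⟩ := exists_root_of_sum_sq (n := ![liftDigit x.shift x.d0, liftDigit x.shift x.d1,
    liftDigit x.shift x.d2, liftDigit x.shift x.d3, liftDigit x.shift x.d4, liftDigit x.shift x.d5,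
    liftDigit x.shift x.d6, liftDigit x.shift x.d7]) hδ
    (by
      simp only [Fin.sum_univ_eight]
      exact Int.even_iff.2 he)
    (by
      simp only [Fin.sum_univ_eight]
      exact h8)
  refine ⟨α, funext fun i => ?_⟩
  rw [residue_of_doubledVec (hα i)]
  have key : ∀ δ a : ℕ, δ < 2 → a < 3 → ((liftDigit δ a - δ : ℤ) : ZMod 3) = (a : ZMod 3) := by
    intro δ a hδ ha
    interval_cases δ <;> interval_cases a <;> rfl
  have hδ' : x.shift < 2 := by omega
  obtain ⟨h0, h1, h2, h3, h4, h5, h6, h7⟩ := hx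
  fin_cases i
  exacts [key _ _ hδ' h0, key _ _ hδ' h1, key _ _ hδ' h2, key _ _ hδ' h3, key _ _ hδ' h4,
    key _ _ hδ' h5, key _ _ hδ' h6, key _ _ hδ' h7]

end RootCodes

end HiddenSector

/-! ### Reduction of vectors by words of reflections -/

namespace HiddenSector

section Words

open Digits

/-- The composition of the reflections in the entries of a list. -/
def applyWord (w : List Digits) (x : Digits) : Digits := w.foldl reflect x

/-- A computed word acts on the three vectors simultaneously, as operation (II) demands. -/
theorem exists_equiv_applyWord (w : List Digits) (hw : ∀ e ∈ w, e.IsTernary ∧ e.isRoot = true)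
    (t : Triple) : ∃ t' : Triple, t.Equiv t' ∧ ∀ i, ofVec (t' i) = applyWord w (ofVec (t i)) := by
  induction w generalizing t with
  | nil => exact ⟨t, .refl t, fun _ => rfl⟩
  | cons e w ih =>
    obtain ⟨he, hw⟩ := List.forall_mem_cons.1 hw
    obtain ⟨α, hα⟩ := exists_root_of_isRoot he.1 he.2
    obtain ⟨t', h, ht'⟩ := ih hw (t.reflect α)
    refine ⟨t', (Triple.equiv_reflect α t).trans h, fun i => ?_⟩
    rw [ht', Triple.reflect, hα, ofVec_residueReflect]
    rfl

theorem isTernary_ofNat (n : ℕ) : (ofNat n).IsTernary :=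
  have h (n : ℕ) : n % 3 < 3 := Nat.mod_lt _ (by norm_num)
  ⟨h _, h _, h _, h _, h _, h _, h _, h _⟩

/-- The word with the given codes. -/
def word (w : List ℕ) : List Digits := w.map ofNat

/-- The word consists of roots and fixes the given vectors. -/
def admissible (fixed : List Digits) (w : List Digits) : Bool :=
  w.all isRoot && fixed.all fun x => (applyWord w x).eqb x

/-- The vector is in the list `reps`, or one of the words decreases it or moves it into `reps`. -/
noncomputable def reducible (words : List (List Digits)) (reps : List Digits) (x : Digits) : Bool :=
  x.memb reps || existsIn (fun w =>
    Nat.blt (applyWord w x).value x.value || (applyWord w x).memb reps) words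

/-- The classes of one member of each pair of opposite roots. -/
def positiveCodes : List ℕ :=
  [4, 5, 10, 11, 12, 15, 28, 29, 30, 33, 36, 45, 82, 83, 84, 87, 90, 99, 108, 135, 244, 245, 246,
   249, 252, 261, 270, 297, 324, 405, 730, 731, 732, 735, 738, 747, 756, 783, 810, 891, 972,
   1215, 2188, 2189, 2190, 2193, 2196, 2205, 2214, 2241, 2268, 2349, 2430, 2673, 2916, 3280,
   3284, 3290, 3292, 3308, 3310, 3316, 3320, 3362, 3364, 3370, 3374, 3388, 3392, 3398, 3400,
   3524, 3526, 3532, 3536, 3550, 3554, 3560, 3562, 3604, 3608, 3614, 3616, 3632, 3634, 3640,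
   3644, 3645, 4010, 4012, 4018, 4022, 4036, 4040, 4046, 4048, 4090, 4094, 4100, 4102, 4118,
   4120, 4126, 4130, 4252, 4256, 4262, 4264, 4280, 4282, 4288, 4292, 4334, 4336, 4342, 4346,
   4360, 4364, 4370, 4372]

/-- Single reflections which fix the given vectors, together with further such words. -/
def stabilizerWords (fixed : List Digits) (extra : List (List ℕ)) : List (List Digits) :=
  (positiveCodes.map fun n => [ofNat n]).filter (admissible fixed) ++
    (extra.map word).filter (admissible fixed)

/-- Every vector with norm `g` which has the prescribed scalar products with the vectors of `fixed`
can be moved into the list `reps`. -/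
noncomputable def orbitCheck (g : ℕ) (fixed : List (Digits × ℕ)) (extra : List (List ℕ))
    (reps : List Digits) : Bool :=
  forallVec fun x => !(Nat.beq (x.dot x) g && fixed.all fun f => Nat.beq (x.dot f.1) f.2) ||
    reducible (stabilizerWords (fixed.map Prod.fst) extra) reps x

/-- The filter by `admissible` makes any list of candidate words safe: words which are not products
of root reflections, or which move a fixed vector, are discarded. -/
theorem mem_stabilizerWords {fixed : List Digits} {extra : List (List ℕ)} {w : List Digits}
    (h : w ∈ stabilizerWords fixed extra) :
    (∀ e ∈ w, e.IsTernary ∧ e.isRoot = true) ∧ ∀ x ∈ fixed, applyWord w x = x := by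
  have key : admissible fixed w = true ∧ ∃ l, w = word l := by
    rcases List.mem_append.1 h with h | h <;> obtain ⟨h, h'⟩ := List.mem_filter.1 h <;>
      obtain ⟨n, -, rfl⟩ := List.mem_map.1 h
    exacts [⟨h', [n], rfl⟩, ⟨h', n, rfl⟩]
  obtain ⟨ha, l, rfl⟩ := key
  simp only [admissible, Bool.and_eq_true, List.all_eq_true] at ha
  refine ⟨fun e he => ⟨?_, ha.1 e he⟩, fun x hx => eqb_iff.1 (ha.2 x hx)⟩
  obtain ⟨n, -, rfl⟩ := List.mem_map.1 he
  exact isTernary_ofNat n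

/-- Descent on the value in base three. A vector not yet in `reps` is moved into it or made smaller
by a word which fixes the earlier vectors; the prescribed scalar products survive, so the check
applies again. -/
theorem exists_equiv_mem {g : ℕ} {fixed : List (Digits × ℕ)} {extra : List (List ℕ)}
    {reps : List Digits} (hc : orbitCheck g fixed extra reps = true) (k : Fin 3) (t : Triple)
    (hg : (ofVec (t k)).dot (ofVec (t k)) = g)
    (hf : ∀ f ∈ fixed, ∃ i, i < k ∧ ofVec (t i) = f.1 ∧ (ofVec (t k)).dot (ofVec (t i)) = f.2)
    (hf' : ∀ i < k, ∃ f ∈ fixed, ofVec (t i) = f.1) :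
    ∃ t' : Triple, t.Equiv t' ∧ (∀ i < k, t' i = t i) ∧ ofVec (t' k) ∈ reps := by
  induction hn : (ofVec (t k)).value using Nat.strong_induction_on generalizing t with
  | _ n ih =>
  subst hn
  have h := of_forallVec hc (isTernary_ofVec (t k))
  have hp : (Nat.beq ((ofVec (t k)).dot (ofVec (t k))) g &&
      fixed.all fun f => Nat.beq ((ofVec (t k)).dot f.1) f.2) = true := by
    rw [Bool.and_eq_true, List.all_eq_true]
    refine ⟨by rw [Nat.beq_eq, hg], fun f hff => ?_⟩
    obtain ⟨i, -, h1, h2⟩ := hf f hff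
    rw [Nat.beq_eq, ← h1, h2]
  rw [hp, Bool.not_true, Bool.false_or, reducible, Bool.or_eq_true, existsIn_iff] at h
  rcases h with h | ⟨w, hw, h⟩
  · exact ⟨t, .refl t, fun _ _ => rfl, memb_iff.1 h⟩
  obtain ⟨hr, hfix⟩ := mem_stabilizerWords hw
  obtain ⟨t', ht, ht'⟩ := exists_equiv_applyWord w hr t
  have hlt : ∀ i < k, t' i = t i := fun i hi => by
    obtain ⟨f, hff, e⟩ := hf' i hi
    apply ofVec_injective
    rw [ht', e]
    exact hfix _ (List.mem_map_of_mem hff)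
  rw [Bool.or_eq_true, memb_iff, ← ht'] at h
  rcases h with h | h
  · have hdot : ∀ i j, (ofVec (t' i)).dot (ofVec (t' j)) = (ofVec (t i)).dot (ofVec (t j)) :=
      fun i j => by rw [dot_ofVec, dot_ofVec, ht.dot]
    obtain ⟨t'', h1, h2, h3⟩ := ih _ (by rwa [Nat.blt_eq] at h) t' ((hdot k k).trans hg)
      (fun f hff => by
        obtain ⟨i, hi, e1, e2⟩ := hf f hff
        exact ⟨i, hi, by rw [hlt i hi, e1], (hdot k i).trans e2⟩)
      (fun i hi => by
        obtain ⟨f, hff, e⟩ := hf' i hi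
        exact ⟨f, hff, by rw [hlt i hi, e]⟩) rfl
    exact ⟨t'', ht.trans h1, fun i hi => (h2 i hi).trans (hlt i hi), h3⟩
  · exact ⟨t', ht, hlt, h⟩

end Words

/-! ### Representatives and words for the orbit reduction -/

section Data

open Digits

/-- The digits modulo three of an integer vector. -/
def digitsOfInt (v : Fin 8 → ℤ) : Digits :=
  ⟨(v 0 % 3).toNat, (v 1 % 3).toNat, (v 2 % 3).toNat, (v 3 % 3).toNat, (v 4 % 3).toNat,
    (v 5 % 3).toNat, (v 6 % 3).toNat, (v 7 % 3).toNat⟩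

theorem digitsOfInt_eq (v : Fin 8 → ℤ) : digitsOfInt v = ofVec fun i => (v i : ZMod 3) := by
  have h : ∀ n : ℤ, (n % 3).toNat = ((n : ZMod 3)).val := fun n => by
    have := ZMod.val_intCast (n := 3) n
    omega
  simp only [digitsOfInt, ofVec, h]

/-- Embeddings of Case 5 which complete the list. -/
def caseFiveTable : List TableEntry :=
  table .cmm1 ![2,1,1,0,0,0,0,0]
    [(![-1,1,0,1,1,0,0,0], ![2,0,-1,0,-1,1,1,0], .case5),
     (![-1,1,0,1,1,0,0,0], ![2,0,-1,0,-1,1,0,1], .case5),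
     (![-1,1,0,1,1,0,0,0], ![2,0,-1,0,-1,1,0,-1], .case5)] ++
  table .cmm2 ![2,1,1,0,0,0,0,0]
    [(![-1,1,-1,1,1,1,0,0], ![2,0,-1,1,0,0,1,1], .case5),
     (![-1,1,-1,1,1,1,0,0], ![2,0,-1,1,0,0,-1,-1], .case5),
     (![-1,1,-1,1,1,1,0,0], ![2,0,-1,0,1,0,1,1], .case5)] ++
  table .cmm4 ![2,1,1,0,0,0,0,0]
    [(![-1,1,0,1,1,1,1,0], ![2,0,-1,1,0,0,-1,1], .case5),
     (![-1,1,0,1,1,1,1,0], ![2,0,-1,1,0,0,-1,-1], .case5),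
     (![-1,1,0,1,1,1,1,0], ![2,0,-1,1,0,-1,0,1], .case5)] ++
  table .cmm6 ![2,1,1,0,0,0,0,0]
    [(![-2,0,-1,1,1,1,0,0], ![2,0,0,1,0,0,1,0], .case5),
     (![-2,0,-1,1,1,1,0,0], ![2,0,0,1,0,0,0,1], .case5),
     (![-2,0,-1,1,1,1,0,0], ![2,0,0,1,0,0,0,-1], .case5)] ++
  table .cmm8 ![2,1,1,1,1,0,0,0]
    [(![-1,0,0,0,-1,1,1,0], ![2,0,0,-1,0,1,0,0], .case5),
     (![-1,0,0,0,-1,1,1,0], ![2,0,0,-1,0,0,1,0], .case5),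
     (![-1,0,0,0,-1,1,1,0], ![2,0,-1,0,0,1,0,0], .case5)] ++
  table .cmm9 ![2,1,1,1,1,0,0,0]
    [(![-2,0,0,0,-1,1,1,-1], ![2,1,1,0,0,1,1,0], .case5),
     (![-2,0,0,0,-1,1,1,-1], ![2,1,1,0,0,1,0,-1], .case5)]

/-- The entries of the complete list. -/
def completeTable : List TableEntry := displayedTable ++ caseFiveTable

/-- Words which move a vector to a smaller vector of the same orbit. -/
def firstWords : List (List ℕ) :=
  [[245, 735, 2196], [28, 29], [244, 4010], [730, 731], [731, 2193], [10, 11], [108, 4252], [244,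
  245]]

/-- A representative `3V` of each orbit, with words for the second step, and in each case the
representatives `3a₁` of the orbits, with words for the third step. -/
def branches : CMM → List (ℕ × List (List ℕ) × List (ℕ × List (List ℕ)))
  | .cmm1 =>
    -- The branch `3V ≡ 0` has no continuation, here and for CMM 2, 4 and 6, since the required
    -- scalar product of `3V` and `3a₁` is nonzero modulo three. The code 5346 is
    -- `(2,1,1,0,0,0,0,0)`.
    [(0, [], []), (5346, [[28, 29], [2430, 4256], [2430, 4372], [2916, 4252]], [(1458, [[29, 87],
    [10, 11], [28, 29]]), (5211, [[12, 4256], [5, 4262], [10, 135, 4264], [11, 135, 4252], [11,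
    2916], [10, 11], [4, 4262], [2916, 4262]])])]
  | .cmm2 =>
    [(0, [], []), (5346, [[10, 11, 4370], [82, 1215, 4372], [4252, 4292], [83, 2916], [4, 5],
    [2430, 4292], [82, 83]], [(5706, [[5, 4334], [99, 4282], [4, 4262], [4, 4336], [99, 2916],
    [4262, 4282], [45, 4334], [2916, 4262], [4280, 4336]]), (2754, [[4, 4288], [10, 11], [12,
    4262], [29, 4292]])])]
  | .cmm4 =>
    [(0, [], []), (5346, [[4, 4370], [10, 11], [4256, 4370], [1215, 4372], [2430, 4252], [82,
    83]], [(5223, [[33, 4334], [87, 4334], [87, 4372], [99, 2916], [15, 45, 4334, 4372], [87,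
    4262], [2916, 4280]]), (3402, [[29, 87], [28, 29]])])]
  | .cmm6 =>
    [(0, [], []), (5346, [[83, 1215], [4, 5], [36, 1215, 4292], [82, 83], [2430, 4252, 4292]],
    [(810, [[10, 11], [36, 4252], [29, 4292], [10, 4280], [28, 29]]), (2790, [[5, 99, 2430], [4,
    5], [4262, 4282], [45, 4336], [4280, 4336], [99, 4336], [4, 4262], [4, 4334], [99, 4280]])])]
  | .cmm8 =>
    [(2916, [[10, 4018, 4360], [4, 5], [83, 249], [82, 83]], [(360, [[4100, 4120], [4, 5], [4102,
    4262], [45, 4046]])]), (5454, [[4, 3290, 4342], [4, 5], [11, 2268], [10, 11], [783, 3292],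
    [3280, 3632], [3632, 4282], [2214, 3634]], [(4440, [[3280, 4120, 4288], [405, 3280, 3640,
    4334], [4282, 4334], [3280, 4126], [4126, 4334], [891, 4126], [3280, 3634]])])]
  | .cmm9 =>
    [(2916, [[245, 3645], [4, 5], [12, 108, 4280], [82, 83]], [(2430, [[4, 4370], [36, 4292],
    [82, 83]]), (6197, [[249, 4010]]), (5832, [])]), (5454, [[11, 2214], [4, 5], [3640, 4130],
    [4130, 4280], [10, 11], [4, 4336], [783, 3280]], [(4383, [[3280, 4336], [4, 5], [4, 297, 891,
    4120], [3280, 4282], [783, 4280]]), (2254, [[11, 3280], [2214, 4280], [405, 3632, 4346],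
    [2214, 4120, 4288], [3632, 4288], [891, 4120], [4280, 4346], [15, 2214]]), (2255, [[5, 135,
    2430, 3280, 4342, 3634], [15, 3292], [891, 2214], [10, 4334], [10, 891, 2214], [4, 5, 135,
    2430, 3280, 4342, 3634, 5, 135, 2430, 3280, 4342, 3634], [4, 10, 5, 135, 2430, 3280, 4342,
    3634], [10, 5, 135, 2430, 3280, 4342, 3634]]), (4347, [])])]

/-- The classes of `3a₃` in the list which complete those of `3V` and `3a₁`. -/
def thirdReps (c : CMM) (v a : Digits) : List Digits :=
  (completeTable.filter fun e => decide (e.cmm = c) && ((digitsOfInt e.V).eqb v &&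
    (digitsOfInt e.a₁).eqb a)).map fun e => digitsOfInt e.a₃

/-- The digit of the scalar product. -/
def gramDigit (c : CMM) (i j : Fin 3) : ℕ := (c.gram i j).val

/-- The kernel check for the second and third steps. -/
noncomputable def branchCheck (c : CMM) : Bool :=
  (branches c).all fun b =>
    orbitCheck (gramDigit c 1 1) [(ofNat b.1, gramDigit c 1 0)] b.2.1
      (b.2.2.map fun a => ofNat a.1) &&
    b.2.2.all fun a => orbitCheck (gramDigit c 2 2)
      [(ofNat b.1, gramDigit c 2 0), (ofNat a.1, gramDigit c 2 1)] a.2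
      (thirdReps c (ofNat b.1) (ofNat a.1))

/-- The kernel check for the first step. -/
noncomputable def firstCheck (c : CMM) : Bool :=
  orbitCheck (gramDigit c 0 0) [] firstWords ((branches c).map fun b => ofNat b.1)

end Data

end HiddenSector

/-! ### Finding a basis of the unbroken roots -/

namespace HiddenSector

section RootSystems

open Digits

/-- The classes modulo three of the roots. -/
def rootDigits : List Digits :=
  -- Modulo three `x + x = -x`, so the second half lists the opposite roots.
  (positiveCodes.map ofNat) ++ positiveCodes.map fun n => addMul 1 (ofNat n) (ofNat n)

theorem rootDigits_complete :
    forallVec (fun x => !x.isRoot || x.memb rootDigits) = true := by decide +kernel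

theorem rootDigits_isRoot : rootDigits.all isRoot = true := by decide +kernel

theorem exists_residue_of_mem {x : Digits} (h : x ∈ rootDigits) :
    ∃ α : Root, ofVec (residue α.1) = x := by
  have ht : x.IsTernary := by
    rcases List.mem_append.1 h with h | h <;> obtain ⟨n, -, rfl⟩ := List.mem_map.1 h
    exacts [isTernary_ofNat n, isTernary_addMul _ _ _]
  obtain ⟨α, hα⟩ := exists_root_of_isRoot ht (List.all_eq_true.1 rootDigits_isRoot x h)
  exact ⟨α, by rw [hα, ofVec_toVec ht]⟩

theorem residue_mem_rootDigits (α : Root) : ofVec (residue α.1) ∈ rootDigits := by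
  have h := of_forallVec rootDigits_complete (isTernary_ofVec (residue α.1))
  rw [isRoot_residue, Bool.not_true, Bool.false_or, memb_iff] at h
  exact h

/-- The linear combination of the vectors in a list. -/
def combination : List ℕ → List Digits → Digits
  | c :: cs, x :: xs => addMul c (combination cs xs) x
  | _, _ => ⟨0, 0, 0, 0, 0, 0, 0, 0⟩

theorem toVec_combination {r : ℕ} (c : Fin r → ℕ) (f : Fin r → Digits) :
    (combination (List.ofFn c) (List.ofFn f)).toVec = ∑ i, (c i : ZMod 3) • (f i).toVec := by
  induction r with
  | zero =>
    funext i
    fin_cases i <;> simp [combination, toVec]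
  | succ r ih =>
    rw [List.ofFn_succ, List.ofFn_succ, combination, toVec_addMul, ih, Fin.sum_univ_succ, add_comm]

/-- The digits modulo three of a tuple of integers. -/
def intDigits {r : ℕ} (v : Fin r → ℤ) : List ℕ := List.ofFn fun i => (v i % 3).toNat

theorem toNat_emod_cast (n : ℤ) : ((n % 3).toNat : ZMod 3) = n := by
  rw [← Int.cast_natCast, Int.toNat_of_nonneg (Int.emod_nonneg _ (by norm_num))]
  exact (ZMod.intCast_eq_intCast_iff' _ _ 3).2 (Int.emod_emod_of_dvd n (dvd_refl _))

/-- The scalar products with a prefix of the list agree with the given row. -/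
def compatible : List ℕ → List Digits → Digits → Bool
  | c :: cs, x :: xs, e => Nat.beq (x.dot e) c && (!x.eqb e && compatible cs xs e)
  | _, _, _ => true

/-- The given classes are those of a basis of the root system `R` of type `k`. -/
noncomputable def isBasis (k : GaugeCase) (R l : List Digits) : Bool :=
  Nat.beq l.length k.rank && (l.all (fun e => e.memb R) &&
    ((List.ofFn fun i : Fin k.rank => List.ofFn fun j : Fin k.rank =>
      Nat.beq ((l.getD i (ofNat 0)).dot (l.getD j (ofNat 0))) ((k.cartanMatrix i j % 3).toNat) &&
        -- Distinctness is tested separately because the scalar products 2 and -1 coincide modulo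
        -- three.
        (Nat.beq i j || !(l.getD i (ofNat 0)).eqb (l.getD j (ofNat 0)))).all (·.all id) &&
      R.all fun e => e.memb (k.roots.map fun v => combination (intDigits v) l)))

/-- The search for a basis. -/
noncomputable def findBasis (k : GaugeCase) (R : List Digits) : List (List ℕ) → List Digits → Bool
  | [], l => isBasis k R l
  | row :: rows, l => existsIn (fun e => compatible row l e && findBasis k R rows (l ++ [e])) R

/-- The pruning of the search needs no justification, since `isBasis` tests the completed list. -/
theorem exists_isBasis {k : GaugeCase} {R : List Digits} {rows : List (List ℕ)} {l : List Digits}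
    (h : findBasis k R rows l = true) : ∃ l, isBasis k R l = true := by
  induction rows generalizing l with
  | nil => exact ⟨l, h⟩
  | cons row rows ih =>
    obtain ⟨e, -, h⟩ := existsIn_iff.1 h
    exact ih (Bool.and_eq_true _ _ ▸ h).2

/-- The roots orthogonal modulo three to the three vectors are a root system of type `k`. -/
noncomputable def gaugeCheck (k : GaugeCase) (x y z : Digits) : Bool :=
  findBasis k (rootDigits.filter fun e =>
    Nat.beq (e.dot x) 0 && (Nat.beq (e.dot y) 0 && Nat.beq (e.dot z) 0))
    (List.ofFn fun i => intDigits (k.cartanMatrix i)) []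

theorem residue_rootComb {r : ℕ} (β : Fin r → Root) (v : Fin r → ℤ) :
    residue (rootComb β v) = ∑ i, (v i : ZMod 3) • residue (β i).1 := by
  have h0 : residue 0 = 0 := by simpa using residue_smul 0 0
  rw [rootComb]
  induction (Finset.univ : Finset (Fin r)) using Finset.induction_on with
  | empty => simpa using h0
  | insert i s hi ih => rw [Finset.sum_insert hi, Finset.sum_insert hi, residue_add, ih,
      residue_smul]

theorem GaugeCase.cartanMatrix_self (k : GaugeCase) (i : Fin k.rank) : k.cartanMatrix i i = 2 := by
  cases k <;> revert i <;> decide +kernel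

theorem GaugeCase.cartanMatrix_of_ne (k : GaugeCase) {i j : Fin k.rank} (h : i ≠ j) :
    k.cartanMatrix i j = 0 ∨ k.cartanMatrix i j = -1 := by
  have key : ∀ p : Fin k.rank × Fin k.rank, p.1 ≠ p.2 →
      k.cartanMatrix p.1 p.2 = 0 ∨ k.cartanMatrix p.1 p.2 = -1 := by
    cases k <;> decide +kernel
  exact key (i, j) h

/-- Distinct roots pair to a number between -2 and 1, where 0 and -1 are each alone in their class
modulo three. -/
theorem pairing_eq_of_residue {α β : Root} (h : α ≠ β) {c : ℤ} (hc : c = 0 ∨ c = -1)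
    (hd : ((pairing α.1 β.1 : ℤ) : ZMod 3) = c) : pairing α.1 β.1 = c := by
  have h1 := pairing_ge α β
  have h2 := pairing_le α β
  have h3 : pairing α.1 β.1 ≠ 2 := fun e => h (eq_of_pairing α β e)
  have h4 := (ZMod.intCast_eq_intCast_iff_dvd_sub _ _ 3).1 hd
  push_cast at h4
  omega

/-- The Gram matrix lifts to the integers by `pairing_eq_of_residue`. A listed combination has norm
two, so it is a root, and a root congruent to it must equal it. Conversely, combinations of roots
orthogonal to the triple remain orthogonal. -/
theorem hasBasis_of_gaugeCheck {k : GaugeCase} {t : Triple}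
    (h : gaugeCheck k (ofVec (t 0)) (ofVec (t 1)) (ofVec (t 2)) = true) :
    HasBasis t.rootSet k.cartanMatrix k.roots := by
  have hR : ∀ α : Root, α ∈ t.rootSet ↔ ofVec (residue α.1) ∈ rootDigits.filter fun e =>
      Nat.beq (e.dot (ofVec (t 0))) 0 &&
        (Nat.beq (e.dot (ofVec (t 1))) 0 && Nat.beq (e.dot (ofVec (t 2))) 0) := fun α => by
    rw [List.mem_filter, and_iff_right (residue_mem_rootDigits α)]
    simp only [Bool.and_eq_true, Nat.beq_eq, dot_ofVec, ZMod.val_eq_zero, Triple.rootSet,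
      Set.mem_ofPred_eq, Fin.forall_fin_succ]
    simp
  obtain ⟨l, hl⟩ := exists_isBasis h
  simp only [isBasis, Bool.and_eq_true, Nat.beq_eq, List.all_eq_true, memb_iff, List.mem_ofFn] at hl
  obtain ⟨hlen, hmem, hgram, hcomb⟩ := hl
  obtain ⟨f, rfl⟩ : ∃ f : Fin k.rank → Digits, l = List.ofFn f :=
    ⟨fun i => l[i]'(by omega), by
      apply List.ext_getElem
      · simp [hlen]
      · intro n h1 h2; simp⟩
  have hf : ∀ i, ∃ α : Root, ofVec (residue α.1) = f i := fun i =>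
    exists_residue_of_mem (List.mem_filter.1 (hmem (f i) (List.mem_ofFn.2 ⟨i, rfl⟩))).1
  choose β hβ using hf
  have hget : ∀ i : Fin k.rank, (List.ofFn f).getD i (ofNat 0) = ofVec (residue (β i).1) :=
    fun i => by simp [List.getD, hβ]
  have hC : ∀ i j, pairing (β i).1 (β j).1 = k.cartanMatrix i j := fun i j => by
    have h1 := hgram _ ⟨i, rfl⟩ _ (List.mem_ofFn.2 ⟨j, rfl⟩)
    rw [id, Bool.and_eq_true, Bool.or_eq_true, hget, hget, Nat.beq_eq, Nat.beq_eq, dot_ofVec] at h1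
    obtain ⟨h1, h2⟩ := h1
    by_cases hij : i = j
    · rw [hij, k.cartanMatrix_self, (β j).2]
    refine pairing_eq_of_residue ?_ (k.cartanMatrix_of_ne hij) ?_
    · rintro e
      rcases h2 with h2 | h2
      · exact hij (Fin.ext h2)
      · rw [e, eqb_iff.2 rfl] at h2
        exact absurd h2 (by decide)
    · rw [← toNat_emod_cast (k.cartanMatrix i j), ← h1, ← residue_dot, ZMod.natCast_zmod_val]
  refine ⟨β, hC, fun α => ⟨fun hα => ?_, ?_⟩⟩
  · obtain ⟨v, hv, e⟩ := List.mem_map.1 (hcomb _ ((hR α).1 hα))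
    refine ⟨v, hv, ?_⟩
    have hnorm : pairing (rootComb β v) (rootComb β v) = 2 := by
      rw [pairing_rootComb hC, k.norm_roots v hv]
    have hres : residue α.1 = residue (rootComb β v) := by
      rw [← toVec_ofVec (residue α.1), ← e, intDigits, toVec_combination, residue_rootComb]
      refine Finset.sum_congr rfl fun i _ => ?_
      rw [toNat_emod_cast, ← hβ, toVec_ofVec]
    exact congrArg Subtype.val (residue_injective_root (a₁ := α) (a₂ := ⟨_, hnorm⟩) hres)
  · rintro ⟨v, hv, e⟩ i
    rw [e, residue_rootComb, sum_dotProduct]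
    refine Finset.sum_eq_zero fun j _ => ?_
    have hj : β j ∈ t.rootSet := (hR _).2 (hβ j ▸ hmem (f j) (List.mem_ofFn.2 ⟨j, rfl⟩))
    rw [smul_dotProduct, hj i, smul_zero]

end RootSystems

end HiddenSector

/-! ### Completeness of the list -/

namespace HiddenSector

section Completeness

open Digits

/-- The first step depends only on the norm of `3V` modulo three, so one check serves four
observable embeddings and `orbitCheck_two` serves the other two. -/
theorem orbitCheck_zero : orbitCheck 0 [] firstWords [ofNat 0, ofNat 5346] = true := by
  decide +kernel

theorem orbitCheck_two : orbitCheck 2 [] firstWords [ofNat 2916, ofNat 5454] = true := by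
  decide +kernel

theorem firstCheck_eq_true : ∀ c, firstCheck c = true
  | .cmm1 | .cmm2 | .cmm4 | .cmm6 => orbitCheck_zero
  | .cmm8 | .cmm9 => orbitCheck_two

theorem branchCheck_cmm1 : branchCheck .cmm1 = true := by decide +kernel

theorem branchCheck_cmm2 : branchCheck .cmm2 = true := by decide +kernel

theorem branchCheck_cmm4 : branchCheck .cmm4 = true := by decide +kernel

theorem branchCheck_cmm6 : branchCheck .cmm6 = true := by decide +kernel

theorem branchCheck_cmm8 : branchCheck .cmm8 = true := by decide +kernel

theorem branchCheck_cmm9 : branchCheck .cmm9 = true := by decide +kernel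

theorem branchCheck_eq_true : ∀ c, branchCheck c = true
  | .cmm1 => branchCheck_cmm1
  | .cmm2 => branchCheck_cmm2
  | .cmm4 => branchCheck_cmm4
  | .cmm6 => branchCheck_cmm6
  | .cmm8 => branchCheck_cmm8
  | .cmm9 => branchCheck_cmm9

theorem Triple.Completes.dot {t : Triple} {c : CMM} (h : t.Completes c) (i j : Fin 3) :
    (ofVec (t i)).dot (ofVec (t j)) = gramDigit c i j := by
  rw [dot_ofVec, h]; rfl

/-- Three times the vectors of an entry. -/
def TableEntry.thirds (e : TableEntry) : Fin 3 → Fin 8 → ℤ := ![e.V, e.a₁, e.a₃]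

/-- The classes modulo three of the vectors of an entry. -/
def TableEntry.triple (e : TableEntry) : Triple := fun i k => (e.thirds i k : ZMod 3)

theorem TableEntry.ofVec_triple (e : TableEntry) (i : Fin 3) :
    ofVec (e.triple i) = digitsOfInt (e.thirds i) := (digitsOfInt_eq _).symm

/-- The descent is applied to the three vectors in turn, each time with words fixing those already
placed. At the end all three classes agree with those of a line of the list. -/
theorem exists_entry {t : Triple} {c : CMM} (ht : t.Completes c) :
    ∃ e ∈ completeTable, e.cmm = c ∧ t.Equiv e.triple := by
  obtain ⟨t₀, h₀, -, m₀⟩ := exists_equiv_mem (firstCheck_eq_true c) 0 t (ht.dot 0 0)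
    (by simp) (fun i hi => absurd hi (Fin.not_lt_zero i))
  obtain ⟨⟨v, w, l⟩, hb, e₀⟩ := List.mem_map.1 m₀
  have hc := List.all_eq_true.1 (branchCheck_eq_true c) _ hb
  rw [Bool.and_eq_true] at hc
  obtain ⟨hA, hB⟩ := hc
  have ht₀ := ht.of_equiv h₀
  obtain ⟨t₁, h₁, f₁, m₁⟩ := exists_equiv_mem hA 1 t₀ (ht₀.dot 1 1)
    (fun f hf => ⟨0, by decide, by
      rw [List.mem_singleton.1 hf]; exact ⟨e₀.symm, ht₀.dot 1 0⟩⟩)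
    (fun i hi => ⟨_, List.mem_singleton.2 rfl, by
      rw [show i = 0 by omega]; exact e₀.symm⟩)
  obtain ⟨⟨a, w'⟩, hl, e₁⟩ := List.mem_map.1 m₁
  have hC := List.all_eq_true.1 hB _ hl
  have ht₁ := ht₀.of_equiv h₁
  have e₀' : ofVec (t₁ 0) = ofNat v := by rw [f₁ 0 (by decide)]; exact e₀.symm
  obtain ⟨t₂, h₂, f₂, m₂⟩ := exists_equiv_mem hC 2 t₁ (ht₁.dot 2 2)
    (by
      simp only [List.forall_mem_cons]
      exact ⟨⟨0, by decide, e₀', ht₁.dot 2 0⟩, ⟨1, by decide, e₁.symm, ht₁.dot 2 1⟩, by simp⟩)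
    (fun i hi => by
      obtain rfl | rfl : i = 0 ∨ i = 1 := by omega
      · exact ⟨_, List.mem_cons_self, e₀'⟩
      · exact ⟨_, List.mem_cons_of_mem _ (List.mem_singleton.2 rfl), e₁.symm⟩)
  obtain ⟨e, he, e₂⟩ := List.mem_map.1 m₂
  rw [List.mem_filter, Bool.and_eq_true, Bool.and_eq_true, decide_eq_true_eq, eqb_iff,
    eqb_iff] at he
  obtain ⟨he, hcmm, hv, ha⟩ := he
  refine ⟨e, he, hcmm, ?_⟩
  have : t₂ = e.triple := by
    funext i
    apply ofVec_injective
    rw [e.ofVec_triple]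
    obtain rfl | rfl | rfl : i = 0 ∨ i = 1 ∨ i = 2 := by omega
    · rw [f₂ 0 (by decide), e₀']; exact hv.symm
    · rw [f₂ 1 (by decide)]; exact e₁.symm.trans ha.symm
    · exact e₂.symm
  exact this ▸ (h₀.trans h₁).trans h₂

end Completeness

/-! ### Verification of the list -/

section Table

open Digits

/-- The vectors of the entry have even sums of coordinates and the scalar products required by
consistency. -/
def TableEntry.check (e : TableEntry) : Bool :=
  (List.finRange 3).all fun i =>
    decide ((e.thirds i 0 + e.thirds i 1 + e.thirds i 2 + e.thirds i 3 + e.thirds i 4 +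
      e.thirds i 5 + e.thirds i 6 + e.thirds i 7) % 2 = 0) &&
    (List.finRange 3).all fun j =>
      Nat.beq ((digitsOfInt (e.thirds i)).dot (digitsOfInt (e.thirds j))) (gramDigit e.cmm i j)

/-- A number which determines the vectors of an entry. -/
def TableEntry.code (e : TableEntry) : ℤ :=
  (List.finRange 3).foldl (fun a i => (List.finRange 8).foldl (fun a k => 7 * a + e.thirds i k) a)
    e.cmm.ctorIdx

theorem completeTable_check : completeTable.all TableEntry.check = true := by decide +kernel

theorem completeTable_gaugeCheck : (completeTable.all fun e =>
    gaugeCheck e.gaugeCase (digitsOfInt e.V) (digitsOfInt e.a₁) (digitsOfInt e.a₃)) = true := by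
  decide +kernel

/-- The code ignores the label of the gauge group and depends only on the model. Hence distinct
codes show that the models are distinct, not merely the lines. -/
theorem nodup_code : (completeTable.map TableEntry.code).Nodup := by decide +kernel

theorem length_displayedTable : displayedTable.length = 175 := by decide +kernel

theorem length_completeTable : completeTable.length = 192 := by decide +kernel

theorem displayedTable_gaugeCase : ∀ e ∈ displayedTable, e.gaugeCase ≠ .case5 := by decide +kernel

theorem caseFiveTable_gaugeCase : ∀ e ∈ caseFiveTable, e.gaugeCase = .case5 := by decide +kernel

theorem exists_gaugeCase (k : GaugeCase) (hk : k ≠ .case5) :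
    ∃ e ∈ displayedTable, e.gaugeCase = k := by
  cases k
  case case5 => exact absurd rfl hk
  all_goals decide +kernel

theorem exists_caseFive : ∃ e ∈ caseFiveTable, e.gaugeCase = .case5 := by decide +kernel

variable {e e' : TableEntry}

theorem hasClass_of_mem (he : e ∈ completeTable) : e.model.2.HasClass e.triple := by
  have h : ∀ i, Even (∑ k, e.thirds i k) := fun i => by
    have h1 := List.all_eq_true.1 (List.all_eq_true.1 completeTable_check e he) i
      (List.mem_finRange i)
    rw [Bool.and_eq_true, decide_eq_true_eq] at h1
    rw [Fin.sum_univ_eight]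
    exact Int.even_iff.2 h1.1
  exact ⟨isClass_third (h 0), isClass_third (h 1), isClass_third (h 2)⟩

theorem completes_of_mem (he : e ∈ completeTable) : e.triple.Completes e.cmm := fun i j => by
  have h1 := List.all_eq_true.1 (List.all_eq_true.1 completeTable_check e he) i
    (List.mem_finRange i)
  rw [Bool.and_eq_true] at h1
  have h2 := List.all_eq_true.1 h1.2 j (List.mem_finRange j)
  rw [Nat.beq_eq, ← e.ofVec_triple, ← e.ofVec_triple, dot_ofVec] at h2
  exact ZMod.val_injective 3 h2

theorem consistent_of_mem (he : e ∈ completeTable) : e.model.Consistent :=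
  (isConsistent_iff (hasClass_of_mem he)).2 (completes_of_mem he)

theorem hasBasis_of_mem (he : e ∈ completeTable) :
    HasBasis e.triple.rootSet e.gaugeCase.cartanMatrix e.gaugeCase.roots := by
  apply hasBasis_of_gaugeCheck
  rw [e.ofVec_triple, e.ofVec_triple, e.ofVec_triple]
  exact List.all_eq_true.1 completeTable_gaugeCheck e he

theorem hasGaugeGroup_of_mem (he : e ∈ completeTable) : HasGaugeGroup e.model.2 e.gaugeCase :=
  hasGaugeGroup_of_basis (rootSet_eq_of_hasClass (hasClass_of_mem he) ▸ hasBasis_of_mem he)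

/-- Showing that a group is not that of Case 5 rests on the uniqueness of the label. -/
theorem isViable_iff_of_mem (he : e ∈ completeTable) :
    IsViable e.model.2 ↔ e.gaugeCase ≠ .case5 :=
  not_congr ⟨fun h => hasGaugeGroup_unique (hasGaugeGroup_of_mem he) h,
    fun h => h ▸ hasGaugeGroup_of_mem he⟩

theorem third_injective {v w : Fin 8 → ℤ}
    (h : (fun I => (v I : ℝ) / 3) = fun I => (w I : ℝ) / 3) : v = w := by
  funext i
  have h₁ : (v i : ℝ) / 3 = (w i : ℝ) / 3 := congrFun h i
  have h' : (v i : ℝ) = w i := by linarith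
  exact_mod_cast h'

theorem code_eq_of_model_eq (h : e.model = e'.model) : e.code = e'.code := by
  have hc : e.cmm = e'.cmm := congrArg Prod.fst h
  have hV : e.V = e'.V := third_injective (congrArg (fun m : Model => m.2.V) h)
  have h₁ : e.a₁ = e'.a₁ := third_injective (congrArg (fun m : Model => m.2.a₁) h)
  have h₃ : e.a₃ = e'.a₃ := third_injective (congrArg (fun m : Model => m.2.a₃) h)
  simp only [TableEntry.code, TableEntry.thirds, hc, hV, h₁, h₃]

theorem eq_of_model_eq (he : e ∈ completeTable) (he' : e' ∈ completeTable)
    (h : e.model = e'.model) : e = e' :=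
  List.inj_on_of_nodup_map nodup_code he he' (code_eq_of_model_eq h)

theorem nodup_completeTable : completeTable.Nodup := nodup_code.of_map

theorem nodup_displayedTable : displayedTable.Nodup :=
  (List.nodup_append.1 nodup_completeTable).1

theorem mem_completeTable_of_mem (he : e ∈ displayedTable) : e ∈ completeTable :=
  List.mem_append_left _ he

open Classical in
/-- The models given by the entries of a list. -/
noncomputable def modelsOf (l : List TableEntry) : Finset Model :=
  (l.map TableEntry.model).toFinset

open Classical in
theorem mem_modelsOf {l : List TableEntry} {m : Model} :
    m ∈ modelsOf l ↔ ∃ e ∈ l, e.model = m := by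
  rw [modelsOf, List.mem_toFinset, List.mem_map]

open Classical in
theorem card_modelsOf {l : List TableEntry} (hl : ∀ e ∈ l, e ∈ completeTable) (h : l.Nodup) :
    (modelsOf l).card = l.length := by
  rw [modelsOf, List.toFinset_card_of_nodup, List.length_map]
  exact h.map_on fun _ h _ h' => eq_of_model_eq (hl _ h) (hl _ h')

/-- The models of the complete list. -/
noncomputable def completeModels : Finset Model := modelsOf completeTable

theorem mem_completeModels {m : Model} :
    m ∈ completeModels ↔ ∃ e ∈ completeTable, e.model = m := mem_modelsOf

theorem card_completeModels : completeModels.card = 192 :=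
  (card_modelsOf (fun _ h => h) nodup_completeTable).trans length_completeTable

theorem viable_eq : {m | m ∈ completeModels ∧ IsViable m.2} =
    {m | ∃ t ∈ displayedTable, t.model = m} := by
  ext m
  simp only [Set.mem_ofPred_eq, mem_completeModels]
  constructor
  · rintro ⟨⟨e, he, rfl⟩, hv⟩
    rw [isViable_iff_of_mem he] at hv
    rcases List.mem_append.1 he with h | h
    · exact ⟨e, h, rfl⟩
    · exact absurd (caseFiveTable_gaugeCase e h) hv
  · rintro ⟨e, he, rfl⟩
    exact ⟨⟨e, mem_completeTable_of_mem he, rfl⟩,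
      (isViable_iff_of_mem (mem_completeTable_of_mem he)).2 (displayedTable_gaugeCase e he)⟩

theorem ncard_displayed : {m | ∃ t ∈ displayedTable, t.model = m}.ncard = 175 := by
  have h : {m | ∃ t ∈ displayedTable, t.model = m} = (modelsOf displayedTable : Set Model) :=
    Set.ext fun m => mem_modelsOf.symm
  rw [h, Set.ncard_coe_finset, card_modelsOf (fun _ => mem_completeTable_of_mem)
    nodup_displayedTable, length_displayedTable]

/-- The gauge group of `E` is obtained by transporting the basis of its root system from the entry,
so equivalences need not be realised on the Lie algebra. -/
theorem exists_entry_of_isConsistent {c : CMM} {E : Embedding}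
    (h : IsConsistent c.observable E) :
    ∃ e ∈ completeTable, e.cmm = c ∧ Equivalent E e.model.2 ∧ HasGaugeGroup E e.gaugeCase := by
  obtain ⟨t, hE, ht⟩ := exists_hasClass h
  obtain ⟨e, he, hc, heq⟩ := exists_entry ht
  refine ⟨e, he, hc, equivalent_of_equiv heq hE (hasClass_of_mem he), hasGaugeGroup_of_basis ?_⟩
  rw [rootSet_eq_of_hasClass hE]
  exact (heq.hasBasis_iff _ _).2 (hasBasis_of_mem he)

end Table

end HiddenSector

theorem mainTheorem2 :
    -- every consistent hidden embedding has exactly one of the five gauge groups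
    (∀ (c : HiddenSector.CMM) (E : HiddenSector.Embedding),
      HiddenSector.IsConsistent c.observable E → ∃! k, HiddenSector.HasGaugeGroup E k) ∧
    -- the 175 displayed embeddings are consistent and have the gauge groups listed for them
    (HiddenSector.displayedTable.length = 175 ∧ HiddenSector.displayedTable.Nodup ∧
      ∀ t ∈ HiddenSector.displayedTable,
        t.model.Consistent ∧ HiddenSector.HasGaugeGroup t.model.2 t.gaugeCase) ∧
    -- they are the viable members of a list of 192 which is complete up to equivalence
    ∃ models : Finset HiddenSector.Model,
      models.card = 192 ∧
      (∀ m ∈ models, m.Consistent) ∧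
      (∀ (c : HiddenSector.CMM) (E : HiddenSector.Embedding),
        HiddenSector.IsConsistent c.observable E →
          ∃ E', (c, E') ∈ models ∧ HiddenSector.Equivalent E E') ∧
      {k | ∃ m ∈ models, HiddenSector.HasGaugeGroup m.2 k} =
        {.case1, .case2, .case3, .case4, .case5} ∧
      {m | m ∈ models ∧ HiddenSector.IsViable m.2} =
        {m | ∃ t ∈ HiddenSector.displayedTable, t.model = m} ∧
      {m | m ∈ models ∧ HiddenSector.IsViable m.2}.ncard = 175 ∧
      {k | ∃ m ∈ models, HiddenSector.IsViable m.2 ∧ HiddenSector.HasGaugeGroup m.2 k} =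
        {.case1, .case2, .case3, .case4} := by
  open HiddenSector in
  refine ⟨fun c E h => ?_, ⟨length_displayedTable, nodup_displayedTable, fun t ht => ?_⟩,
    completeModels, card_completeModels, fun m hm => ?_, fun c E h => ?_, ?_, viable_eq, ?_, ?_⟩
  · obtain ⟨e, -, -, -, hE⟩ := exists_entry_of_isConsistent h
    exact ⟨_, hE, fun k hk => hasGaugeGroup_unique hk hE⟩
  · exact ⟨consistent_of_mem (mem_completeTable_of_mem ht),
      hasGaugeGroup_of_mem (mem_completeTable_of_mem ht)⟩
  · obtain ⟨e, he, rfl⟩ := mem_completeModels.1 hm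
    exact consistent_of_mem he
  · obtain ⟨e, he, rfl, hE, -⟩ := exists_entry_of_isConsistent h
    exact ⟨_, mem_completeModels.2 ⟨e, he, rfl⟩, hE⟩
  · refine Set.eq_of_subset_of_subset (fun k _ => by cases k <;> simp) fun k _ => ?_
    by_cases hk : k = .case5
    · subst hk
      obtain ⟨e, he, h⟩ := exists_caseFive
      have he' : e ∈ completeTable := List.mem_append_right _ he
      exact ⟨_, mem_completeModels.2 ⟨e, he', rfl⟩, h ▸ hasGaugeGroup_of_mem he'⟩
    · obtain ⟨e, he, rfl⟩ := exists_gaugeCase k hk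
      have he' := mem_completeTable_of_mem he
      exact ⟨_, mem_completeModels.2 ⟨e, he', rfl⟩, hasGaugeGroup_of_mem he'⟩
  · rw [viable_eq, ncard_displayed]
  · refine Set.eq_of_subset_of_subset ?_ fun k hk => ?_
    · rintro k ⟨m, hm, hv, hk⟩
      have : k ≠ .case5 := fun h => hv (h ▸ hk)
      cases k <;> simp at this ⊢
    · have hk' : k ≠ .case5 := by
        rintro rfl
        simp at hk
      obtain ⟨e, he, rfl⟩ := exists_gaugeCase k hk'
      have he' := mem_completeTable_of_mem he
      exact ⟨_, mem_completeModels.2 ⟨e, he', rfl⟩, (isViable_iff_of_mem he').2 hk',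
        hasGaugeGroup_of_mem he'⟩
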